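/- Let $\mathbb D=\{x+\tau y : x,y\in\mathbb R\}$, $\tau^2=1$, be the algebra of para-complex numbers, and equip $\mathbb D^n$ with its canonical para-Kähler structure: $J(z_1,\dots,z_n)=(\tau z_1,\dots,\tau z_n)$, $\langle\cdot,\cdot\rangle=\sum_{j=1}^n dx_j^2-dy_j^2$, $\omega=\langle J\cdot,\cdot\rangle$. For $r>0$ put $$\mathbb H^1_+(r)=\{x+\tau y : x^2-y^2=r^2,\ x>0\},\qquad \mathbb H^1_-(r)=\{x+\tau y : x^2-y^2=-r^2,\ y>0\}.$$ For a Lagrangian submanifold $\mathcal L\subset\mathbb D^n$ (i.e. $\dim\mathcal L=n$ and $\omega|_{\mathcal L}=0$) with non-degenerate induced metric, let $\mathcal V$ be the volume with respect to the volume element of the induced metric, computed on compact portions of $\mathcal L$ containing the support of the variation. A Hamiltonian variation is a vector field $X$ on $\mathbb D^n$ with $X\lrcorner\,\omega=dF$ for some $F\in C_c^\infty(\mathbb D^n)$. The submanifold $\mathcal L$ is called *H-minimal* if $\frac{d}{dt}\mathcal V(\exp_t(X)(\mathcal L))|_{t=0}=0$ for every Hamiltonian variation $X$. An H-minimal $\mathcal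 L$ is called *H-stable* if the second variation $\delta^2\mathcal V(\mathcal L)(X)=\frac{d^2}{dt^2}\mathcal V(\exp_t(X)(\mathcal L))|_{t=0}$ is definite on Hamiltonian variations, that is, either positive for all Hamiltonian variations $X$ that are not everywhere tangent to $\mathcal L$, or negative for all of them. It is called *H-unstable* if $\delta^2\mathcal V(\mathcal L)$ is indefinite, that is, takes both positive and negative values on Hamiltonian variations whose restriction to $\mathcal L$ is normal to $\mathcal L$. **Theorem.** Let $r_1,\dots,r_n>0$, and let $\mathbb H^n_{r_1,\dots,r_n}=\mathbb H^1_{\pm}(r_1)\times\dots\times\mathbb H^1_{\pm}(r_n)\subset\mathbb D^n$ with an arbitrary choice of signs. Then $\mathbb H^n_{r_1,\dots,r_n}$ is an embedded submanifold diffeomorphic to $\mathbb R^n$, and it is Lagrangian and H-minimal. If $n=1$ or $n=2$ it is H-stable; if $n\ge 3$ it is H-unstable. -/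

import Mathlib

open scoped ContDiff Topology

/-! Para-complex numbers `x + τ y` are pairs `(x, y) : ℝ × ℝ` with the product `paraMul`
(the componentwise ring structure of `ℝ × ℝ` is not used). -/

/-- The para-complex product `(x, y) (x', y') = (x x' + y y', x y' + x' y)`. -/
def paraMul (z w : ℝ × ℝ) : ℝ × ℝ :=
  (z.1 * w.1 + z.2 * w.2, z.1 * w.2 + w.1 * z.2)

/-- The para-complex unit `τ`, with `τ² = 1`. -/
def paraTau : ℝ × ℝ := (0, 1)

/-- Conjugation `x + τ y ↦ x - τ y`. -/
def paraConj (z : ℝ × ℝ) : ℝ × ℝ := (z.1, -z.2)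

/-- Para-complex space `𝔻ⁿ`, a real vector space of dimension `2n`. -/
abbrev ParaSpace (n : ℕ) : Type := Fin n → ℝ × ℝ

/-- The canonical para-complex structure `J (z₁, …, zₙ) = (τ z₁, …, τ zₙ)`. -/
def paraJ {n : ℕ} (v : ParaSpace n) : ParaSpace n := fun j => paraMul paraTau (v j)

/-- The canonical neutral metric `∑ⱼ dxⱼ² - dyⱼ²`, as the real part of `∑ⱼ dzⱼ ⊗ dz̄ⱼ`. -/
def paraMetric {n : ℕ} (v w : ParaSpace n) : ℝ :=
  ∑ j, (paraMul (v j) (paraConj (w j))).1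

/-- The symplectic form `ω = ⟨J ·, ·⟩`. -/
def paraOmega {n : ℕ} (v w : ParaSpace n) : ℝ := paraMetric (paraJ v) w

/-- `f` is a smooth global parametrization of the `n`-dimensional embedded submanifold `L`
of `𝔻ⁿ`, defined on the whole of `ℝⁿ`. -/
structure IsGlobalParam {n : ℕ} (f : (Fin n → ℝ) → ParaSpace n) (L : Set (ParaSpace n)) :
    Prop where
  smooth : ContDiff ℝ ∞ f
  immersion : ∀ s, Function.Injective (fderiv ℝ f s)
  embedding : Topology.IsEmbedding f
  range_eq : Set.range f = L

/-- The matrix of the induced (pseudo-)metric, `g i j = ⟨∂ᵢ f, ∂ⱼ f⟩`. -/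
noncomputable def inducedMetric {n : ℕ} (f : (Fin n → ℝ) → ParaSpace n) (s : Fin n → ℝ) :
    Matrix (Fin n) (Fin n) ℝ :=
  Matrix.of fun i j =>
    paraMetric (fderiv ℝ f s (Pi.single i 1)) (fderiv ℝ f s (Pi.single j 1))

/-- The volume of the portion `f(K)` with respect to the volume element `|det g|^{1/2} ds` of
the induced metric. -/
noncomputable def inducedVolume {n : ℕ} (K : Set (Fin n → ℝ))
    (f : (Fin n → ℝ) → ParaSpace n) : ℝ :=
  ∫ s in K, Real.sqrt |(inducedMetric f s).det|

/-- The symplectic form vanishes on the tangent spaces of the (`n`-dimensional) submanifold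
parametrized by `f`. -/
def IsLagrangianParam {n : ℕ} (f : (Fin n → ℝ) → ParaSpace n) : Prop :=
  ∀ s v w, paraOmega (fderiv ℝ f s v) (fderiv ℝ f s w) = 0

/-- `X` is the Hamiltonian vector field, `X ⌟ ω = dF`, of the compactly supported smooth
function `F` on `𝔻ⁿ`. -/
structure IsHamiltonianField {n : ℕ} (F : ParaSpace n → ℝ) (X : ParaSpace n → ParaSpace n) :
    Prop where
  smooth : ContDiff ℝ ∞ F
  compactSupport : HasCompactSupport F
  contract : ∀ z v, paraOmega (X z) v = fderiv ℝ F z v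

/-- `Φ t = exp_t(X) ∘ f` for all `t` near `0`: the parametrization `f` is transported by the
flow of the vector field `X`. -/
def IsFlowVariation {n : ℕ} (f : (Fin n → ℝ) → ParaSpace n) (X : ParaSpace n → ParaSpace n)
    (Φ : ℝ → (Fin n → ℝ) → ParaSpace n) : Prop :=
  ∃ δ : ℝ, 0 < δ ∧
    ContDiffOn ℝ ∞ (fun p : ℝ × (Fin n → ℝ) => Φ p.1 p.2) (Set.Ioo (-δ) δ ×ˢ Set.univ) ∧
    (∀ s, Φ 0 s = f s) ∧
    ∀ t ∈ Set.Ioo (-δ) δ, ∀ s, HasDerivAt (fun t' => Φ t' s) (X (Φ t s)) t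

/-- The triples (Hamiltonian, its vector field, the induced variation of `f`) along which the
volume of the submanifold parametrized by `f` is varied. -/
structure IsHamiltonianVariation {n : ℕ} (f : (Fin n → ℝ) → ParaSpace n)
    (F : ParaSpace n → ℝ) (X : ParaSpace n → ParaSpace n)
    (Φ : ℝ → (Fin n → ℝ) → ParaSpace n) : Prop where
  hamiltonian : IsHamiltonianField F X
  flow : IsFlowVariation f X Φ

/-- `V` is differentiable near `t₀`, and twice differentiable at `t₀` with second
derivative `c`. -/
def HasSecondDerivAt (V : ℝ → ℝ) (c t₀ : ℝ) : Prop :=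
  ∃ V' : ℝ → ℝ, (∀ᶠ t in 𝓝 t₀, HasDerivAt V (V' t) t) ∧ HasDerivAt V' c t₀

/-- The first variation of the volume along `Φ` equals `c`. As the total volume may be infinite,
it is computed on compact portions `K` outside which the variation is trivial. -/
def HasFirstVariation {n : ℕ} (f : (Fin n → ℝ) → ParaSpace n) (F : ParaSpace n → ℝ)
    (Φ : ℝ → (Fin n → ℝ) → ParaSpace n) (c : ℝ) : Prop :=
  ∀ K : Set (Fin n → ℝ), IsCompact K → f ⁻¹' tsupport F ⊆ K →
    HasDerivAt (fun t => inducedVolume K (Φ t)) c 0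

/-- The second variation of the volume along `Φ` equals `c`. -/
def HasSecondVariation {n : ℕ} (f : (Fin n → ℝ) → ParaSpace n) (F : ParaSpace n → ℝ)
    (Φ : ℝ → (Fin n → ℝ) → ParaSpace n) (c : ℝ) : Prop :=
  ∀ K : Set (Fin n → ℝ), IsCompact K → f ⁻¹' tsupport F ⊆ K →
    HasSecondDerivAt (fun t => inducedVolume K (Φ t)) c 0

/-- H-minimal: a Lagrangian submanifold with non-degenerate induced metric which is a critical
point of the volume under compactly supported Hamiltonian variations. -/
def IsHMinimal {n : ℕ} (f : (Fin n → ℝ) → ParaSpace n) : Prop :=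
  IsLagrangianParam f ∧ (∀ s, (inducedMetric f s).det ≠ 0) ∧
    ∀ F X Φ, IsHamiltonianVariation f F X Φ → HasFirstVariation f F Φ 0

/-- `X` is not everywhere tangent to the submanifold parametrized by `f`, i.e. (for a
non-degenerate induced metric) its normal component is not identically zero. -/
def IsNontangent {n : ℕ} (f : (Fin n → ℝ) → ParaSpace n) (X : ParaSpace n → ParaSpace n) :
    Prop :=
  ∃ s, X (f s) ∉ Set.range (fderiv ℝ f s)

/-- `X` is normal along the submanifold parametrized by `f`. -/
def IsNormalAlong {n : ℕ} (f : (Fin n → ℝ) → ParaSpace n) (X : ParaSpace n → ParaSpace n) :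
    Prop :=
  ∀ s v, paraMetric (X (f s)) (fderiv ℝ f s v) = 0

/-- H-stable: H-minimal, and the second variation of the volume is definite (positive or
negative) on Hamiltonian variations. Fields tangent to the submanifold do not move it to first
order and play the role of the zero vector. -/
def IsHStable {n : ℕ} (f : (Fin n → ℝ) → ParaSpace n) : Prop :=
  IsHMinimal f ∧
    ((∀ F X Φ, IsHamiltonianVariation f F X Φ → IsNontangent f X →
        ∃ c : ℝ, 0 < c ∧ HasSecondVariation f F Φ c) ∨
      (∀ F X Φ, IsHamiltonianVariation f F X Φ → IsNontangent f X →
        ∃ c : ℝ, c < 0 ∧ HasSecondVariation f F Φ c))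

/-- H-unstable: H-minimal, and the second variation is indefinite, i.e. takes both signs, already
on Hamiltonian variations that are normal along the submanifold. -/
def IsHUnstable {n : ℕ} (f : (Fin n → ℝ) → ParaSpace n) : Prop :=
  IsHMinimal f ∧
    (∃ F X Φ, IsHamiltonianVariation f F X Φ ∧ IsNormalAlong f X ∧
        ∃ c : ℝ, 0 < c ∧ HasSecondVariation f F Φ c) ∧
      (∃ F X Φ, IsHamiltonianVariation f F X Φ ∧ IsNormalAlong f X ∧
        ∃ c : ℝ, c < 0 ∧ HasSecondVariation f F Φ c)

/-- The hyperbola `ℍ¹₊(r) = {x² - y² = r², x > 0}`. -/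
def hyperbolaPlus (r : ℝ) : Set (ℝ × ℝ) := {z | z.1 ^ 2 - z.2 ^ 2 = r ^ 2 ∧ 0 < z.1}

/-- The hyperbola `ℍ¹₋(r) = {x² - y² = -r², y > 0}`. -/
def hyperbolaMinus (r : ℝ) : Set (ℝ × ℝ) := {z | z.1 ^ 2 - z.2 ^ 2 = -r ^ 2 ∧ 0 < z.2}

/-- The product of the hyperbolas of radii `r j`; the `j`-th factor is `ℍ¹₊(r j)` where `σ j` is
true and `ℍ¹₋(r j)` where it is false. -/
def hyperbolaProduct {n : ℕ} (σ : Fin n → Bool) (r : Fin n → ℝ) : Set (ParaSpace n) :=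
  {z | ∀ j, z j ∈ if σ j = true then hyperbolaPlus (r j) else hyperbolaMinus (r j)}

/-! In the null coordinates `p = x + y`, `q = x - y` of each factor, `2⟨v, w⟩ = ∑ (p q' + q p')` and
`2ω(v, w) = ∑ (p q' - q p')`. On a Lagrangian immersion the two halves of the first sum therefore
agree, the Gram matrix is `(∂p)(∂q)ᵀ`, and its determinant is a product of two ordinary Jacobians
(`det_inducedMetric`). The product of hyperbolas is `pₖ = rₖ e^{sₖ}`, `qₖ = ±rₖ e^{-sₖ}`: its
induced metric is flat, diagonal and constant, with entries `-εₖ`, where `εₖ = pₖ qₖ = ±rₖ²`.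

A Hamiltonian flow conserves `F`, so `ω(X, ∂ᵢΦ) = ∂ᵢu` holds at every time with the same `u`, the
restriction of `F` to the submanifold; this keeps the family Lagrangian, and its time derivative at
`0` controls the accelerations. The 2-jet of the volume density then follows from the 2-jets of two
determinants. Its first-order part is a divergence, which gives H-minimality. Its second-order part
is, up to divergences and with `wᵢ = ∂ᵢu / εᵢ`, minus a positive constant times `(∑ ∂ᵢwᵢ)² + Q(w)`,
where `Q(w) = 2 ∑ wᵢ² - (∑ wᵢ)²` (`integral_secondVariation`). Tangential parts of the variation
drop out.

Everything now depends on `Q`. For `n = 1` it is `w²`. For `n = 2` it is `(w₁ - w₂)²`, which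
vanishes identically only if `u` is constant along a fixed direction, hence zero by compact support.
So the second variation is negative (`hessianForm_pos`). For `n ≥ 3`, `Q` is `1` at `(1, 0, …)` and
`-3` at `(1, 1, 1, 0, …)`. Oscillating test functions carry these signs over to `∫ Q`, and dilation
makes the fourth-order term negligible, so both signs occur (`exists_hessianForm_pos`,
`exists_hessianForm_neg`). Such a `u` is realized by a normal Hamiltonian field: extended constantly
along rays of each factor, it has an explicit flow that fixes the hyperbolic angles and moves the
squared lengths linearly (`isHamiltonianVariation_radialFlow`).

The notions are formulated for a parametrization, so invariance under diffeomorphisms of `ℝⁿ`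
finally carries the result from the model to all global parametrizations. -/

open MeasureTheory

/-! ### Second order jets at `0` of functions of one real variable -/

/-- `f` is differentiable near `0` and twice differentiable at `0`, with value `a`, derivative `b`
and second derivative `c` at `0`. -/
def HasJetTwo (f : ℝ → ℝ) (a b c : ℝ) : Prop :=
  f 0 = a ∧ ∃ f' : ℝ → ℝ, (∀ᶠ t in 𝓝 0, HasDerivAt f (f' t) t) ∧ f' 0 = b ∧ HasDerivAt f' c 0

namespace HasJetTwo

variable {f g : ℝ → ℝ} {a b c a' b' c' : ℝ}

theorem congr (h : HasJetTwo f a b c) (hfg : f =ᶠ[𝓝 0] g) : HasJetTwo g a b c := by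
  obtain ⟨h0, f', h1, h2, h3⟩ := h
  refine ⟨by rw [← hfg.eq_of_nhds, h0], f', ?_, h2, h3⟩
  filter_upwards [h1, hfg.eventually_nhds] with t ht ht'
  exact ht.congr_of_eventuallyEq (ht'.mono fun _ h => h.symm)

theorem unique (h : HasJetTwo f a b c) (h' : HasJetTwo f a' b' c') : b = b' ∧ c = c' := by
  obtain ⟨-, f', h1, h2, h3⟩ := h
  obtain ⟨-, g', k1, k2, k3⟩ := h'
  have heq : f' =ᶠ[𝓝 0] g' := by
    filter_upwards [h1, k1] with t ht kt using ht.unique kt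
  exact ⟨by rw [← h2, ← k2, heq.eq_of_nhds],
    h3.unique (k3.congr_of_eventuallyEq heq)⟩

theorem mul (h : HasJetTwo f a b c) (h' : HasJetTwo g a' b' c') :
    HasJetTwo (fun t => f t * g t) (a * a') (b * a' + a * b') (c * a' + 2 * b * b' + a * c') := by
  obtain ⟨h0, f', h1, h2, h3⟩ := h
  obtain ⟨k0, g', k1, k2, k3⟩ := h'
  refine ⟨by simp [h0, k0], fun t => f' t * g t + f t * g' t, ?_, by simp [h0, h2, k0, k2], ?_⟩
  · filter_upwards [h1, k1] with t ht kt using ht.mul kt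
  · refine ((h3.mul k1.self_of_nhds).add (h1.self_of_nhds.mul k3)).congr_deriv ?_
    rw [h0, h2, k0, k2]; ring

theorem const (a : ℝ) : HasJetTwo (fun _ => a) a 0 0 :=
  ⟨rfl, fun _ => 0, .of_forall fun t => hasDerivAt_const t a, rfl, hasDerivAt_const 0 0⟩

theorem const_mul (h : HasJetTwo f a b c) (k : ℝ) :
    HasJetTwo (fun t => k * f t) (k * a) (k * b) (k * c) := by
  simpa using (const k).mul h

/-- The logarithmic derivative of `|f|` is `f' / f` whatever the sign of `f`, so writing the
derivative as `√|f| · f' / (2f)` covers both signs and can be differentiated again by the product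
rule. -/
theorem sqrt_abs (h : HasJetTwo f a b c) (ha : a ≠ 0) :
    HasJetTwo (fun t => √|f t|) (√|a|) (√|a| * (b / (2 * a)))
      (√|a| * (c / (2 * a) - b ^ 2 / (4 * a ^ 2))) := by
  obtain ⟨h0, f', h1, h2, h3⟩ := h
  have hf0 : f 0 ≠ 0 := by rwa [h0]
  have hne : ∀ᶠ t in 𝓝 0, f t ≠ 0 := h1.self_of_nhds.continuousAt.eventually_ne hf0
  have key : ∀ t, HasDerivAt f (f' t) t → f t ≠ 0 →
      HasDerivAt (fun t => √|f t|) (√|f t| * (f' t / (2 * f t))) t := by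
    intro t ht hft
    have hpos : ∀ {g : ℝ → ℝ} {g' : ℝ}, HasDerivAt g g' t → 0 < g t →
        HasDerivAt (fun t => √|g t|) (√|g t| * (g' / (2 * g t))) t := by
      intro g g' hg hgt
      have hev : (fun t => √|g t|) =ᶠ[𝓝 t] fun t => √(g t) := by
        filter_upwards [hg.continuousAt.eventually (lt_mem_nhds hgt)] with x hx
        rw [abs_of_pos hx]
      refine ((hg.sqrt hgt.ne').congr_of_eventuallyEq hev).congr_deriv ?_
      have hs := Real.sqrt_pos.2 hgt
      rw [abs_of_pos hgt, div_eq_iff (by positivity)]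
      have h2 := Real.mul_self_sqrt hgt.le
      field_simp
      linear_combination (-g') * h2
    -- The negative case is the positive one for `-f`.
    rcases hft.lt_or_gt with hlt | hgt
    · have := hpos ht.neg (by simpa using hlt)
      simp only [Pi.neg_apply, abs_neg] at this
      refine this.congr_deriv ?_
      rw [mul_neg, neg_div_neg_eq]
    · exact hpos ht hgt
  refine ⟨by simp [h0], fun t => √|f t| * (f' t / (2 * f t)), ?_, by simp [h0, h2], ?_⟩
  · filter_upwards [h1, hne] with t ht hft using key t ht hft
  · have hd := (key 0 h1.self_of_nhds hf0).mul
      (h3.div (h1.self_of_nhds.const_mul 2) (mul_ne_zero two_ne_zero hf0))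
    refine hd.congr_deriv ?_
    simp only [Pi.div_apply, h0, h2]
    field_simp
    ring

end HasJetTwo

/-! ### Derivatives of determinants -/

section Det

variable {ι : Type*} [Fintype ι] [DecidableEq ι]

/-- Jacobi's formula: the Leibniz expansion is differentiated one column at a time, and Cramer's
rule turns each column replacement into a diagonal entry of `adj M * M'`. -/
theorem hasDerivAt_det {M : ℝ → Matrix ι ι ℝ} {M' : Matrix ι ι ℝ} {t : ℝ}
    (h : ∀ i j, HasDerivAt (fun t => M t i j) (M' i j) t) :
    HasDerivAt (fun t => (M t).det) ((M t).adjugate * M').trace t := by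
  have h1 : HasDerivAt (fun t => (M t).det)
      (∑ i, ((M t).updateCol i fun k => M' k i).det) t := by
    simp only [Matrix.det_apply]
    rw [Finset.sum_comm]
    refine HasDerivAt.fun_sum fun σ _ => ?_
    have := (HasDerivAt.fun_finsetProd (u := Finset.univ) (f := fun i t => M t (σ i) i)
      (f' := fun i => M' (σ i) i) (x := t) fun i _ => h (σ i) i).fun_const_smul
        (Equiv.Perm.sign σ)
    refine this.congr_deriv ?_
    rw [Finset.smul_sum]
    refine Finset.sum_congr rfl fun i _ => congrArg _ ?_
    rw [← Finset.prod_erase_mul _ _ (Finset.mem_univ i), smul_eq_mul]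
    congr 1
    · refine Finset.prod_congr rfl fun j hj => ?_
      rw [Matrix.updateCol_ne (Finset.ne_of_mem_erase hj)]
    · rw [Matrix.updateCol_self]
  refine h1.congr_deriv ?_
  rw [Matrix.trace]
  refine Finset.sum_congr rfl fun i _ => ?_
  rw [← Matrix.cramer_apply, Matrix.cramer_eq_adjugate_mulVec]
  rfl

theorem HasJetTwo.det {M M₁ : ℝ → Matrix ι ι ℝ} {M₂ : Matrix ι ι ℝ} (h0 : M 0 = 1)
    (h1 : ∀ᶠ t in 𝓝 0, ∀ i j, HasDerivAt (fun t => M t i j) (M₁ t i j) t)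
    (h2 : ∀ i j, HasDerivAt (fun t => M₁ t i j) (M₂ i j) 0) :
    HasJetTwo (fun t => (M t).det) 1 (M₁ 0).trace
      ((M₁ 0).trace ^ 2 - (M₁ 0 * M₁ 0).trace + M₂.trace) := by
  refine ⟨by simp [h0], fun t => ((M t).adjugate * M₁ t).trace, ?_, by simp [h0], ?_⟩
  · filter_upwards [h1] with t ht using hasDerivAt_det ht
  have h1' := h1.self_of_nhds
  -- Entries of the adjugate are determinants of `M` with one row made constant. Only
  -- differentiability is needed here; the value of the derivative comes from the next identity.
  have hadj : ∀ i j, DifferentiableAt ℝ (fun t => (M t).adjugate i j) 0 := by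
    intro i j
    simp only [Matrix.adjugate_apply]
    refine (hasDerivAt_det (M' := (M₁ 0).updateRow j 0) fun k l => ?_).differentiableAt
    by_cases hk : k = j
    · subst hk
      simpa using hasDerivAt_const (0 : ℝ) _
    · simpa [Matrix.updateRow_ne hk] using h1' k l
  set A' : Matrix ι ι ℝ := Matrix.of fun i j => deriv (fun t => (M t).adjugate i j) 0
  have hA : ∀ i j, HasDerivAt (fun t => (M t).adjugate i j) (A' i j) 0 := fun i j =>
    (hadj i j).hasDerivAt
  -- Differentiate `adj M * M = det M • 1` at `M 0 = 1`.
  have hA'eq : A' = (M₁ 0).trace • (1 : Matrix ι ι ℝ) - M₁ 0 := by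
    ext i j
    have e1 : HasDerivAt (fun t => ∑ k, (M t).adjugate i k * M t k j)
        (∑ k, (A' i k * M 0 k j + (M 0).adjugate i k * M₁ 0 k j)) 0 :=
      HasDerivAt.fun_sum fun k _ => (hA i k).mul (h1' k j)
    have e2 : HasDerivAt (fun t => (M t).det * (1 : Matrix ι ι ℝ) i j)
        ((M₁ 0).trace * (1 : Matrix ι ι ℝ) i j) 0 := by
      have := (hasDerivAt_det h1').mul_const ((1 : Matrix ι ι ℝ) i j)
      simpa [h0] using this
    have e3 : (fun t => ∑ k, (M t).adjugate i k * M t k j)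
        = fun t => (M t).det * (1 : Matrix ι ι ℝ) i j := by
      funext t
      rw [← Matrix.mul_apply, Matrix.adjugate_mul, Matrix.smul_apply, smul_eq_mul]
    rw [e3] at e1
    have e4 := e1.unique e2
    rw [Finset.sum_add_distrib, ← Matrix.mul_apply, ← Matrix.mul_apply, h0] at e4
    simp at e4
    simp [← e4]
  have hfin : HasDerivAt (fun t => ∑ i, ∑ k, (M t).adjugate i k * M₁ t k i)
      (∑ i, ∑ k, (A' i k * M₁ 0 k i + (M 0).adjugate i k * M₂ k i)) 0 :=
    HasDerivAt.fun_sum fun i _ => HasDerivAt.fun_sum fun k _ => (hA i k).mul (h2 k i)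
  have e : ∑ i, ∑ k, (A' i k * M₁ 0 k i + (M 0).adjugate i k * M₂ k i)
      = (A' * M₁ 0).trace + ((M 0).adjugate * M₂).trace := by
    simp only [Matrix.trace, Matrix.diag, Matrix.mul_apply, Finset.sum_add_distrib]
  rw [e, hA'eq, h0] at hfin
  refine hfin.congr_deriv ?_
  simp [sub_mul, Matrix.trace_sub, sq]

end Det

/-! ### Directional derivatives and test functions -/

section Dir

variable {E : Type*} [NormedAddCommGroup E] [NormedSpace ℝ E]

/-- The derivative of `f` in the direction `v`. -/
noncomputable def dirDeriv (v : E) (f : E → ℝ) : E → ℝ := fun x => fderiv ℝ f x v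

theorem ContDiffOn.dirDeriv {f : E → ℝ} {U : Set E} (hf : ContDiffOn ℝ ∞ f U) (hU : IsOpen U)
    (v : E) : ContDiffOn ℝ ∞ (dirDeriv v f) U :=
  (hf.fderiv_of_isOpen hU (m := ∞) (by simp)).clm_apply contDiffOn_const

theorem ContDiff.dirDeriv {f : E → ℝ} (hf : ContDiff ℝ ∞ f) (v : E) :
    ContDiff ℝ ∞ (dirDeriv v f) :=
  (hf.fderiv_right (m := ∞) (by simp)).clm_apply contDiff_const

theorem ContDiffOn.differentiableAt_of_isOpen {f : E → ℝ} {U : Set E} (hf : ContDiffOn ℝ ∞ f U)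
    (hU : IsOpen U) {x : E} (hx : x ∈ U) : DifferentiableAt ℝ f x :=
  (hf.contDiffAt (hU.mem_nhds hx)).differentiableAt (by simp)

theorem ContDiff.dirDeriv_comm_at {f : E → ℝ} {x : E} (hf : ContDiffAt ℝ ∞ f x) (v w : E) :
    _root_.dirDeriv v (_root_.dirDeriv w f) x = _root_.dirDeriv w (_root_.dirDeriv v f) x := by
  have hsymm := hf.isSymmSndFDerivAt (by simpa using ENat.LEInfty.out)
  have hd : DifferentiableAt ℝ (fderiv ℝ f) x :=
    (hf.fderiv_right (m := ∞) (by simp)).differentiableAt (by simp)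
  have key : ∀ v w : E, _root_.dirDeriv v (_root_.dirDeriv w f) x
      = fderiv ℝ (fderiv ℝ f) x v w := by
    intro v w
    have : HasFDerivAt (_root_.dirDeriv w f) ((fderiv ℝ (fderiv ℝ f) x).flip w) x := by
      have := hd.hasFDerivAt.clm_apply (hasFDerivAt_const w x)
      rw [ContinuousLinearMap.comp_zero, zero_add] at this
      exact this
    rw [_root_.dirDeriv, this.fderiv]; rfl
  rw [key, key]
  exact hsymm v w

theorem dirDeriv_comm {f : E → ℝ} (hf : ContDiff ℝ ∞ f) (v w : E) :
    dirDeriv v (dirDeriv w f) = dirDeriv w (dirDeriv v f) :=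
  funext fun _ => ContDiff.dirDeriv_comm_at hf.contDiffAt v w

theorem dirDeriv_mul {f g : E → ℝ} {x : E} (hf : DifferentiableAt ℝ f x)
    (hg : DifferentiableAt ℝ g x) (v : E) :
    dirDeriv v (fun x => f x * g x) x = dirDeriv v f x * g x + f x * dirDeriv v g x := by
  simp only [dirDeriv, fderiv_fun_mul hf hg]
  simp; ring

theorem dirDeriv_const_mul {f : E → ℝ} {x : E} (hf : DifferentiableAt ℝ f x) (c : ℝ) (v : E) :
    dirDeriv v (fun x => c * f x) x = c * dirDeriv v f x := by
  simp only [dirDeriv, fderiv_const_mul hf]; simp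

theorem dirDeriv_add {f g : E → ℝ} {x : E} (hf : DifferentiableAt ℝ f x)
    (hg : DifferentiableAt ℝ g x) (v : E) :
    dirDeriv v (fun x => f x + g x) x = dirDeriv v f x + dirDeriv v g x := by
  simp only [dirDeriv, fderiv_fun_add hf hg]; simp

theorem dirDeriv_sub {f g : E → ℝ} {x : E} (hf : DifferentiableAt ℝ f x)
    (hg : DifferentiableAt ℝ g x) (v : E) :
    dirDeriv v (fun x => f x - g x) x = dirDeriv v f x - dirDeriv v g x := by
  simp only [dirDeriv, fderiv_fun_sub hf hg]; simp

theorem dirDeriv_neg (f : E → ℝ) (x : E) (v : E) :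
    dirDeriv v (fun x => -f x) x = -dirDeriv v f x := by
  simp [dirDeriv, fderiv_fun_neg]

theorem dirDeriv_congr {f g : E → ℝ} {x : E} (h : f =ᶠ[𝓝 x] g) (v : E) :
    dirDeriv v f x = dirDeriv v g x := by
  simp only [dirDeriv, h.fderiv_eq]

/-- Smooth functions with compact support. -/
structure IsTestFunction (f : E → ℝ) : Prop where
  smooth : ContDiff ℝ ∞ f
  compact : HasCompactSupport f

namespace IsTestFunction

variable {f g : E → ℝ}

theorem differentiableAt (hf : IsTestFunction f) (x : E) : DifferentiableAt ℝ f x :=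
  (hf.smooth.differentiable (by simp)) x

theorem dirDeriv (hf : IsTestFunction f) (v : E) : IsTestFunction (dirDeriv v f) :=
  ⟨hf.smooth.dirDeriv v, hf.compact.fderiv_apply ℝ v⟩

theorem add (hf : IsTestFunction f) (hg : IsTestFunction g) :
    IsTestFunction (fun x => f x + g x) :=
  ⟨hf.smooth.add hg.smooth, hf.compact.add hg.compact⟩

theorem mul_smooth (hf : IsTestFunction f) (hg : ContDiff ℝ ∞ g) :
    IsTestFunction (fun x => f x * g x) :=
  ⟨hf.smooth.mul hg, hf.compact.mul_right⟩

theorem mul (hf : IsTestFunction f) (hg : IsTestFunction g) :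
    IsTestFunction (fun x => f x * g x) := hf.mul_smooth hg.smooth

theorem const_mul (hf : IsTestFunction f) (c : ℝ) : IsTestFunction (fun x => c * f x) :=
  ⟨contDiff_const.mul hf.smooth, hf.compact.mul_left⟩

theorem neg (hf : IsTestFunction f) : IsTestFunction (fun x => -f x) := by
  simpa using hf.const_mul (-1)

theorem sub (hf : IsTestFunction f) (hg : IsTestFunction g) :
    IsTestFunction (fun x => f x - g x) := by
  simpa [sub_eq_add_neg] using hf.add hg.neg

theorem zero : IsTestFunction (fun _ : E => (0 : ℝ)) :=
  ⟨contDiff_const, HasCompactSupport.zero⟩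

theorem sum {ι : Type*} (s : Finset ι) {f : ι → E → ℝ} (hf : ∀ i, IsTestFunction (f i)) :
    IsTestFunction (fun x => ∑ i ∈ s, f i x) := by
  classical
  induction s using Finset.induction_on with
  | empty => simpa using zero
  | insert i s hi ih => simpa [Finset.sum_insert hi] using (hf i).add ih

theorem pow_two (hf : IsTestFunction f) : IsTestFunction (fun x => f x ^ 2) := by
  simpa [sq] using hf.mul hf

variable [MeasurableSpace E] [BorelSpace E] {μ : Measure E}

theorem integrable [IsFiniteMeasureOnCompacts μ] (hf : IsTestFunction f) : Integrable f μ :=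
  hf.smooth.continuous.integrable_of_hasCompactSupport hf.compact

/-- Integration by parts against the constant `1`. This is the only way in which divergence terms
are discarded below. -/
theorem integral_dirDeriv [FiniteDimensional ℝ E] [μ.IsAddHaarMeasure] (hf : IsTestFunction f)
    (v : E) : ∫ x, _root_.dirDeriv v f x ∂μ = 0 := by
  have h := integral_mul_fderiv_eq_neg_fderiv_mul_of_integrable (μ := μ) (𝕜 := ℝ)
    (f := fun _ : E => (1 : ℝ)) (g := f) (v := v) (by simp)
    (by simpa using! (hf.dirDeriv v).integrable) (by simpa using hf.integrable)
    (fun x _ => by fun_prop) (fun x _ => hf.differentiableAt x)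
  simpa [_root_.dirDeriv] using h

end IsTestFunction

end Dir

/-! ### Differentiation of integrals depending on a real parameter -/

section Param

variable {E : Type*} [NormedAddCommGroup E] [NormedSpace ℝ E]

theorem hasDerivAt_slice {G : ℝ × E → ℝ} {t : ℝ} {s : E} (h : DifferentiableAt ℝ G (t, s)) :
    HasDerivAt (fun t => G (t, s)) (dirDeriv ((1, 0) : ℝ × E) G (t, s)) t := by
  have h1 : HasDerivAt (fun t : ℝ => (t, s)) ((1, 0) : ℝ × E) t :=
    (hasDerivAt_id t).prodMk (hasDerivAt_const t s)
  exact h.hasFDerivAt.comp_hasDerivAt t h1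

theorem ContDiffOn.hasJetTwo {G : ℝ × E → ℝ} {W : Set (ℝ × E)} (hG : ContDiffOn ℝ ∞ G W)
    (hW : IsOpen W) {s : E} (hs : ((0 : ℝ), s) ∈ W) :
    HasJetTwo (fun t => G (t, s)) (G (0, s)) (_root_.dirDeriv ((1, 0) : ℝ × E) G (0, s))
      (_root_.dirDeriv ((1, 0) : ℝ × E) (_root_.dirDeriv ((1, 0) : ℝ × E) G) (0, s)) := by
  refine ⟨rfl, fun t => _root_.dirDeriv ((1, 0) : ℝ × E) G (t, s), ?_, rfl, ?_⟩
  · have : ∀ᶠ t in 𝓝 (0 : ℝ), (t, s) ∈ W := by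
      have hc : ContinuousAt (fun t : ℝ => (t, s)) 0 := by fun_prop
      exact hc.eventually (hW.mem_nhds hs)
    filter_upwards [this] with t ht
    exact hasDerivAt_slice (hG.differentiableAt_of_isOpen hW ht)
  · exact hasDerivAt_slice ((hG.dirDeriv hW _).differentiableAt_of_isOpen hW hs)

variable [MeasurableSpace E] [BorelSpace E] {μ : Measure E} [IsFiniteMeasureOnCompacts μ]

/-- The tube lemma gives a closed time interval whose product with `K` lies in `W`; there the time
derivative is bounded by compactness, which is the domination needed. The conclusion holds for all
`t` near `0`, so the lemma can be applied once more to the derivative. -/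
theorem eventually_hasDerivAt_setIntegral {G : ℝ × E → ℝ} {W : Set (ℝ × E)} {K : Set E}
    (hG : ContDiffOn ℝ ∞ G W) (hW : IsOpen W) (hK : IsCompact K)
    (hKW : ∀ s ∈ K, ((0 : ℝ), s) ∈ W) :
    ∀ᶠ t in 𝓝 (0 : ℝ), HasDerivAt (fun t => ∫ s in K, G (t, s) ∂μ)
      (∫ s in K, dirDeriv ((1, 0) : ℝ × E) G (t, s) ∂μ) t := by
  obtain ⟨u, v, hu, hv, h0u, hKv, huv⟩ := generalized_tube_lemma (isCompact_singleton (x := (0 : ℝ)))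
    hK hW (by rintro ⟨t, s⟩ ⟨ht, hs⟩; obtain rfl : t = 0 := ht; exact hKW s hs)
  obtain ⟨τ, hτ, hball⟩ := Metric.nhds_basis_closedBall.mem_iff.1
    (hu.mem_nhds (h0u rfl))
  have hsub : Metric.closedBall (0 : ℝ) τ ×ˢ K ⊆ W := fun z hz => huv ⟨hball hz.1, hKv hz.2⟩
  have hG' := hG.dirDeriv hW ((1, 0) : ℝ × E)
  have hcpt : IsCompact (Metric.closedBall (0 : ℝ) τ ×ˢ K) := (isCompact_closedBall _ _).prod hK
  obtain ⟨C, hC⟩ := hcpt.exists_bound_of_continuousOn (hG'.continuousOn.mono hsub)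
  have hKm := hK.isClosed.measurableSet
  have hslice : ∀ {H : ℝ × E → ℝ}, ContinuousOn H W → ∀ t ∈ Metric.closedBall (0 : ℝ) τ,
      ContinuousOn (fun s => H (t, s)) K := fun hH t ht =>
    hH.comp (by fun_prop) fun s hs => hsub ⟨ht, hs⟩
  filter_upwards [Metric.ball_mem_nhds (0 : ℝ) hτ] with t ht
  have hnear : Metric.ball (0 : ℝ) τ ∈ 𝓝 t := Metric.isOpen_ball.mem_nhds ht
  refine (hasDerivAt_integral_of_dominated_loc_of_deriv_le (μ := μ.restrict K)
    (F := fun t s => G (t, s)) (F' := fun t s => dirDeriv ((1, 0) : ℝ × E) G (t, s))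
    (bound := fun _ => C) hnear ?_ ?_ ?_ ?_ ?_ ?_).2
  · filter_upwards [hnear] with t' ht'
    exact (hslice hG.continuousOn t' (Metric.ball_subset_closedBall ht')).aestronglyMeasurable_of_isCompact
      hK hKm
  · exact (hslice hG.continuousOn t (Metric.ball_subset_closedBall ht)).integrableOn_compact hK
  · exact (hslice hG'.continuousOn t (Metric.ball_subset_closedBall ht)).aestronglyMeasurable_of_isCompact
      hK hKm
  · filter_upwards [ae_restrict_mem hKm] with s hs t' ht'
    exact hC (t', s) ⟨Metric.ball_subset_closedBall ht', hs⟩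
  · exact (continuousOn_const (c := C)).integrableOn_compact hK
  · filter_upwards [ae_restrict_mem hKm] with s hs t' ht'
    exact hasDerivAt_slice (hG.differentiableAt_of_isOpen hW
      (hsub ⟨Metric.ball_subset_closedBall ht', hs⟩))

/-- First and second derivative of an integral over a compact set, from the pointwise jets. -/
theorem hasJetTwo_setIntegral {G : ℝ × E → ℝ} {W : Set (ℝ × E)} {K : Set E}
    (hG : ContDiffOn ℝ ∞ G W) (hW : IsOpen W) (hK : IsCompact K)
    (hKW : ∀ s ∈ K, ((0 : ℝ), s) ∈ W) {a b c : E → ℝ}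
    (hjet : ∀ s ∈ K, HasJetTwo (fun t => G (t, s)) (a s) (b s) (c s)) :
    HasJetTwo (fun t => ∫ s in K, G (t, s) ∂μ) (∫ s in K, a s ∂μ) (∫ s in K, b s ∂μ)
      (∫ s in K, c s ∂μ) := by
  have hKm := hK.isClosed.measurableSet
  have hb := fun s hs => (hG.hasJetTwo hW (hKW s hs)).unique (hjet s hs)
  refine ⟨setIntegral_congr_fun hKm fun s hs => (hjet s hs).1, _,
    eventually_hasDerivAt_setIntegral hG hW hK hKW,
    setIntegral_congr_fun hKm fun s hs => (hb s hs).1, ?_⟩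
  have h := (eventually_hasDerivAt_setIntegral (μ := μ) (hG.dirDeriv hW ((1, 0) : ℝ × E)) hW hK
    hKW).self_of_nhds
  rwa [setIntegral_congr_fun hKm fun s hs => (hb s hs).2] at h

end Param

/-! ### The second variation integral -/

section Algebra

variable {ι : Type*} [Fintype ι] [DecidableEq ι]

theorem sum_mul_add_diagonal (x : ι → ι → ℝ) (y : ι → ℝ) :
    ∑ i, ∑ j, (x i j + if i = j then y j else 0) * (x j i + if j = i then y i else 0)
      = ∑ i, ∑ j, x i j * x j i + ∑ i, (2 * x i i * y i + y i ^ 2) := by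
  rw [← Finset.sum_add_distrib]
  refine Finset.sum_congr rfl fun i _ => ?_
  have : ∀ j, (x i j + if i = j then y j else 0) * (x j i + if j = i then y i else 0)
      = x i j * x j i + if i = j then 2 * x i i * y i + y i ^ 2 else 0 := by
    intro j
    by_cases h : i = j
    · subst h; simp; ring
    · simp [h, Ne.symm h]
  simp [this, Finset.sum_add_distrib]

/-- The pointwise algebra of the second variation, with `β i j`, `ν i j` standing for `∂ᵢbⱼ`,
`∂ᵢwⱼ`. The last bracket on the right is arranged so that it becomes a divergence: the `2 × 2`
minors of `β` and `ν` are null Lagrangians, and the mixed terms are product-rule expansions of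
multiples of `b w`. -/
theorem secondVariation_density_eq {ε b w p d : ι → ℝ} {β ν : ι → ι → ℝ}
    (hε : ∀ i, ε i ≠ 0) (hsym : ∀ i j, ε j * ν i j = ε i * ν j i)
    (hp : ∀ i, ε i * (p i + 2 * (b i - w i) * (-b i - w i))
      = ∑ k, ε k * ((b k - w k) * (-β i k - ν i k) - (-b k - w k) * (β i k - ν i k))) :
    1 / 4 * (∑ i, (β i i - ν i i + (b i - w i)) + ∑ i, (-(-β i i - ν i i) + (-b i - w i))) ^ 2
      + 1 / 2 * (-∑ i, ∑ j, (β i j - ν i j + if i = j then b j - w j else 0)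
            * (β j i - ν j i + if j = i then b i - w i else 0)
          - ∑ i, ∑ j, (-(-β i j - ν i j) + if i = j then -b j - w j else 0)
            * (-(-β j i - ν j i) + if j = i then -b i - w i else 0)
          + ∑ i, (d i + p i))
    = -((∑ i, ν i i) ^ 2 + 2 * ∑ i, w i ^ 2 - (∑ i, w i) ^ 2)
      + (∑ i, ∑ j, ((β i i * β j j - β i j * β j i) + (ν i i * ν j j - ν i j * ν j i)
          + (ε j / ε i * (β i j * w j + b j * ν i j) - 2 * (β j j * w i + b j * ν j i)))
        + ∑ i, (1 / 2 * d i + 2 * (ν i i * b i + w i * β i i))) := by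
  -- The sum of the accelerations is eliminated. Symmetry of the Hessian, `hsym`, brings the `ν`
  -- term to the index order used in the conclusion.
  have hp' : ∀ i, p i = 2 * b i ^ 2 - 2 * w i ^ 2
      + ∑ k, (2 * (ε k / ε i) * w k * β i k - 2 * b k * ν k i) := by
    intro i
    have h : ∑ k, (2 * (ε k / ε i) * w k * β i k - 2 * b k * ν k i)
        = (∑ k, ε k * ((b k - w k) * (-β i k - ν i k) - (-b k - w k) * (β i k - ν i k))) / ε i := by
      rw [Finset.sum_div]
      refine Finset.sum_congr rfl fun k _ => ?_
      have := hε i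
      field_simp
      linear_combination (2 * b k) * hsym i k
    rw [h, ← hp i]
    have := hε i
    field_simp
    ring
  rw [sum_mul_add_diagonal, sum_mul_add_diagonal (fun i j => -(-β i j - ν i j))]
  have h1 : ∑ i, ∑ j, (β i j - ν i j) * (β j i - ν j i)
      + ∑ i, ∑ j, -(-β i j - ν i j) * -(-β j i - ν j i)
      = 2 * ∑ i, ∑ j, β i j * β j i + 2 * ∑ i, ∑ j, ν i j * ν j i := by
    simp only [Finset.mul_sum, ← Finset.sum_add_distrib]
    exact Finset.sum_congr rfl fun i _ => Finset.sum_congr rfl fun j _ => by ring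
  have h2 : ∑ i, (2 * (β i i - ν i i) * (b i - w i) + (b i - w i) ^ 2)
      + ∑ i, (2 * -(-β i i - ν i i) * (-b i - w i) + (-b i - w i) ^ 2)
      = -2 * ∑ i, 2 * (ν i i * b i + w i * β i i) + 2 * ∑ i, b i ^ 2 + 2 * ∑ i, w i ^ 2 := by
    simp only [Finset.mul_sum, ← Finset.sum_add_distrib]
    exact Finset.sum_congr rfl fun i _ => by ring
  have h3 : ∑ i, (d i + p i) = ∑ i, d i + 2 * ∑ i, b i ^ 2 - 2 * ∑ i, w i ^ 2
      + 2 * ∑ i, ∑ k, ε k / ε i * (β i k * w k + b k * ν i k) - 4 * ∑ i, ∑ k, b k * ν k i := by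
    simp only [Finset.mul_sum, ← Finset.sum_add_distrib, ← Finset.sum_sub_distrib]
    refine Finset.sum_congr rfl fun i _ => ?_
    rw [hp' i, add_sub_assoc, ← Finset.sum_sub_distrib]
    rw [← add_assoc, ← add_sub_assoc]
    congr 1
    refine Finset.sum_congr rfl fun k _ => ?_
    have := hε i
    field_simp
    linear_combination (-2 * b k) * hsym i k
  have h4 : ∑ i, (β i i - ν i i + (b i - w i)) + ∑ i, (-(-β i i - ν i i) + (-b i - w i))
      = 2 * ∑ i, β i i - 2 * ∑ i, w i := by
    simp only [Finset.mul_sum, ← Finset.sum_add_distrib, ← Finset.sum_sub_distrib]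
    exact Finset.sum_congr rfl fun i _ => by ring
  have h5 : ∑ i, ∑ j, ((β i i * β j j - β i j * β j i) + (ν i i * ν j j - ν i j * ν j i)
          + (ε j / ε i * (β i j * w j + b j * ν i j) - 2 * (β j j * w i + b j * ν j i)))
      = (∑ i, β i i) ^ 2 - ∑ i, ∑ j, β i j * β j i + (∑ i, ν i i) ^ 2
        - ∑ i, ∑ j, ν i j * ν j i + ∑ i, ∑ j, ε j / ε i * (β i j * w j + b j * ν i j)
        - 2 * (∑ i, w i) * (∑ i, β i i) - 2 * ∑ i, ∑ j, b j * ν j i := by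
    have e : ∀ f g : ι → ℝ, (∑ i, f i) * ∑ i, g i = ∑ i, ∑ j, f i * g j := fun f g =>
      Finset.sum_mul_sum _ _ _ _
    rw [sq, sq, e, e, mul_assoc, e]
    simp only [Finset.mul_sum, ← Finset.sum_add_distrib, ← Finset.sum_sub_distrib]
    exact Finset.sum_congr rfl fun i _ => Finset.sum_congr rfl fun j _ => by ring
  rw [h4, h5, h3, Finset.sum_add_distrib (f := fun i => 1 / 2 * d i), ← Finset.mul_sum]
  linear_combination (-1 / 2) * h1 - (1 / 2) * h2

end Algebra

/-! ### Integration of the second variation over `ℝⁿ` -/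

section Integral

variable {n : ℕ}

/-- The `i`-th partial derivative. -/
noncomputable abbrev partialD (i : Fin n) (f : (Fin n → ℝ) → ℝ) : (Fin n → ℝ) → ℝ :=
  dirDeriv (Pi.single i 1) f

/-- The integral of the square of the (weighted) Laplacian of `u`, plus the integral of the
quadratic form `2 ∑ wᵢ² - (∑ wᵢ)²` of its gradient, where `wᵢ = ∂ᵢ u / εᵢ`. -/
noncomputable def hessianForm (ε : Fin n → ℝ) (u : (Fin n → ℝ) → ℝ) : ℝ :=
  ∫ s, ((∑ i, partialD i (partialD i u) s / ε i) ^ 2 + 2 * ∑ i, (partialD i u s / ε i) ^ 2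
    - (∑ i, partialD i u s / ε i) ^ 2)

/-- `A`, `B` are the logarithmic velocities of `p`, `q` at time `0`, and `A₂`, `B₂` the
corresponding accelerations. The hypotheses fix `A + B` and `A₂ + B₂`; the difference `A₂ - B₂`
enters only through its divergence and integrates to zero. -/
theorem integral_secondVariation {ε : Fin n → ℝ} (hε : ∀ i, ε i ≠ 0)
    {u : (Fin n → ℝ) → ℝ} {A B A₂ B₂ : Fin n → (Fin n → ℝ) → ℝ} (hu : IsTestFunction u)
    (hA : ∀ i, IsTestFunction (A i)) (hB : ∀ i, IsTestFunction (B i))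
    (hA₂ : ∀ i, IsTestFunction (A₂ i)) (hB₂ : ∀ i, IsTestFunction (B₂ i))
    (h1 : ∀ i s, ε i * (A i s + B i s) = -2 * partialD i u s)
    (h2 : ∀ i s, ε i * (A₂ i s + B₂ i s + 2 * A i s * B i s)
      = ∑ k, ε k * (A k s * partialD i (B k) s - B k s * partialD i (A k) s)) :
    ∫ s, (1 / 4 * (∑ i, (partialD i (A i) s + A i s)
          + ∑ i, (-partialD i (B i) s + B i s)) ^ 2
        + 1 / 2 * (-∑ i, ∑ j, (partialD i (A j) s + if i = j then A j s else 0)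
              * (partialD j (A i) s + if j = i then A i s else 0)
            - ∑ i, ∑ j, (-partialD i (B j) s + if i = j then B j s else 0)
              * (-partialD j (B i) s + if j = i then B i s else 0)
            + ∑ i, (partialD i (A₂ i) s - partialD i (B₂ i) s + (A₂ i s + B₂ i s))))
      = -hessianForm ε u := by
  -- Tangential and normal parts: moving `s` by `b` changes `log |p|`, `log |q|` by `b`, `-b`, while
  -- scaling the factor by `e^{-w}` changes both by `-w`. Thus `A = b - w` and `B = -b - w`.
  obtain ⟨b, hb⟩ : ∃ b : Fin n → (Fin n → ℝ) → ℝ, b = fun i s => 1 / 2 * (A i s - B i s) :=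
    ⟨_, rfl⟩
  obtain ⟨w, hw⟩ : ∃ w : Fin n → (Fin n → ℝ) → ℝ, w = fun i s => 1 / ε i * partialD i u s :=
    ⟨_, rfl⟩
  have tb : ∀ i, IsTestFunction (b i) := fun i => by
    rw [hb]; exact ((hA i).sub (hB i)).const_mul _
  have tw : ∀ i, IsTestFunction (w i) := fun i => by
    rw [hw]; exact (hu.dirDeriv _).const_mul _
  have hwA : ∀ i s, w i s = -1 / 2 * (A i s + B i s) := fun i s => by
    have := hε i
    rw [hw]; field_simp; linear_combination h1 i s
  have hA' : A = fun i s => b i s - w i s := by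
    funext i s; rw [hwA, hb]; ring
  have hB' : B = fun i s => -b i s - w i s := by
    funext i s; rw [hwA, hb]; ring
  clear hb hwA
  subst hA' hB'
  have dA : ∀ i j s, partialD i (fun s => b j s - w j s) s
      = partialD i (b j) s - partialD i (w j) s := fun i j s =>
    dirDeriv_sub ((tb j).differentiableAt s) ((tw j).differentiableAt s) _
  have dB : ∀ i j s, partialD i (fun s => -b j s - w j s) s
      = -partialD i (b j) s - partialD i (w j) s := fun i j s => by
    rw [partialD, dirDeriv_sub ((tb j).neg.differentiableAt s)
      ((tw j).differentiableAt s), dirDeriv_neg]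
  -- Both sides are the mixed second derivative of `u`.
  have hsym : ∀ i j s, ε j * partialD i (w j) s = ε i * partialD j (w i) s := fun i j s => by
    have e : ∀ i j, ε j * partialD i (w j) s = partialD i (partialD j u) s := fun i j => by
      rw [hw, partialD, dirDeriv_const_mul ((hu.dirDeriv _).differentiableAt s)]
      have := hε j
      field_simp
    rw [e, e, partialD, dirDeriv_comm hu.smooth]
  have hmul : ∀ {f g : (Fin n → ℝ) → ℝ} (i : Fin n) (s : Fin n → ℝ), IsTestFunction f →
      IsTestFunction g → partialD i (fun s => f s * g s) s
        = partialD i f s * g s + f s * partialD i g s := fun i s hf hg =>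
    dirDeriv_mul (hf.differentiableAt s) (hg.differentiableAt s) _
  have hcomm : ∀ {f : (Fin n → ℝ) → ℝ} (i j : Fin n) (s : Fin n → ℝ), IsTestFunction f →
      partialD i (partialD j f) s = partialD j (partialD i f) s := fun i j s hf => by
    rw [partialD, dirDeriv_comm hf.smooth]
  have hpt : ∀ s, _ = _ := fun s => secondVariation_density_eq (ε := ε) (b := fun i => b i s)
    (w := fun i => w i s) (p := fun i => A₂ i s + B₂ i s)
    (d := fun i => partialD i (A₂ i) s - partialD i (B₂ i) s)
    (β := fun i j => partialD i (b j) s) (ν := fun i j => partialD i (w j) s)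
    hε (fun i j => hsym i j s) (fun i => by
      have := h2 i s
      simp only [dA, dB] at this
      linear_combination this)
  simp only [dA, dB]
  -- Primitives of the divergence terms: in `∂ᵢ Yᵢⱼ - ∂ⱼ Zᵢⱼ` the second derivatives of `b` and `w`
  -- cancel, leaving the minors and the mixed terms, and `∂ᵢ Vᵢ` supplies the rest.
  set Y : Fin n → Fin n → (Fin n → ℝ) → ℝ := fun i j s =>
    b i s * partialD j (b j) s + w i s * partialD j (w j) s + ε j / ε i * (b j s * w j s) with hY
  set Z : Fin n → Fin n → (Fin n → ℝ) → ℝ := fun i j s =>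
    b i s * partialD i (b j) s + w i s * partialD i (w j) s + 2 * (b j s * w i s) with hZ
  set V : Fin n → (Fin n → ℝ) → ℝ := fun i s =>
    1 / 2 * (A₂ i s - B₂ i s) + 2 * (w i s * b i s) with hV
  have tD : ∀ {f : (Fin n → ℝ) → ℝ} (i : Fin n), IsTestFunction f →
    IsTestFunction (partialD i f) := fun i hf => hf.dirDeriv _
  have tY : ∀ i j, IsTestFunction (Y i j) := fun i j =>
    (((tb i).mul (tD j (tb j))).add ((tw i).mul (tD j (tw j)))).add
      (((tb j).mul (tw j)).const_mul _)
  have tZ : ∀ i j, IsTestFunction (Z i j) := fun i j =>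
    (((tb i).mul (tD i (tb j))).add ((tw i).mul (tD i (tw j)))).add
      (((tb j).mul (tw i)).const_mul _)
  have tV : ∀ i, IsTestFunction (V i) := fun i =>
    (((hA₂ i).sub (hB₂ i)).const_mul _).add (((tw i).mul (tb i)).const_mul _)
  have hYZ : ∀ i j s, partialD i (Y i j) s - partialD j (Z i j) s
      = ((partialD i (b i) s * partialD j (b j) s - partialD i (b j) s * partialD j (b i) s)
        + (partialD i (w i) s * partialD j (w j) s - partialD i (w j) s * partialD j (w i) s)
        + (ε j / ε i * (partialD i (b j) s * w j s + b j s * partialD i (w j) s)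
          - 2 * (partialD j (b j) s * w i s + b j s * partialD j (w i) s))) := by
    intro i j s
    have eY : partialD i (Y i j) s = partialD i (b i) s * partialD j (b j) s
        + b i s * partialD i (partialD j (b j)) s + (partialD i (w i) s * partialD j (w j) s
        + w i s * partialD i (partialD j (w j)) s)
        + ε j / ε i * (partialD i (b j) s * w j s + b j s * partialD i (w j) s) := by
      rw [← hmul i s (tb i) (tD j (tb j)), ← hmul i s (tw i) (tD j (tw j)),
        ← hmul i s (tb j) (tw j)]
      rw [hY, partialD, dirDeriv_add ((((tb i).mul (tD j (tb j))).add
        ((tw i).mul (tD j (tw j)))).differentiableAt s)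
        ((((tb j).mul (tw j)).const_mul _).differentiableAt s),
        dirDeriv_add (((tb i).mul (tD j (tb j))).differentiableAt s)
        (((tw i).mul (tD j (tw j))).differentiableAt s),
        dirDeriv_const_mul (((tb j).mul (tw j)).differentiableAt s)]
    have eZ : partialD j (Z i j) s = partialD j (b i) s * partialD i (b j) s
        + b i s * partialD j (partialD i (b j)) s + (partialD j (w i) s * partialD i (w j) s
        + w i s * partialD j (partialD i (w j)) s)
        + 2 * (partialD j (b j) s * w i s + b j s * partialD j (w i) s) := by
      rw [← hmul j s (tb i) (tD i (tb j)), ← hmul j s (tw i) (tD i (tw j)),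
        ← hmul j s (tb j) (tw i)]
      rw [hZ, partialD, dirDeriv_add ((((tb i).mul (tD i (tb j))).add
        ((tw i).mul (tD i (tw j)))).differentiableAt s)
        ((((tb j).mul (tw i)).const_mul _).differentiableAt s),
        dirDeriv_add (((tb i).mul (tD i (tb j))).differentiableAt s)
        (((tw i).mul (tD i (tw j))).differentiableAt s),
        dirDeriv_const_mul (((tb j).mul (tw i)).differentiableAt s)]
    rw [eY, eZ, hcomm i j s (tb j), hcomm i j s (tw j)]
    ring
  have hVd : ∀ i s, partialD i (V i) s = 1 / 2 * (partialD i (A₂ i) s - partialD i (B₂ i) s)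
      + 2 * (partialD i (w i) s * b i s + w i s * partialD i (b i) s) := by
    intro i s
    rw [← hmul i s (tw i) (tb i), hV, partialD, dirDeriv_add
      ((((hA₂ i).sub (hB₂ i)).const_mul _).differentiableAt s)
      ((((tw i).mul (tb i)).const_mul _).differentiableAt s),
      dirDeriv_const_mul (((hA₂ i).sub (hB₂ i)).differentiableAt s),
      dirDeriv_const_mul (((tw i).mul (tb i)).differentiableAt s),
      dirDeriv_sub ((hA₂ i).differentiableAt s) ((hB₂ i).differentiableAt s)]
  have hpt' := fun s => (hpt s).trans (show _ = -((∑ i, partialD i (w i) s) ^ 2 + 2 * ∑ i, w i s ^ 2 - (∑ i, w i s) ^ 2)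
      + (∑ i, ∑ j, (partialD i (Y i j) s - partialD j (Z i j) s) + ∑ i, partialD i (V i) s) by
      simp only [hYZ, hVd])
  rw [integral_congr_ae (.of_forall hpt'), integral_add, integral_add, integral_neg]
  · rw [integral_finsetSum _ fun i _ => ?_, integral_finsetSum _ fun i _ => ?_]
    · rw [Finset.sum_eq_zero fun i _ => (tV i).integral_dirDeriv _, Finset.sum_eq_zero,
        add_zero, add_zero, hessianForm]
      · congr 1
        refine integral_congr_ae (.of_forall fun s => ?_)
        have hw' : ∀ i, w i s = partialD i u s / ε i := fun i => by rw [hw]; ring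
        have hw'' : ∀ i, partialD i (w i) s = partialD i (partialD i u) s / ε i := fun i => by
          rw [hw, partialD, dirDeriv_const_mul ((hu.dirDeriv _).differentiableAt s)]; ring
        simp only [hw', hw'']
      · intro i _
        rw [integral_finsetSum _ fun j _ => ((tD i (tY i j)).sub (tD j (tZ i j))).integrable]
        refine Finset.sum_eq_zero fun j _ => ?_
        rw [integral_sub (tD i (tY i j)).integrable (tD j (tZ i j)).integrable,
          (tY i j).integral_dirDeriv, (tZ i j).integral_dirDeriv, sub_zero]
    · exact (tD i (tV i)).integrable
    · exact (IsTestFunction.sum _ fun j => (tD i (tY i j)).sub (tD j (tZ i j))).integrable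
  · exact (IsTestFunction.sum _ fun i => IsTestFunction.sum _ fun j =>
      (tD i (tY i j)).sub (tD j (tZ i j))).integrable
  · exact (IsTestFunction.sum _ fun i => tD i (tV i)).integrable
  · exact (((IsTestFunction.sum _ fun i => tD i (tw i)).pow_two.add
      ((IsTestFunction.sum _ fun i => (tw i).pow_two).const_mul 2)).sub
      (IsTestFunction.sum _ fun i => tw i).pow_two).neg.integrable
  · exact ((IsTestFunction.sum _ fun i => IsTestFunction.sum _ fun j =>
      (tD i (tY i j)).sub (tD j (tZ i j))).add (IsTestFunction.sum _ fun i => tD i (tV i))).integrable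

end Integral

/-! ### Lagrangian families in null coordinates -/

section Slices

variable {n : ℕ}

/-- The time direction in `ℝ × ℝⁿ`. -/
abbrev timeDir (n : ℕ) : ℝ × (Fin n → ℝ) := (1, 0)

/-- The `i`-th space direction in `ℝ × ℝⁿ`. -/
abbrev spaceDir (i : Fin n) : ℝ × (Fin n → ℝ) := (0, Pi.single i 1)

/-- The slab `(-δ, δ) × ℝⁿ`. -/
abbrev slab (n : ℕ) (δ : ℝ) : Set (ℝ × (Fin n → ℝ)) := Set.Ioo (-δ) δ ×ˢ Set.univ

theorem isOpen_slab (n : ℕ) (δ : ℝ) : IsOpen (slab n δ) := isOpen_Ioo.prod isOpen_univ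

theorem zero_mem_slab {δ : ℝ} (hδ : 0 < δ) (s : Fin n → ℝ) : ((0 : ℝ), s) ∈ slab n δ :=
  ⟨⟨neg_neg_of_pos hδ, hδ⟩, trivial⟩

theorem partialD_slice {H : ℝ × (Fin n → ℝ) → ℝ} {t : ℝ} {s : Fin n → ℝ}
    (h : DifferentiableAt ℝ H (t, s)) (i : Fin n) :
    partialD i (fun s => H (t, s)) s = dirDeriv (spaceDir i) H (t, s) := by
  have h1 : HasFDerivAt (fun s : Fin n → ℝ => (t, s)) (ContinuousLinearMap.inr ℝ ℝ (Fin n → ℝ)) s :=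
    hasFDerivAt_prodMk_right t s
  have h2 : HasFDerivAt (fun s => H (t, s))
    ((fderiv ℝ H (t, s)).comp (ContinuousLinearMap.inr ℝ ℝ (Fin n → ℝ))) s :=
    h.hasFDerivAt.comp s h1
  rw [partialD, dirDeriv, h2.fderiv]
  rfl

theorem contDiff_slice {H : ℝ × (Fin n → ℝ) → ℝ} {δ t : ℝ} (hH : ContDiffOn ℝ ∞ H (slab n δ))
    (ht : t ∈ Set.Ioo (-δ) δ) : ContDiff ℝ ∞ fun s => H (t, s) := by
  rw [← contDiffOn_univ]
  exact hH.comp (contDiff_prodMk_right t).contDiffOn fun s _ => ⟨ht, trivial⟩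

theorem dirDeriv_wronskian {ι E : Type*} [Fintype ι] [NormedAddCommGroup E] [NormedSpace ℝ E]
    {a b c d : ι → E → ℝ} {z : E} (ha : ∀ k, DifferentiableAt ℝ (a k) z)
    (hb : ∀ k, DifferentiableAt ℝ (b k) z) (hc : ∀ k, DifferentiableAt ℝ (c k) z)
    (hd : ∀ k, DifferentiableAt ℝ (d k) z) (v : E) :
    dirDeriv v (fun z => ∑ k, (a k z * b k z - c k z * d k z)) z
      = ∑ k, (dirDeriv v (a k) z * b k z + a k z * dirDeriv v (b k) z
        - (dirDeriv v (c k) z * d k z + c k z * dirDeriv v (d k) z)) := by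
  have h : HasFDerivAt (fun z => ∑ k, (a k z * b k z - c k z * d k z))
      (∑ k, ((a k z • fderiv ℝ (b k) z + b k z • fderiv ℝ (a k) z)
        - (c k z • fderiv ℝ (d k) z + d k z • fderiv ℝ (c k) z))) z :=
    HasFDerivAt.fun_sum fun k _ => ((ha k).hasFDerivAt.mul (hb k).hasFDerivAt).sub
      ((hc k).hasFDerivAt.mul (hd k).hasFDerivAt)
  rw [dirDeriv, h.fderiv]
  simp only [sum_apply, dirDeriv]
  refine Finset.sum_congr rfl fun k _ => ?_
  simp
  ring

theorem dirDeriv_eq_zero_of_forall_notMem {E : Type*} [NormedAddCommGroup E] [NormedSpace ℝ E]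
    {f : E → ℝ} {S : Set E} (hS : IsClosed S) (hf : ∀ x ∉ S, f x = 0) {x : E} (hx : x ∉ S) (v : E) :
    dirDeriv v f x = 0 := by
  have : f =ᶠ[𝓝 x] fun _ => 0 := by
    filter_upwards [hS.isOpen_compl.mem_nhds hx] with y hy using hf y hy
  rw [dirDeriv_congr this]
  simp [dirDeriv]

end Slices

/-! ### Jacobians of families that start from exponentials -/

section Family

variable {n : ℕ}

/-- The Jacobian matrix in the space variables. -/
noncomputable def spaceJacobian (H : Fin n → ℝ × (Fin n → ℝ) → ℝ) (z : ℝ × (Fin n → ℝ)) :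
    Matrix (Fin n) (Fin n) ℝ := Matrix.of fun i k => dirDeriv (spaceDir i) (H k) z

/-- The logarithmic time derivatives at time `0` of a family `H` with `H k (0, s) = cₖ e^{η sₖ}`. -/
noncomputable def logSpeed (c : Fin n → ℝ) (η : ℝ) (H : Fin n → ℝ × (Fin n → ℝ) → ℝ) (k : Fin n)
    (s : Fin n → ℝ) : ℝ :=
  (c k)⁻¹ * Real.exp (-(η * s k)) * dirDeriv (timeDir n) (H k) (0, s)

section Exponential

variable {c : Fin n → ℝ} {η δ : ℝ} {H : Fin n → ℝ × (Fin n → ℝ) → ℝ}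

theorem dirDeriv_time_eq (hc : ∀ k, c k ≠ 0) (k : Fin n) (s : Fin n → ℝ) :
    dirDeriv (timeDir n) (H k) (0, s) = c k * Real.exp (η * s k) * logSpeed c η H k s := by
  have := hc k
  rw [logSpeed, Real.exp_neg]
  have := (Real.exp_pos (η * s k)).ne'
  field_simp

theorem contDiff_logSpeed (hδ : 0 < δ) (hH : ∀ k, ContDiffOn ℝ ∞ (H k) (slab n δ)) (k : Fin n) :
    ContDiff ℝ ∞ (logSpeed c η H k) := by
  have h := contDiff_slice ((hH k).dirDeriv (isOpen_slab n δ) (timeDir n))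
    (⟨neg_neg_of_pos hδ, hδ⟩ : (0 : ℝ) ∈ Set.Ioo (-δ) δ)
  unfold logSpeed
  exact (contDiff_const.mul (Real.contDiff_exp.comp (by fun_prop))).mul h

theorem isTestFunction_logSpeed (hδ : 0 < δ) (hH : ∀ k, ContDiffOn ℝ ∞ (H k) (slab n δ))
    {S : Set (Fin n → ℝ)} (hS : IsCompact S)
    (h0 : ∀ k, ∀ s ∉ S, dirDeriv (timeDir n) (H k) (0, s) = 0) (k : Fin n) :
    IsTestFunction (logSpeed c η H k) :=
  ⟨contDiff_logSpeed hδ hH k, HasCompactSupport.intro hS fun s hs => by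
    rw [logSpeed, h0 k s hs, mul_zero]⟩

theorem hasFDerivAt_exp_coord (η : ℝ) (k : Fin n) (s : Fin n → ℝ) :
    HasFDerivAt (fun s : Fin n → ℝ => Real.exp (η * s k))
      (Real.exp (η * s k) • (η • ContinuousLinearMap.proj (R := ℝ) (φ := fun _ : Fin n => ℝ) k)) s := by
  have h : HasFDerivAt (fun s : Fin n → ℝ => η * s k)
      (η • ContinuousLinearMap.proj (R := ℝ) (φ := fun _ : Fin n => ℝ) k) s :=
    (ContinuousLinearMap.proj (R := ℝ) (φ := fun _ : Fin n => ℝ) k).hasFDerivAt.const_mul η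
  exact h.exp

theorem partialD_exp_mul {f : (Fin n → ℝ) → ℝ} {s : Fin n → ℝ} (hf : DifferentiableAt ℝ f s)
    (a η : ℝ) (i k : Fin n) :
    partialD i (fun s => a * Real.exp (η * s k) * f s) s
      = a * Real.exp (η * s k) * (partialD i f s + if i = k then η * f s else 0) := by
  have h := ((hasFDerivAt_exp_coord η k s).const_mul a).mul hf.hasFDerivAt
  have h' : fderiv ℝ (fun s => a * Real.exp (η * s k) * f s) s = _ := h.fderiv
  rw [partialD, dirDeriv, h']
  by_cases hik : i = k
  · subst hik; simp [dirDeriv]; ring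
  · simp [dirDeriv, hik]

theorem dirDeriv_space_zero (hδ : 0 < δ) (hH : ∀ k, ContDiffOn ℝ ∞ (H k) (slab n δ))
    (h0 : ∀ k s, H k (0, s) = c k * Real.exp (η * s k)) (i k : Fin n) (s : Fin n → ℝ) :
    dirDeriv (spaceDir i) (H k) (0, s) = if i = k then η * (c k * Real.exp (η * s k)) else 0 := by
  rw [← partialD_slice ((hH k).differentiableAt_of_isOpen (isOpen_slab n δ) (zero_mem_slab hδ s))]
  have : (fun s => H k (0, s)) = fun s => c k * Real.exp (η * s k) * 1 := by
    funext s; rw [h0, mul_one]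
  rw [this, partialD_exp_mul (by fun_prop)]
  simp only [dirDeriv, partialD]
  split_ifs <;> simp
  ring

theorem dirDeriv_space_time_zero (hδ : 0 < δ) (hc : ∀ k, c k ≠ 0)
    (hH : ∀ k, ContDiffOn ℝ ∞ (H k) (slab n δ)) (i k : Fin n) (s : Fin n → ℝ) :
    dirDeriv (spaceDir i) (dirDeriv (timeDir n) (H k)) (0, s)
      = c k * Real.exp (η * s k) * (partialD i (logSpeed c η H k) s
        + if i = k then η * logSpeed c η H k s else 0) := by
  rw [← partialD_slice (((hH k).dirDeriv (isOpen_slab n δ) _).differentiableAt_of_isOpen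
    (isOpen_slab n δ) (zero_mem_slab hδ s))]
  rw [← partialD_exp_mul ((contDiff_logSpeed hδ hH k).differentiable (by simp) s)]
  congr 1
  funext s
  exact dirDeriv_time_eq hc k s

theorem ContDiffOn.dirDeriv_comm {E : Type*} [NormedAddCommGroup E] [NormedSpace ℝ E] {f : E → ℝ}
    {U : Set E} (hf : ContDiffOn ℝ ∞ f U) (hU : IsOpen U) {z : E} (hz : z ∈ U) (v w : E) :
    _root_.dirDeriv v (_root_.dirDeriv w f) z = _root_.dirDeriv w (_root_.dirDeriv v f) z :=
  ContDiff.dirDeriv_comm_at (hf.contDiffAt (hU.mem_nhds hz)) v w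

theorem dirDeriv_time_time_space (hH : ∀ k, ContDiffOn ℝ ∞ (H k) (slab n δ)) (i k : Fin n)
    {z : ℝ × (Fin n → ℝ)} (hz : z ∈ slab n δ) :
    dirDeriv (timeDir n) (dirDeriv (timeDir n) (dirDeriv (spaceDir i) (H k))) z
      = dirDeriv (spaceDir i) (dirDeriv (timeDir n) (dirDeriv (timeDir n) (H k))) z := by
  have hU := isOpen_slab n δ
  rw [← ((hH k).dirDeriv hU (timeDir n)).dirDeriv_comm hU hz]
  refine dirDeriv_congr ?_ _
  filter_upwards [hU.mem_nhds hz] with y hy using (hH k).dirDeriv_comm hU hy _ _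

/-- The second order jet of the normalized Jacobian determinant. -/
theorem hasJetTwo_det_spaceJacobian (hδ : 0 < δ) (hη : η * η = 1) (hc : ∀ k, c k ≠ 0)
    (hH : ∀ k, ContDiffOn ℝ ∞ (H k) (slab n δ))
    (h0 : ∀ k s, H k (0, s) = c k * Real.exp (η * s k)) (s : Fin n → ℝ) :
    HasJetTwo (fun t => (∏ k, (η * ((c k)⁻¹ * Real.exp (-(η * s k)))))
        * (spaceJacobian H (t, s)).det) 1
      (∑ i, (η * partialD i (logSpeed c η H i) s + logSpeed c η H i s))
      ((∑ i, (η * partialD i (logSpeed c η H i) s + logSpeed c η H i s)) ^ 2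
        - ∑ i, ∑ j, (η * partialD i (logSpeed c η H j) s + if i = j then logSpeed c η H j s else 0)
          * (η * partialD j (logSpeed c η H i) s + if j = i then logSpeed c η H i s else 0)
        + ∑ i, (η * partialD i (logSpeed c η (fun k => dirDeriv (timeDir n) (H k)) i) s
          + logSpeed c η (fun k => dirDeriv (timeDir n) (H k)) i s)) := by
  have hU := isOpen_slab n δ
  have hz := zero_mem_slab hδ s
  have hH' : ∀ k, ContDiffOn ℝ ∞ (dirDeriv (timeDir n) (H k)) (slab n δ) := fun k =>
    (hH k).dirDeriv hU _
  -- At time `0` the Jacobian is diagonal with entries `η cₖ e^{η sₖ}`. Since `η² = 1`, scaling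
  -- column `k` by `ν k` makes it the identity, as `HasJetTwo.det` requires.
  set ν : Fin n → ℝ := fun k => η * ((c k)⁻¹ * Real.exp (-(η * s k))) with hν
  have hνc : ∀ k, ν k * (c k * Real.exp (η * s k)) = η := fun k => by
    have := hc k
    have := (Real.exp_pos (η * s k)).ne'
    simp only [hν, Real.exp_neg]; field_simp
  set M : ℝ → Matrix (Fin n) (Fin n) ℝ := fun t =>
    Matrix.of fun i k => ν k * dirDeriv (spaceDir i) (H k) (t, s)
  set M₁ : ℝ → Matrix (Fin n) (Fin n) ℝ := fun t =>
    Matrix.of fun i k => ν k * dirDeriv (timeDir n) (dirDeriv (spaceDir i) (H k)) (t, s)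
  set M₂ : Matrix (Fin n) (Fin n) ℝ := Matrix.of fun i k =>
    ν k * dirDeriv (timeDir n) (dirDeriv (timeDir n) (dirDeriv (spaceDir i) (H k))) (0, s)
  have hM0 : M 0 = 1 := by
    ext i k
    simp only [M, Matrix.of_apply, dirDeriv_space_zero hδ hH h0, Matrix.one_apply]
    split_ifs
    · rw [mul_left_comm, hνc, hη]
    · simp
  have hM₁0 : ∀ i k, M₁ 0 i k = η * partialD i (logSpeed c η H k) s
      + if i = k then logSpeed c η H k s else 0 := fun i k => by
    simp only [M₁, Matrix.of_apply]
    rw [(hH k).dirDeriv_comm hU hz, dirDeriv_space_time_zero (η := η) hδ hc hH, ← mul_assoc, hνc]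
    split_ifs
    · rw [mul_add, ← mul_assoc, hη, one_mul]
    · simp
  have hM₂0 : ∀ i k, M₂ i k
      = η * partialD i (logSpeed c η (fun k => dirDeriv (timeDir n) (H k)) k) s
      + if i = k then logSpeed c η (fun k => dirDeriv (timeDir n) (H k)) k s else 0 := fun i k => by
    simp only [M₂, Matrix.of_apply]
    rw [dirDeriv_time_time_space hH i k hz, dirDeriv_space_time_zero (η := η) hδ hc hH',
      ← mul_assoc, hνc]
    split_ifs
    · rw [mul_add, ← mul_assoc, hη, one_mul]
    · simp
  have hjet := HasJetTwo.det (M := M) (M₁ := M₁) (M₂ := M₂) hM0 ?_ ?_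
  · have e1 : (M₁ 0).trace = ∑ i, (η * partialD i (logSpeed c η H i) s + logSpeed c η H i s) := by
      simp [Matrix.trace, hM₁0]
    have e2 : (M₁ 0 * M₁ 0).trace = ∑ i, ∑ j, (η * partialD i (logSpeed c η H j) s
        + if i = j then logSpeed c η H j s else 0)
        * (η * partialD j (logSpeed c η H i) s + if j = i then logSpeed c η H i s else 0) := by
      simp [Matrix.trace, Matrix.mul_apply, hM₁0]
    have e3 : M₂.trace = ∑ i, (η * partialD i
        (logSpeed c η (fun k => dirDeriv (timeDir n) (H k)) i) s
          + logSpeed c η (fun k => dirDeriv (timeDir n) (H k)) i s) := by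
      simp [Matrix.trace, hM₂0]
    rw [e1, e2, e3] at hjet
    convert hjet using 2 with t
    rw [← Matrix.det_mul_row]
    rfl
  · have hev : ∀ᶠ t in 𝓝 (0 : ℝ), (t, s) ∈ slab n δ := by
      have hcont : ContinuousAt (fun t : ℝ => (t, s)) 0 := by fun_prop
      exact hcont.eventually (hU.mem_nhds hz)
    filter_upwards [hev] with t ht i k
    exact (hasDerivAt_slice (((hH k).dirDeriv hU _).differentiableAt_of_isOpen hU ht)).const_mul _
  · intro i k
    exact (hasDerivAt_slice ((((hH k).dirDeriv hU _).dirDeriv hU _).differentiableAt_of_isOpen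
      hU hz)).const_mul _

end Exponential

end Family

/-! ### Relations satisfied by a Hamiltonian family -/

section Family

variable {n : ℕ}

/-- A family of immersions of `ℝⁿ`, given by its null coordinates `P k`, `Q k`, which at time `0`
is the product of hyperbolas `(ρₖ e^{sₖ}, κₖ e^{-sₖ})`, which is moved by a vector field dual to
the differential of a function equal to `u` along the family, and with velocity and acceleration
supported in `S` at time `0`. -/
structure IsHamiltonianFamily (δ : ℝ) (ρ κ : Fin n → ℝ) (u : (Fin n → ℝ) → ℝ)
    (S : Set (Fin n → ℝ)) (P Q : Fin n → ℝ × (Fin n → ℝ) → ℝ) : Prop where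
  pos : 0 < δ
  left_ne : ∀ k, ρ k ≠ 0
  right_ne : ∀ k, κ k ≠ 0
  left_smooth : ∀ k, ContDiffOn ℝ ∞ (P k) (slab n δ)
  right_smooth : ∀ k, ContDiffOn ℝ ∞ (Q k) (slab n δ)
  left_zero : ∀ k s, P k (0, s) = ρ k * Real.exp (1 * s k)
  right_zero : ∀ k s, Q k (0, s) = κ k * Real.exp (-1 * s k)
  test : IsTestFunction u
  compact : IsCompact S
  relation : ∀ i, ∀ z ∈ slab n δ,
    ∑ k, (dirDeriv (timeDir n) (P k) z * dirDeriv (spaceDir i) (Q k) z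
      - dirDeriv (timeDir n) (Q k) z * dirDeriv (spaceDir i) (P k) z) = 2 * partialD i u z.2
  left_velocity : ∀ k, ∀ s ∉ S, dirDeriv (timeDir n) (P k) (0, s) = 0
  right_velocity : ∀ k, ∀ s ∉ S, dirDeriv (timeDir n) (Q k) (0, s) = 0
  left_acceleration : ∀ k, ∀ s ∉ S,
    dirDeriv (timeDir n) (dirDeriv (timeDir n) (P k)) (0, s) = 0
  right_acceleration : ∀ k, ∀ s ∉ S,
    dirDeriv (timeDir n) (dirDeriv (timeDir n) (Q k)) (0, s) = 0

namespace IsHamiltonianFamily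

variable {δ : ℝ} {ρ κ : Fin n → ℝ} {u : (Fin n → ℝ) → ℝ} {S : Set (Fin n → ℝ)}
  {P Q : Fin n → ℝ × (Fin n → ℝ) → ℝ}

theorem smooth_diff (h : IsHamiltonianFamily δ ρ κ u S P Q) (v : ℝ × (Fin n → ℝ)) :
    (∀ k, ∀ z ∈ slab n δ, DifferentiableAt ℝ (dirDeriv v (P k)) z) ∧
      ∀ k, ∀ z ∈ slab n δ, DifferentiableAt ℝ (dirDeriv v (Q k)) z :=
  have hU := isOpen_slab n δ
  ⟨fun k _ hz => ((h.left_smooth k).dirDeriv hU v).differentiableAt_of_isOpen hU hz,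
    fun k _ hz => ((h.right_smooth k).dirDeriv hU v).differentiableAt_of_isOpen hU hz⟩

/-- The derivative of the relation defining a Hamiltonian family. -/
theorem dirDeriv_relation (h : IsHamiltonianFamily δ ρ κ u S P Q) (i : Fin n)
    {z : ℝ × (Fin n → ℝ)} (hz : z ∈ slab n δ) (v : ℝ × (Fin n → ℝ)) :
    ∑ k, (dirDeriv v (dirDeriv (timeDir n) (P k)) z * dirDeriv (spaceDir i) (Q k) z
      + dirDeriv (timeDir n) (P k) z * dirDeriv v (dirDeriv (spaceDir i) (Q k)) z
      - (dirDeriv v (dirDeriv (timeDir n) (Q k)) z * dirDeriv (spaceDir i) (P k) z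
      + dirDeriv (timeDir n) (Q k) z * dirDeriv v (dirDeriv (spaceDir i) (P k)) z))
      = 2 * dirDeriv v.2 (partialD i u) z.2 := by
  rw [← dirDeriv_wronskian (fun k => (h.smooth_diff _).1 k z hz)
    (fun k => (h.smooth_diff _).2 k z hz) (fun k => (h.smooth_diff _).2 k z hz)
    (fun k => (h.smooth_diff _).1 k z hz)]
  have hev : (fun z => ∑ k, (dirDeriv (timeDir n) (P k) z * dirDeriv (spaceDir i) (Q k) z
      - dirDeriv (timeDir n) (Q k) z * dirDeriv (spaceDir i) (P k) z))
      =ᶠ[𝓝 z] fun z => 2 * partialD i u z.2 := by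
    filter_upwards [(isOpen_slab n δ).mem_nhds hz] with y hy using h.relation i y hy
  rw [dirDeriv_congr hev]
  have hd : HasFDerivAt (fun z : ℝ × (Fin n → ℝ) => 2 * partialD i u z.2)
      ((2 : ℝ) • (fderiv ℝ (partialD i u) z.2).comp (ContinuousLinearMap.snd ℝ ℝ (Fin n → ℝ))) z :=
    (((h.test.dirDeriv _).differentiableAt z.2).hasFDerivAt.comp z hasFDerivAt_snd).const_mul 2
  rw [dirDeriv, hd.fderiv]
  rfl

/-- The members of a Hamiltonian family are Lagrangian. -/
theorem lagrangian (h : IsHamiltonianFamily δ ρ κ u S P Q) (i j : Fin n)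
    {t : ℝ} (ht : t ∈ Set.Ioo (-δ) δ) (s : Fin n → ℝ) :
    ∑ k, (dirDeriv (spaceDir i) (P k) (t, s) * dirDeriv (spaceDir j) (Q k) (t, s)
      - dirDeriv (spaceDir i) (Q k) (t, s) * dirDeriv (spaceDir j) (P k) (t, s)) = 0 := by
  have hU := isOpen_slab n δ
  set L : ℝ → ℝ := fun t =>
    ∑ k, (dirDeriv (spaceDir i) (P k) (t, s) * dirDeriv (spaceDir j) (Q k) (t, s)
      - dirDeriv (spaceDir i) (Q k) (t, s) * dirDeriv (spaceDir j) (P k) (t, s)) with hL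
  have hderiv : ∀ t ∈ Set.Ioo (-δ) δ, HasDerivAt L 0 t := by
    intro t ht
    have hz : (t, s) ∈ slab n δ := ⟨ht, trivial⟩
    have hd : HasDerivAt L (∑ k, (dirDeriv (timeDir n) (dirDeriv (spaceDir i) (P k)) (t, s)
          * dirDeriv (spaceDir j) (Q k) (t, s)
        + dirDeriv (spaceDir i) (P k) (t, s)
          * dirDeriv (timeDir n) (dirDeriv (spaceDir j) (Q k)) (t, s)
        - (dirDeriv (timeDir n) (dirDeriv (spaceDir i) (Q k)) (t, s)
          * dirDeriv (spaceDir j) (P k) (t, s)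
        + dirDeriv (spaceDir i) (Q k) (t, s)
          * dirDeriv (timeDir n) (dirDeriv (spaceDir j) (P k)) (t, s)))) t :=
      HasDerivAt.fun_sum fun k _ =>
        ((hasDerivAt_slice ((h.smooth_diff _).1 k _ hz)).mul
          (hasDerivAt_slice ((h.smooth_diff _).2 k _ hz))).sub
        ((hasDerivAt_slice ((h.smooth_diff _).2 k _ hz)).mul
          (hasDerivAt_slice ((h.smooth_diff _).1 k _ hz)))
    refine hd.congr_deriv ?_
    have e1 := h.dirDeriv_relation j hz (spaceDir i)
    have e2 := h.dirDeriv_relation i hz (spaceDir j)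
    have e3 : dirDeriv (Pi.single i 1) (partialD j u) s
        = dirDeriv (Pi.single j 1) (partialD i u) s := by
      rw [partialD, dirDeriv_comm h.test.smooth]
    have e4 : ∀ k, dirDeriv (spaceDir i) (dirDeriv (spaceDir j) (P k)) (t, s)
        = dirDeriv (spaceDir j) (dirDeriv (spaceDir i) (P k)) (t, s) := fun k =>
      (h.left_smooth k).dirDeriv_comm hU hz _ _
    have e5 : ∀ k, dirDeriv (spaceDir i) (dirDeriv (spaceDir j) (Q k)) (t, s)
        = dirDeriv (spaceDir j) (dirDeriv (spaceDir i) (Q k)) (t, s) := fun k =>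
      (h.right_smooth k).dirDeriv_comm hU hz _ _
    have e6 : ∀ (l : Fin n) k, dirDeriv (timeDir n) (dirDeriv (spaceDir l) (P k)) (t, s)
        = dirDeriv (spaceDir l) (dirDeriv (timeDir n) (P k)) (t, s) := fun l k =>
      (h.left_smooth k).dirDeriv_comm hU hz _ _
    have e7 : ∀ (l : Fin n) k, dirDeriv (timeDir n) (dirDeriv (spaceDir l) (Q k)) (t, s)
        = dirDeriv (spaceDir l) (dirDeriv (timeDir n) (Q k)) (t, s) := fun l k =>
      (h.right_smooth k).dirDeriv_comm hU hz _ _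
    -- Cartan's formula in coordinates: the time derivative of `2ω(∂ᵢΦ, ∂ⱼΦ)` is `∂ᵢ` of relation
    -- `j` minus `∂ⱼ` of relation `i`, that is `2(∂ᵢ∂ⱼu - ∂ⱼ∂ᵢu) = 0`.
    have e8 := e1.trans ((congrArg (2 * ·) e3).trans e2.symm)
    rw [← sub_eq_zero, ← Finset.sum_sub_distrib] at e8
    rw [← e8]
    refine Finset.sum_congr rfl fun k _ => ?_
    rw [e6, e7, e6, e7, e4, e5]
    ring
  have hconst : L t = L 0 :=
    isOpen_Ioo.is_const_of_deriv_eq_zero isPreconnected_Ioo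
      (fun x hx => (hderiv x hx).differentiableAt.differentiableWithinAt)
      (fun x hx => (hderiv x hx).deriv) ht ⟨neg_neg_of_pos h.pos, h.pos⟩
  change L t = 0
  rw [hconst, hL]
  refine Finset.sum_eq_zero fun k _ => ?_
  simp only [dirDeriv_space_zero h.pos h.left_smooth h.left_zero,
    dirDeriv_space_zero h.pos h.right_smooth h.right_zero]
  by_cases hi : i = k <;> by_cases hj : j = k <;> simp [hi, hj]
  ring

/-- At time `0` the Jacobians are diagonal, so only `k = i` survives in `relation`; the opposite
signs of the exponents turn the difference there into minus a sum. -/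
theorem velocity_relation (h : IsHamiltonianFamily δ ρ κ u S P Q) (i : Fin n) (s : Fin n → ℝ) :
    ρ i * κ i * (logSpeed ρ 1 P i s + logSpeed κ (-1) Q i s) = -2 * partialD i u s := by
  have hr := h.relation i _ (zero_mem_slab h.pos s)
  simp only [dirDeriv_space_zero h.pos h.left_smooth h.left_zero,
    dirDeriv_space_zero h.pos h.right_smooth h.right_zero,
    dirDeriv_time_eq (H := P) (η := 1) h.left_ne,
    dirDeriv_time_eq (H := Q) (η := -1) h.right_ne] at hr
  have hexp : Real.exp (1 * s i) * Real.exp (-1 * s i) = 1 := by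
    rw [← Real.exp_add]; simp
  rw [Finset.sum_eq_single i (fun k _ hk => by simp [Ne.symm hk]) (by simp)] at hr
  simp only [if_true] at hr
  linear_combination -hr
    - (ρ i * κ i * (logSpeed ρ 1 P i s + logSpeed κ (-1) Q i s)) * hexp

/-- The time derivative at `0` of `relation`, whose right side does not depend on time. The
accelerations survive only for `k = i`, whereas the velocities meet the mixed derivatives `∂ᵢ∂ₜ` for
every `k`. -/
theorem acceleration_relation (h : IsHamiltonianFamily δ ρ κ u S P Q) (i : Fin n)
    (s : Fin n → ℝ) :
    ρ i * κ i * (logSpeed ρ 1 (fun k => dirDeriv (timeDir n) (P k)) i s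
        + logSpeed κ (-1) (fun k => dirDeriv (timeDir n) (Q k)) i s
        + 2 * logSpeed ρ 1 P i s * logSpeed κ (-1) Q i s)
      = ∑ k, ρ k * κ k * (logSpeed ρ 1 P k s * partialD i (logSpeed κ (-1) Q k) s
        - logSpeed κ (-1) Q k s * partialD i (logSpeed ρ 1 P k) s) := by
  have hU := isOpen_slab n δ
  have hz := zero_mem_slab h.pos s
  have hr := h.dirDeriv_relation i hz (timeDir n)
  have e6 : ∀ (l : Fin n) k, dirDeriv (timeDir n) (dirDeriv (spaceDir l) (P k)) (0, s)
      = dirDeriv (spaceDir l) (dirDeriv (timeDir n) (P k)) (0, s) := fun l k =>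
    (h.left_smooth k).dirDeriv_comm hU hz _ _
  have e7 : ∀ (l : Fin n) k, dirDeriv (timeDir n) (dirDeriv (spaceDir l) (Q k)) (0, s)
      = dirDeriv (spaceDir l) (dirDeriv (timeDir n) (Q k)) (0, s) := fun l k =>
    (h.right_smooth k).dirDeriv_comm hU hz _ _
  have e8 : ∀ k, dirDeriv (timeDir n) (dirDeriv (timeDir n) (P k)) (0, s)
      = ρ k * Real.exp (1 * s k) * logSpeed ρ 1 (fun k => dirDeriv (timeDir n) (P k)) k s :=
    fun k => dirDeriv_time_eq (H := fun k => dirDeriv (timeDir n) (P k)) h.left_ne k s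
  have e9 : ∀ k, dirDeriv (timeDir n) (dirDeriv (timeDir n) (Q k)) (0, s)
      = κ k * Real.exp (-1 * s k) * logSpeed κ (-1) (fun k => dirDeriv (timeDir n) (Q k)) k s :=
    fun k => dirDeriv_time_eq (H := fun k => dirDeriv (timeDir n) (Q k)) h.right_ne k s
  simp only [e6, e7, e8, e9, dirDeriv_space_zero h.pos h.left_smooth h.left_zero,
    dirDeriv_space_zero h.pos h.right_smooth h.right_zero,
    dirDeriv_space_time_zero (η := 1) h.pos h.left_ne h.left_smooth,
    dirDeriv_space_time_zero (η := -1) h.pos h.right_ne h.right_smooth,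
    dirDeriv_time_eq (H := P) (η := 1) h.left_ne,
    dirDeriv_time_eq (H := Q) (η := -1) h.right_ne] at hr
  have hexp : ∀ k, Real.exp (1 * s k) * Real.exp (-1 * s k) = 1 := fun k => by
    rw [← Real.exp_add]; simp
  have hzero : dirDeriv (timeDir n).2 (partialD i u) s = 0 := by simp [dirDeriv]
  rw [hzero, mul_zero] at hr
  have hsplit : ∀ k, _ = _ := fun k => show
    ρ k * Real.exp (1 * s k) * logSpeed ρ 1 (fun k => dirDeriv (timeDir n) (P k)) k s *
        (if i = k then -1 * (κ k * Real.exp (-1 * s k)) else 0) +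
      ρ k * Real.exp (1 * s k) * logSpeed ρ 1 P k s *
        (κ k * Real.exp (-1 * s k) * (partialD i (logSpeed κ (-1) Q k) s +
          if i = k then -1 * logSpeed κ (-1) Q k s else 0)) -
      (κ k * Real.exp (-1 * s k) * logSpeed κ (-1) (fun k => dirDeriv (timeDir n) (Q k)) k s *
        (if i = k then 1 * (ρ k * Real.exp (1 * s k)) else 0) +
      κ k * Real.exp (-1 * s k) * logSpeed κ (-1) Q k s *
        (ρ k * Real.exp (1 * s k) * (partialD i (logSpeed ρ 1 P k) s +
          if i = k then 1 * logSpeed ρ 1 P k s else 0)))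
    = ρ k * κ k * (logSpeed ρ 1 P k s * partialD i (logSpeed κ (-1) Q k) s
        - logSpeed κ (-1) Q k s * partialD i (logSpeed ρ 1 P k) s)
      - if i = k then ρ k * κ k * (logSpeed ρ 1 (fun k => dirDeriv (timeDir n) (P k)) k s
        + logSpeed κ (-1) (fun k => dirDeriv (timeDir n) (Q k)) k s
        + 2 * logSpeed ρ 1 P k s * logSpeed κ (-1) Q k s) else 0 by
    split_ifs
    · linear_combination (ρ k * κ k * (logSpeed ρ 1 P k s * partialD i (logSpeed κ (-1) Q k) s
        - logSpeed κ (-1) Q k s * partialD i (logSpeed ρ 1 P k) s)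
        - ρ k * κ k * (logSpeed ρ 1 (fun k => dirDeriv (timeDir n) (P k)) k s
        + logSpeed κ (-1) (fun k => dirDeriv (timeDir n) (Q k)) k s
        + 2 * logSpeed ρ 1 P k s * logSpeed κ (-1) Q k s)) * hexp k
    · linear_combination (ρ k * κ k * (logSpeed ρ 1 P k s * partialD i (logSpeed κ (-1) Q k) s
        - logSpeed κ (-1) Q k s * partialD i (logSpeed ρ 1 P k) s)) * hexp k
  rw [Finset.sum_congr rfl fun k _ => hsplit k, Finset.sum_sub_distrib, Finset.sum_ite_eq,
    if_pos (Finset.mem_univ i)] at hr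
  linarith

end IsHamiltonianFamily

end Family

/-! ### First and second variation of the volume -/

section Volume

variable {n : ℕ}

theorem contDiffOn_matrix_det {ι E : Type*} [Fintype ι] [DecidableEq ι] [NormedAddCommGroup E]
    [NormedSpace ℝ E] {M : E → Matrix ι ι ℝ} {U : Set E}
    (h : ∀ i j, ContDiffOn ℝ ∞ (fun z => M z i j) U) : ContDiffOn ℝ ∞ (fun z => (M z).det) U := by
  simp only [Matrix.det_apply, Units.smul_def, zsmul_eq_mul]
  exact ContDiffOn.sum fun σ _ => contDiffOn_const.mul (contDiffOn_prod fun i _ => h (σ i) i)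

theorem ContDiffOn.sqrt_abs {E : Type*} [NormedAddCommGroup E] [NormedSpace ℝ E] {D : E → ℝ}
    {U : Set E} (hD : ContDiffOn ℝ ∞ D U) (h0 : ∀ z ∈ U, D z ≠ 0) :
    ContDiffOn ℝ ∞ (fun z => √|D z|) U :=
  (hD.norm ℝ h0).sqrt fun z hz => (norm_pos_iff.2 (h0 z hz)).ne'

namespace IsHamiltonianFamily

variable {δ : ℝ} {ρ κ : Fin n → ℝ} {u : (Fin n → ℝ) → ℝ} {S : Set (Fin n → ℝ)}
  {P Q : Fin n → ℝ × (Fin n → ℝ) → ℝ}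

/-- The integrand of the first variation, divided by the (constant) volume density and doubled. -/
noncomputable def firstDensity (ρ κ : Fin n → ℝ) (P Q : Fin n → ℝ × (Fin n → ℝ) → ℝ)
    (s : Fin n → ℝ) : ℝ :=
  ∑ i, (partialD i (logSpeed ρ 1 P i) s + logSpeed ρ 1 P i s)
    + ∑ i, (-partialD i (logSpeed κ (-1) Q i) s + logSpeed κ (-1) Q i s)

/-- The integrand of the second variation, divided by the (constant) volume density. -/
noncomputable def secondDensity (ρ κ : Fin n → ℝ) (P Q : Fin n → ℝ × (Fin n → ℝ) → ℝ)
    (s : Fin n → ℝ) : ℝ :=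
  1 / 4 * (firstDensity ρ κ P Q s) ^ 2
    + 1 / 2 * (-∑ i, ∑ j, (partialD i (logSpeed ρ 1 P j) s + if i = j then logSpeed ρ 1 P j s else 0)
          * (partialD j (logSpeed ρ 1 P i) s + if j = i then logSpeed ρ 1 P i s else 0)
        - ∑ i, ∑ j, (-partialD i (logSpeed κ (-1) Q j) s
            + if i = j then logSpeed κ (-1) Q j s else 0)
          * (-partialD j (logSpeed κ (-1) Q i) s + if j = i then logSpeed κ (-1) Q i s else 0)
        + ∑ i, (partialD i (logSpeed ρ 1 (fun k => dirDeriv (timeDir n) (P k)) i) s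
          - partialD i (logSpeed κ (-1) (fun k => dirDeriv (timeDir n) (Q k)) i) s
          + (logSpeed ρ 1 (fun k => dirDeriv (timeDir n) (P k)) i s
            + logSpeed κ (-1) (fun k => dirDeriv (timeDir n) (Q k)) i s)))

/-- The jet of the volume density. -/
theorem hasJetTwo_density (h : IsHamiltonianFamily δ ρ κ u S P Q) (s : Fin n → ℝ) :
    HasJetTwo (fun t => √|(spaceJacobian P (t, s)).det * (spaceJacobian Q (t, s)).det|)
      (√|∏ k, -(ρ k * κ k)|) (√|∏ k, -(ρ k * κ k)| * (1 / 2 * firstDensity ρ κ P Q s))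
      (√|∏ k, -(ρ k * κ k)| * secondDensity ρ κ P Q s) := by
  have h0 : ∏ k, -(ρ k * κ k) ≠ 0 := Finset.prod_ne_zero_iff.2 fun k _ =>
    neg_ne_zero.2 (mul_ne_zero (h.left_ne k) (h.right_ne k))
  have hP := hasJetTwo_det_spaceJacobian (η := 1) h.pos (by norm_num) h.left_ne h.left_smooth
    h.left_zero s
  have hQ := hasJetTwo_det_spaceJacobian (η := -1) h.pos (by norm_num) h.right_ne h.right_smooth
    h.right_zero s
  have hD := ((hP.mul hQ).const_mul (∏ k, -(ρ k * κ k))).sqrt_abs (by simpa using h0)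
  -- The two normalizing factors multiply to the inverse of the initial determinant `∏ (-ρₖ κₖ)`:
  -- the exponentials cancel, so the initial density is constant.
  have hprod : (∏ k, -(ρ k * κ k)) * ((∏ k, (1 * ((ρ k)⁻¹ * Real.exp (-(1 * s k)))))
      * ∏ k, (-1 * ((κ k)⁻¹ * Real.exp (-(-1 * s k))))) = 1 := by
    rw [← Finset.prod_mul_distrib, ← Finset.prod_mul_distrib]
    refine Finset.prod_eq_one fun k _ => ?_
    have := h.left_ne k
    have := h.right_ne k
    have hexp : Real.exp (-(1 * s k)) * Real.exp (-(-1 * s k)) = 1 := by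
      rw [← Real.exp_add]; simp
    generalize Real.exp (-(1 * s k)) = x at hexp ⊢
    generalize Real.exp (-(-1 * s k)) = y at hexp ⊢
    field_simp
    linear_combination hexp
  have hfun : (fun t => √|(∏ k, -(ρ k * κ k))
      * ((∏ k, (1 * ((ρ k)⁻¹ * Real.exp (-(1 * s k))))) * (spaceJacobian P (t, s)).det
      * ((∏ k, (-1 * ((κ k)⁻¹ * Real.exp (-(-1 * s k))))) * (spaceJacobian Q (t, s)).det))|)
      = fun t => √|(spaceJacobian P (t, s)).det * (spaceJacobian Q (t, s)).det| := by
    funext t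
    congr 2
    linear_combination ((spaceJacobian P (t, s)).det * (spaceJacobian Q (t, s)).det) * hprod
  rw [hfun] at hD
  simp only [mul_one, one_mul, neg_one_mul] at hD
  convert hD using 1
  · rw [firstDensity]
    field_simp
  · rw [secondDensity, firstDensity]
    simp only [Finset.sum_add_distrib, Finset.sum_sub_distrib, Finset.sum_neg_distrib]
    field_simp
    ring

theorem isTestFunction_logSpeeds (h : IsHamiltonianFamily δ ρ κ u S P Q) :
    (∀ k, IsTestFunction (logSpeed ρ 1 P k)) ∧ (∀ k, IsTestFunction (logSpeed κ (-1) Q k)) ∧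
    (∀ k, IsTestFunction (logSpeed ρ 1 (fun k => dirDeriv (timeDir n) (P k)) k)) ∧
    ∀ k, IsTestFunction (logSpeed κ (-1) (fun k => dirDeriv (timeDir n) (Q k)) k) :=
  have hU := isOpen_slab n δ
  ⟨isTestFunction_logSpeed h.pos h.left_smooth h.compact h.left_velocity,
    isTestFunction_logSpeed h.pos h.right_smooth h.compact h.right_velocity,
    isTestFunction_logSpeed h.pos (fun k => (h.left_smooth k).dirDeriv hU _) h.compact
      h.left_acceleration,
    isTestFunction_logSpeed h.pos (fun k => (h.right_smooth k).dirDeriv hU _) h.compact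
      h.right_acceleration⟩

/-- This makes the variations independent of the choice of `K ⊇ S`: integrals over `K` are integrals
over `ℝⁿ`. -/
theorem densities_eq_zero (h : IsHamiltonianFamily δ ρ κ u S P Q) {s : Fin n → ℝ} (hs : s ∉ S) :
    firstDensity ρ κ P Q s = 0 ∧ secondDensity ρ κ P Q s = 0 := by
  have hS := h.compact.isClosed
  have key : ∀ {c : Fin n → ℝ} {η : ℝ} {H : Fin n → ℝ × (Fin n → ℝ) → ℝ},
      (∀ k, ∀ s ∉ S, dirDeriv (timeDir n) (H k) (0, s) = 0) →
      (∀ k, logSpeed c η H k s = 0) ∧ ∀ i k, partialD i (logSpeed c η H k) s = 0 :=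
    fun hH => ⟨fun k => by rw [logSpeed, hH k s hs, mul_zero], fun i k =>
      dirDeriv_eq_zero_of_forall_notMem hS (fun x hx => by rw [logSpeed, hH k x hx, mul_zero]) hs _⟩
  obtain ⟨a1, a2⟩ := key (c := ρ) (η := 1) h.left_velocity
  obtain ⟨b1, b2⟩ := key (c := κ) (η := -1) h.right_velocity
  obtain ⟨c1, c2⟩ := key (c := ρ) (η := 1) h.left_acceleration
  obtain ⟨d1, d2⟩ := key (c := κ) (η := -1) h.right_acceleration
  have e1 : firstDensity ρ κ P Q s = 0 := by simp [firstDensity, a1, a2, b1, b2]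
  exact ⟨e1, by simp [secondDensity, e1, a1, a2, b1, b2, c1, c2, d1, d2]⟩

/-- The part without derivatives is `∑ (Aᵢ + Bᵢ) = -2 ∑ ∂ᵢu / εᵢ` by `velocity_relation`. Since `εᵢ`
is constant, this too is a sum of derivatives of test functions. -/
theorem integral_firstDensity (h : IsHamiltonianFamily δ ρ κ u S P Q) :
    ∫ s, firstDensity ρ κ P Q s = 0 := by
  obtain ⟨tA, tB, -, -⟩ := h.isTestFunction_logSpeeds
  have hε : ∀ k, ρ k * κ k ≠ 0 := fun k => mul_ne_zero (h.left_ne k) (h.right_ne k)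
  have e : ∀ s, firstDensity ρ κ P Q s = ∑ i, (partialD i (logSpeed ρ 1 P i) s
      - partialD i (logSpeed κ (-1) Q i) s + -2 / (ρ i * κ i) * partialD i u s) := by
    intro s
    rw [firstDensity, ← Finset.sum_add_distrib]
    refine Finset.sum_congr rfl fun i _ => ?_
    have h1 : logSpeed ρ 1 P i s + logSpeed κ (-1) Q i s = -2 / (ρ i * κ i) * partialD i u s := by
      have := hε i
      rw [div_mul_eq_mul_div, eq_div_iff this, mul_comm, h.velocity_relation]
    linear_combination h1
  have t1 : ∀ i, IsTestFunction fun s => partialD i (logSpeed ρ 1 P i) s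
      - partialD i (logSpeed κ (-1) Q i) s := fun i => ((tA i).dirDeriv _).sub ((tB i).dirDeriv _)
  have t2 : ∀ i, IsTestFunction fun s => -2 / (ρ i * κ i) * partialD i u s := fun i =>
    (h.test.dirDeriv _).const_mul _
  rw [integral_congr_ae (.of_forall e), integral_finsetSum _ fun i _ => ((t1 i).add (t2 i)).integrable]
  refine Finset.sum_eq_zero fun i _ => ?_
  rw [integral_add (t1 i).integrable (t2 i).integrable, integral_sub ((tA i).dirDeriv _).integrable
    ((tB i).dirDeriv _).integrable, integral_const_mul, (tA i).integral_dirDeriv,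
    (tB i).integral_dirDeriv, h.test.integral_dirDeriv]
  ring

theorem integral_secondDensity (h : IsHamiltonianFamily δ ρ κ u S P Q) :
    ∫ s, secondDensity ρ κ P Q s = -hessianForm (fun k => ρ k * κ k) u := by
  obtain ⟨tA, tB, tA₂, tB₂⟩ := h.isTestFunction_logSpeeds
  exact integral_secondVariation (fun k => mul_ne_zero (h.left_ne k) (h.right_ne k)) h.test tA tB
    tA₂ tB₂ h.velocity_relation h.acceleration_relation

/-- First and second variation of the volume of a Hamiltonian family. -/
theorem hasJetTwo_volume (h : IsHamiltonianFamily δ ρ κ u S P Q) {K : Set (Fin n → ℝ)}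
    (hK : IsCompact K) (hSK : S ⊆ K) :
    HasJetTwo (fun t => ∫ s in K, √|(spaceJacobian P (t, s)).det * (spaceJacobian Q (t, s)).det|)
      (∫ _ in K, √|∏ k, -(ρ k * κ k)|) 0
      (-(√|∏ k, -(ρ k * κ k)| * hessianForm (fun k => ρ k * κ k) u)) := by
  have hU := isOpen_slab n δ
  have h0 : ∏ k, -(ρ k * κ k) ≠ 0 := Finset.prod_ne_zero_iff.2 fun k _ =>
    neg_ne_zero.2 (mul_ne_zero (h.left_ne k) (h.right_ne k))
  set D : ℝ × (Fin n → ℝ) → ℝ := fun z => (spaceJacobian P z).det * (spaceJacobian Q z).det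
  have hD : ContDiffOn ℝ ∞ D (slab n δ) :=
    (contDiffOn_matrix_det fun i k => (h.left_smooth k).dirDeriv hU _).mul
      (contDiffOn_matrix_det fun i k => (h.right_smooth k).dirDeriv hU _)
  -- The open set on which `√|D|` is smooth. It contains `{0} × K` because the initial density is a
  -- nonzero constant.
  set W : Set (ℝ × (Fin n → ℝ)) := slab n δ ∩ D ⁻¹' {0}ᶜ
  have hW : IsOpen W := hD.continuousOn.isOpen_inter_preimage hU isOpen_compl_singleton
  have hKW : ∀ s ∈ K, ((0 : ℝ), s) ∈ W := fun s _ => ⟨zero_mem_slab h.pos s, fun h' => by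
    have h1 : √|(spaceJacobian P (0, s)).det * (spaceJacobian Q (0, s)).det| = _ :=
      (h.hasJetTwo_density s).1
    rw [show (spaceJacobian P (0, s)).det * (spaceJacobian Q (0, s)).det = 0 from h'] at h1
    simp only [abs_zero, Real.sqrt_zero] at h1
    exact (Real.sqrt_pos.2 (abs_pos.2 h0)).ne h1⟩
  have hjet := hasJetTwo_setIntegral (μ := volume)
    ((hD.mono Set.inter_subset_left).sqrt_abs fun z hz => hz.2) hW hK hKW
    fun s _ => h.hasJetTwo_density s
  have e1 : ∫ s in K, √|∏ k, -(ρ k * κ k)| * (1 / 2 * firstDensity ρ κ P Q s) = 0 := by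
    rw [integral_const_mul, integral_const_mul, setIntegral_eq_integral_of_forall_compl_eq_zero
      fun s hs => (h.densities_eq_zero fun hs' => hs (hSK hs')).1, h.integral_firstDensity]
    simp
  have e2 : ∫ s in K, √|∏ k, -(ρ k * κ k)| * secondDensity ρ κ P Q s
      = -(√|∏ k, -(ρ k * κ k)| * hessianForm (fun k => ρ k * κ k) u) := by
    rw [integral_const_mul, setIntegral_eq_integral_of_forall_compl_eq_zero
      fun s hs => (h.densities_eq_zero fun hs' => hs (hSK hs')).2, h.integral_secondDensity]
    ring
  rw [e1, e2] at hjet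
  exact hjet

end IsHamiltonianFamily

end Volume

/-! ### Null coordinates, the model parametrization and H-minimality -/

section Hyperbola

variable {n : ℕ}

/-- The null coordinate `xₖ + yₖ` of para-complex space. -/
noncomputable def nullLeft (k : Fin n) : ParaSpace n →L[ℝ] ℝ :=
  (ContinuousLinearMap.fst ℝ ℝ ℝ + ContinuousLinearMap.snd ℝ ℝ ℝ).comp
    (ContinuousLinearMap.proj (R := ℝ) (φ := fun _ : Fin n => ℝ × ℝ) k)

/-- The null coordinate `xₖ - yₖ` of para-complex space. -/
noncomputable def nullRight (k : Fin n) : ParaSpace n →L[ℝ] ℝ :=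
  (ContinuousLinearMap.fst ℝ ℝ ℝ - ContinuousLinearMap.snd ℝ ℝ ℝ).comp
    (ContinuousLinearMap.proj (R := ℝ) (φ := fun _ : Fin n => ℝ × ℝ) k)

@[simp] theorem nullLeft_apply (k : Fin n) (z : ParaSpace n) :
    nullLeft k z = (z k).1 + (z k).2 := rfl

@[simp] theorem nullRight_apply (k : Fin n) (z : ParaSpace n) :
    nullRight k z = (z k).1 - (z k).2 := rfl

theorem two_mul_paraMetric (v w : ParaSpace n) : 2 * paraMetric v w
    = ∑ k, (nullLeft k v * nullRight k w + nullRight k v * nullLeft k w) := by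
  rw [paraMetric, Finset.mul_sum]
  refine Finset.sum_congr rfl fun k _ => ?_
  simp [paraMul, paraConj]; ring

theorem two_mul_paraOmega (v w : ParaSpace n) : 2 * paraOmega v w
    = ∑ k, (nullLeft k v * nullRight k w - nullRight k v * nullLeft k w) := by
  rw [paraOmega, paraMetric, Finset.mul_sum]
  refine Finset.sum_congr rfl fun k _ => ?_
  simp [paraMul, paraConj, paraJ, paraTau]; ring

theorem paraOmega_eq (v w : ParaSpace n) :
    paraOmega v w = ∑ k, ((v k).2 * (w k).1 - (v k).1 * (w k).2) := by
  rw [paraOmega, paraMetric]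
  refine Finset.sum_congr rfl fun k _ => ?_
  simp [paraMul, paraConj, paraJ, paraTau]; ring

theorem paraOmega_self (v : ParaSpace n) : paraOmega v v = 0 := by
  rw [paraOmega_eq]
  exact Finset.sum_eq_zero fun k _ => by ring

theorem paraOmega_injective {v w : ParaSpace n} (h : ∀ x, paraOmega v x = paraOmega w x) :
    v = w := by
  funext k
  have h1 := h (Pi.single k (1, 0))
  have h2 := h (Pi.single k (0, 1))
  simp only [paraOmega_eq] at h1 h2
  rw [Finset.sum_eq_single k (fun j _ hj => by simp [hj]) (by simp),
    Finset.sum_eq_single k (fun j _ hj => by simp [hj]) (by simp)] at h1 h2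
  simp at h1 h2
  exact Prod.ext h2 h1

/-- The model parametrization of the product of hyperbolas. -/
noncomputable def hyperbolaParam (σ : Fin n → Bool) (r : Fin n → ℝ) (s : Fin n → ℝ) :
    ParaSpace n := fun j =>
  if σ j = true then (r j * Real.cosh (s j), r j * Real.sinh (s j))
  else (r j * Real.sinh (s j), r j * Real.cosh (s j))

/-- The smooth left inverse of `hyperbolaParam`. -/
noncomputable def hyperbolaCoord (σ : Fin n → Bool) (r : Fin n → ℝ) (z : ParaSpace n) :
    Fin n → ℝ := fun j =>
  Real.arsinh (if σ j = true then (z j).2 / r j else (z j).1 / r j)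

/-- `r j` or `-r j`, according to the sign `σ j`. -/
def signedRadius (σ : Fin n → Bool) (r : Fin n → ℝ) (j : Fin n) : ℝ :=
  if σ j = true then r j else -r j

variable {σ : Fin n → Bool} {r : Fin n → ℝ}

theorem signedRadius_ne (hr : ∀ j, 0 < r j) (j : Fin n) : signedRadius σ r j ≠ 0 := by
  have := (hr j).ne'
  rw [signedRadius]; split_ifs <;> simpa

theorem nullLeft_hyperbolaParam (s : Fin n → ℝ) (k : Fin n) :
    nullLeft k (hyperbolaParam σ r s) = r k * Real.exp (1 * s k) := by
  rw [nullLeft_apply, hyperbolaParam, one_mul, ← Real.cosh_add_sinh]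
  split_ifs <;> dsimp only <;> ring

theorem nullRight_hyperbolaParam (s : Fin n → ℝ) (k : Fin n) :
    nullRight k (hyperbolaParam σ r s) = signedRadius σ r k * Real.exp (-1 * s k) := by
  rw [nullRight_apply, hyperbolaParam, neg_one_mul, ← Real.cosh_sub_sinh, signedRadius]
  split_ifs <;> dsimp only <;> ring

theorem contDiff_hyperbolaParam : ContDiff ℝ ∞ (hyperbolaParam σ r) := by
  rw [contDiff_pi]
  intro j
  unfold hyperbolaParam
  have h1 : ContDiff ℝ ∞ fun s : Fin n → ℝ => r j * Real.cosh (s j) :=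
    contDiff_const.mul (Real.contDiff_cosh.comp (by fun_prop))
  have h2 : ContDiff ℝ ∞ fun s : Fin n → ℝ => r j * Real.sinh (s j) :=
    contDiff_const.mul (Real.contDiff_sinh.comp (by fun_prop))
  by_cases h : σ j = true
  · simpa only [if_pos h] using h1.prodMk h2
  · simpa only [if_neg h] using h2.prodMk h1

theorem contDiff_hyperbolaCoord : ContDiff ℝ ∞ (hyperbolaCoord σ r) := by
  rw [contDiff_pi]
  intro j
  unfold hyperbolaCoord
  by_cases h : σ j = true
  · simp only [if_pos h]
    exact Real.contDiff_arsinh.comp (by fun_prop)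
  · simp only [if_neg h]
    exact Real.contDiff_arsinh.comp (by fun_prop)

theorem hyperbolaCoord_param (hr : ∀ j, 0 < r j) (s : Fin n → ℝ) :
    hyperbolaCoord σ r (hyperbolaParam σ r s) = s := by
  funext j
  have := (hr j).ne'
  rw [hyperbolaCoord, hyperbolaParam]
  split_ifs <;> simp [mul_div_cancel_left₀ _ this]

theorem hyperbolaParam_mem (hr : ∀ j, 0 < r j) (s : Fin n → ℝ) :
    hyperbolaParam σ r s ∈ hyperbolaProduct σ r := by
  intro j
  have h := Real.cosh_sq (s j)
  have hp := mul_pos (hr j) (Real.cosh_pos (s j))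
  rw [hyperbolaParam]
  split_ifs with hσ
  · exact ⟨by simp only; linear_combination (r j) ^ 2 * h, hp⟩
  · exact ⟨by simp only; linear_combination -(r j) ^ 2 * h, hp⟩

theorem hyperbolaParam_coord (hr : ∀ j, 0 < r j) {z : ParaSpace n}
    (hz : z ∈ hyperbolaProduct σ r) : hyperbolaParam σ r (hyperbolaCoord σ r z) = z := by
  funext j
  have hrj := hr j
  have hzj := hz j
  have key : ∀ x y : ℝ, 0 < x → x ^ 2 = y ^ 2 + r j ^ 2 →
      r j * Real.cosh (Real.arsinh (y / r j)) = x := by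
    intro x y hx hxy
    rw [Real.cosh_arsinh]
    have : 1 + (y / r j) ^ 2 = (x / r j) ^ 2 := by
      field_simp; linarith
    rw [this, Real.sqrt_sq (by positivity)]
    field_simp
  have key2 : ∀ y : ℝ, r j * Real.sinh (Real.arsinh (y / r j)) = y := fun y => by
    rw [Real.sinh_arsinh]; field_simp
  rw [hyperbolaParam, hyperbolaCoord]
  split_ifs with hσ
  · rw [if_pos hσ] at hzj
    rw [key (z j).1 (z j).2 hzj.2 (by linarith [hzj.1]), key2]
  · rw [if_neg hσ] at hzj
    rw [key (z j).2 (z j).1 hzj.2 (by linarith [hzj.1]), key2]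

/-- Closedness matters as well as the embedding: it makes `F ∘ hyperbolaParam σ r` compactly
supported whenever `F` is. -/
theorem isClosedEmbedding_hyperbolaParam (hr : ∀ j, 0 < r j) :
    Topology.IsClosedEmbedding (hyperbolaParam σ r) :=
  Function.LeftInverse.isClosedEmbedding (hyperbolaCoord_param hr)
    contDiff_hyperbolaCoord.continuous contDiff_hyperbolaParam.continuous

theorem range_hyperbolaParam (hr : ∀ j, 0 < r j) :
    Set.range (hyperbolaParam σ r) = hyperbolaProduct σ r :=
  Set.Subset.antisymm (Set.range_subset_iff.2 (hyperbolaParam_mem hr))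
    fun _ hz => ⟨_, hyperbolaParam_coord hr hz⟩

theorem isGlobalParam_hyperbolaParam (hr : ∀ j, 0 < r j) :
    IsGlobalParam (hyperbolaParam σ r) (hyperbolaProduct σ r) where
  smooth := contDiff_hyperbolaParam
  immersion s := by
    have h1 : HasFDerivAt (hyperbolaCoord σ r ∘ hyperbolaParam σ r)
        ((fderiv ℝ (hyperbolaCoord σ r) (hyperbolaParam σ r s)).comp
          (fderiv ℝ (hyperbolaParam σ r) s)) s :=
      ((contDiff_hyperbolaCoord.differentiable (by simp)) _).hasFDerivAt.comp s
        ((contDiff_hyperbolaParam.differentiable (by simp)) s).hasFDerivAt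
    have h2 : hyperbolaCoord σ r ∘ hyperbolaParam σ r = id := funext (hyperbolaCoord_param hr)
    rw [h2] at h1
    have h3 := h1.unique (hasFDerivAt_id s)
    intro v w hvw
    have := congrArg (fun L => L v) h3
    have h4 := congrArg (fun L => L w) h3
    simp only [ContinuousLinearMap.comp_apply, ContinuousLinearMap.id_apply] at this h4
    rw [← this, ← h4, hvw]
  embedding := (isClosedEmbedding_hyperbolaParam hr).isEmbedding
  range_eq := range_hyperbolaParam hr

theorem IsHamiltonianField.eq_zero {F : ParaSpace n → ℝ} {X : ParaSpace n → ParaSpace n}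
    (h : IsHamiltonianField F X) {z : ParaSpace n} (hz : z ∉ tsupport F) : X z = 0 := by
  refine paraOmega_injective fun v => ?_
  have : fderiv ℝ F z = 0 :=
    image_eq_zero_of_notMem_tsupport fun h' => hz (tsupport_fderiv_subset ℝ h')
  rw [h.contract, this, paraOmega_eq]
  simp

/-- Adding `2⟨∂ᵢf, ∂ⱼf⟩` to `2ω(∂ᵢf, ∂ⱼf) = 0` leaves only the products of left with right null
coordinates, so the Gram matrix is the left Jacobian times the transposed right one. -/
theorem det_inducedMetric {f : (Fin n → ℝ) → ParaSpace n} {s : Fin n → ℝ}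
    (h : ∀ i j, paraOmega (fderiv ℝ f s (Pi.single i 1)) (fderiv ℝ f s (Pi.single j 1)) = 0) :
    (inducedMetric f s).det
      = (Matrix.of fun i k => nullLeft k (fderiv ℝ f s (Pi.single i 1))).det
        * (Matrix.of fun i k => nullRight k (fderiv ℝ f s (Pi.single i 1))).det := by
  rw [← Matrix.det_transpose (Matrix.of fun i k => nullRight k (fderiv ℝ f s (Pi.single i 1))),
    ← Matrix.det_mul]
  congr 1
  ext i j
  have h1 := two_mul_paraMetric (fderiv ℝ f s (Pi.single i 1)) (fderiv ℝ f s (Pi.single j 1))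
  have h2 := two_mul_paraOmega (fderiv ℝ f s (Pi.single i 1)) (fderiv ℝ f s (Pi.single j 1))
  rw [h] at h2
  simp only [Finset.sum_add_distrib, Finset.sum_sub_distrib] at h1 h2
  rw [inducedMetric, Matrix.mul_apply]
  simp only [Matrix.of_apply, Matrix.transpose_apply]
  linarith

/-- The bridge from the geometric definitions to null coordinates; the determinant factors at all
small times because the moved submanifold stays Lagrangian. -/
theorem IsHamiltonianVariation.exists_family {F : ParaSpace n → ℝ}
    {X : ParaSpace n → ParaSpace n} {Φ : ℝ → (Fin n → ℝ) → ParaSpace n} (hr : ∀ j, 0 < r j)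
    (h : IsHamiltonianVariation (hyperbolaParam σ r) F X Φ) :
    ∃ δ, IsHamiltonianFamily δ r (signedRadius σ r) (F ∘ hyperbolaParam σ r)
        (hyperbolaParam σ r ⁻¹' tsupport F) (fun k z => nullLeft k (Φ z.1 z.2))
        (fun k z => nullRight k (Φ z.1 z.2)) ∧
      ∀ t ∈ Set.Ioo (-δ) δ, ∀ s, (inducedMetric (Φ t) s).det
        = (spaceJacobian (fun k z => nullLeft k (Φ z.1 z.2)) (t, s)).det
          * (spaceJacobian (fun k z => nullRight k (Φ z.1 z.2)) (t, s)).det := by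
  obtain ⟨hX, δ, hδ, hsm, h0, hder⟩ := h
  have hU := isOpen_slab n δ
  set Ψ : ℝ × (Fin n → ℝ) → ParaSpace n := fun z => Φ z.1 z.2
  have hdiff : ∀ z ∈ slab n δ, DifferentiableAt ℝ Ψ z := fun z hz =>
    (hsm.contDiffAt (hU.mem_nhds hz)).differentiableAt (by simp)
  have hlin : ∀ (L : ParaSpace n →L[ℝ] ℝ) (v : ℝ × (Fin n → ℝ)), ∀ z ∈ slab n δ,
      dirDeriv v (fun z => L (Ψ z)) z = L (fderiv ℝ Ψ z v) := fun L v z hz => by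
    have := L.hasFDerivAt.comp z (hdiff z hz).hasFDerivAt
    rw [dirDeriv, show (fun z => L (Ψ z)) = L ∘ Ψ from rfl, this.fderiv]
    rfl
  have htime : ∀ z ∈ slab n δ, fderiv ℝ Ψ z (timeDir n) = X (Ψ z) := fun z hz => by
    have h1 : HasDerivAt (fun t : ℝ => (t, z.2)) ((1, 0) : ℝ × (Fin n → ℝ)) z.1 :=
      (hasDerivAt_id z.1).prodMk (hasDerivAt_const z.1 z.2)
    exact (HasFDerivAt.comp_hasDerivAt (l := Ψ) z.1 (hdiff z hz).hasFDerivAt h1).unique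
      (hder z.1 hz.1 z.2)
  have hspace : ∀ t ∈ Set.Ioo (-δ) δ, ∀ s, HasFDerivAt (Φ t)
      ((fderiv ℝ Ψ (t, s)).comp (ContinuousLinearMap.inr ℝ ℝ (Fin n → ℝ))) s := fun t ht s =>
    (hdiff (t, s) ⟨ht, trivial⟩).hasFDerivAt.comp s (hasFDerivAt_prodMk_right t s)
  have hFd : ∀ z, DifferentiableAt ℝ F z := hX.smooth.differentiable (by simp)
  -- Conservation of energy: `dF(X) = ω(X, X) = 0`.
  have hFconst : ∀ t ∈ Set.Ioo (-δ) δ, ∀ s, F (Φ t s) = F (hyperbolaParam σ r s) := by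
    intro t ht s
    have hd : ∀ t ∈ Set.Ioo (-δ) δ, HasDerivAt (fun t => F (Φ t s)) 0 t := fun t ht => by
      have := (hFd (Φ t s)).hasFDerivAt.comp_hasDerivAt t (hder t ht s)
      rw [← hX.contract, paraOmega_self] at this
      exact this
    rw [← h0 s]
    exact isOpen_Ioo.is_const_of_deriv_eq_zero isPreconnected_Ioo
      (fun x hx => (hd x hx).differentiableAt.differentiableWithinAt)
      (fun x hx => (hd x hx).deriv) ht ⟨neg_neg_of_pos hδ, hδ⟩
  have hcpt : IsCompact (hyperbolaParam σ r ⁻¹' tsupport F) :=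
    (isClosedEmbedding_hyperbolaParam hr).isCompact_preimage hX.compactSupport
  have hvel : ∀ (L : ParaSpace n →L[ℝ] ℝ), ∀ s ∉ hyperbolaParam σ r ⁻¹' tsupport F,
      dirDeriv (timeDir n) (fun z => L (Ψ z)) (0, s) = 0 := fun L s hs => by
    rw [hlin L _ _ (zero_mem_slab hδ s), htime _ (zero_mem_slab hδ s),
      show Ψ (0, s) = hyperbolaParam σ r s from h0 s, hX.eq_zero hs, map_zero]
  have hacc : ∀ (L : ParaSpace n →L[ℝ] ℝ), ∀ s ∉ hyperbolaParam σ r ⁻¹' tsupport F,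
      dirDeriv (timeDir n) (dirDeriv (timeDir n) (fun z => L (Ψ z))) (0, s) = 0 := by
    intro L s hs
    have hz := zero_mem_slab hδ s
    have hLsm : ContDiffOn ℝ ∞ (fun z => L (Ψ z)) (slab n δ) := L.contDiff.comp_contDiffOn hsm
    have hd := hasDerivAt_slice ((hLsm.dirDeriv hU (timeDir n)).differentiableAt_of_isOpen hU hz)
    -- By continuity the trajectory stays for a short time in the open complement of the support,
    -- where the field vanishes.
    have hev : (fun t => dirDeriv (timeDir n) (fun z => L (Ψ z)) (t, s)) =ᶠ[𝓝 0] fun _ => 0 := by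
      have hc : ContinuousAt (fun t : ℝ => (t, s)) 0 := by fun_prop
      have hc2 : ContinuousAt (fun t : ℝ => Φ t s) 0 :=
        (hder 0 ⟨neg_neg_of_pos hδ, hδ⟩ s).continuousAt
      have hnot : ∀ᶠ t in 𝓝 (0 : ℝ), Φ t s ∈ (tsupport F)ᶜ :=
        hc2.eventually ((isClosed_tsupport F).isOpen_compl.mem_nhds (show Φ 0 s ∉ tsupport F by rw [h0]; exact hs))
      filter_upwards [hc.eventually (hU.mem_nhds hz), hnot] with t ht hts
      rw [hlin L _ _ ht, htime _ ht, show Ψ (t, s) = Φ t s from rfl, hX.eq_zero hts, map_zero]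
    exact hd.unique ((hasDerivAt_const (0 : ℝ) (0 : ℝ)).congr_of_eventuallyEq hev)
  have hfam : IsHamiltonianFamily δ r (signedRadius σ r) (F ∘ hyperbolaParam σ r)
      (hyperbolaParam σ r ⁻¹' tsupport F) (fun k z => nullLeft k (Ψ z))
      (fun k z => nullRight k (Ψ z)) :=
    { pos := hδ
      left_ne := fun k => (hr k).ne'
      right_ne := signedRadius_ne hr
      left_smooth := fun k => (nullLeft k).contDiff.comp_contDiffOn hsm
      right_smooth := fun k => (nullRight k).contDiff.comp_contDiffOn hsm
      left_zero := fun k s => by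
        rw [show Ψ (0, s) = hyperbolaParam σ r s from h0 s, nullLeft_hyperbolaParam]
      right_zero := fun k s => by
        rw [show Ψ (0, s) = hyperbolaParam σ r s from h0 s, nullRight_hyperbolaParam]
      test := ⟨hX.smooth.comp contDiff_hyperbolaParam,
        hX.compactSupport.comp_isClosedEmbedding (isClosedEmbedding_hyperbolaParam hr)⟩
      compact := hcpt
      -- `2ω(X, ∂ᵢΦ) = 2 dF(∂ᵢΦ) = 2 ∂ᵢ(F ∘ Φ t)`, and `F ∘ Φ t` does not depend on `t`.
      relation := fun i z hz => by
        have e1 : HasFDerivAt (F ∘ hyperbolaParam σ r) ((fderiv ℝ F (Φ z.1 z.2)).comp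
            ((fderiv ℝ Ψ z).comp (ContinuousLinearMap.inr ℝ ℝ (Fin n → ℝ)))) z.2 := by
          have := (hFd (Φ z.1 z.2)).hasFDerivAt.comp z.2 (hspace z.1 hz.1 z.2)
          rwa [show F ∘ Φ z.1 = F ∘ hyperbolaParam σ r from funext (hFconst z.1 hz.1)] at this
        rw [partialD, dirDeriv, e1.fderiv]
        simp only [hlin _ _ z hz]
        rw [← two_mul_paraOmega, htime z hz, show Ψ z = Φ z.1 z.2 from rfl, hX.contract]
        rfl
      left_velocity := fun k => hvel _
      right_velocity := fun k => hvel _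
      left_acceleration := fun k => hacc _
      right_acceleration := fun k => hacc _ }
  refine ⟨δ, hfam, fun t ht s => ?_⟩
  have hz : (t, s) ∈ slab n δ := ⟨ht, trivial⟩
  have hentry : ∀ (L : ParaSpace n →L[ℝ] ℝ) i, L (fderiv ℝ (Φ t) s (Pi.single i 1))
      = dirDeriv (spaceDir i) (fun z => L (Ψ z)) (t, s) := fun L i => by
    rw [hlin _ _ _ hz, (hspace t ht s).fderiv]
    rfl
  rw [det_inducedMetric]
  · simp only [hentry]
    rfl
  · intro i j
    have h2 := two_mul_paraOmega (fderiv ℝ (Φ t) s (Pi.single i 1))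
      (fderiv ℝ (Φ t) s (Pi.single j 1))
    simp only [hentry] at h2
    rw [hfam.lagrangian i j ht s] at h2
    simpa using h2

theorem HasJetTwo.hasDerivAt {f : ℝ → ℝ} {a b c : ℝ} (h : HasJetTwo f a b c) :
    HasDerivAt f b 0 := by
  obtain ⟨-, f', h1, h2, -⟩ := h
  exact h2 ▸ h1.self_of_nhds

theorem HasJetTwo.hasSecondDerivAt {f : ℝ → ℝ} {a b c : ℝ} (h : HasJetTwo f a b c) :
    HasSecondDerivAt f c 0 := by
  obtain ⟨-, f', h1, -, h3⟩ := h
  exact ⟨f', h1, h3⟩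

/-- The quadratic form giving (up to sign and a positive factor) the second variation of the
volume of a product of hyperbolas. -/
noncomputable def hyperbolaForm (σ : Fin n → Bool) (r : Fin n → ℝ) (u : (Fin n → ℝ) → ℝ) : ℝ :=
  hessianForm (fun k => r k * signedRadius σ r k) u

/-- The constant volume density of a product of hyperbolas. -/
noncomputable def hyperbolaDensity (σ : Fin n → Bool) (r : Fin n → ℝ) : ℝ :=
  √|∏ k, -(r k * signedRadius σ r k)|

theorem hyperbolaDensity_pos (hr : ∀ j, 0 < r j) : 0 < hyperbolaDensity σ r :=
  Real.sqrt_pos.2 (abs_pos.2 (Finset.prod_ne_zero_iff.2 fun k _ =>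
    neg_ne_zero.2 (mul_ne_zero (hr k).ne' (signedRadius_ne hr k))))

theorem IsHamiltonianVariation.hasVariations {F : ParaSpace n → ℝ}
    {X : ParaSpace n → ParaSpace n} {Φ : ℝ → (Fin n → ℝ) → ParaSpace n} (hr : ∀ j, 0 < r j)
    (h : IsHamiltonianVariation (hyperbolaParam σ r) F X Φ) :
    HasFirstVariation (hyperbolaParam σ r) F Φ 0 ∧
      HasSecondVariation (hyperbolaParam σ r) F Φ
        (-(hyperbolaDensity σ r * hyperbolaForm σ r (F ∘ hyperbolaParam σ r))) := by
  obtain ⟨δ, hfam, hdet⟩ := h.exists_family hr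
  have hjet : ∀ K : Set (Fin n → ℝ), IsCompact K → hyperbolaParam σ r ⁻¹' tsupport F ⊆ K →
      HasJetTwo (fun t => inducedVolume K (Φ t)) (∫ _ in K, hyperbolaDensity σ r) 0
        (-(hyperbolaDensity σ r * hyperbolaForm σ r (F ∘ hyperbolaParam σ r))) := by
    intro K hK hSK
    refine (hfam.hasJetTwo_volume hK hSK).congr ?_
    filter_upwards [Ioo_mem_nhds (neg_neg_of_pos hfam.pos) hfam.pos] with t ht
    simp only [inducedVolume, hdet t ht]
  exact ⟨fun K hK hSK => (hjet K hK hSK).hasDerivAt,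
    fun K hK hSK => (hjet K hK hSK).hasSecondDerivAt⟩

theorem fderiv_hyperbolaParam_null (s v : Fin n → ℝ) (k : Fin n) :
    nullLeft k (fderiv ℝ (hyperbolaParam σ r) s v) = r k * Real.exp (1 * s k) * v k ∧
      nullRight k (fderiv ℝ (hyperbolaParam σ r) s v)
        = -(signedRadius σ r k * Real.exp (-1 * s k) * v k) := by
  have hd := ((contDiff_hyperbolaParam (σ := σ) (r := r)).differentiable (by simp) s).hasFDerivAt
  have h1 := (nullLeft k).hasFDerivAt.comp s hd
  have h2 := (nullRight k).hasFDerivAt.comp s hd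
  rw [show nullLeft k ∘ hyperbolaParam σ r = fun s => r k * Real.exp (1 * s k) from
    funext fun s => nullLeft_hyperbolaParam s k] at h1
  rw [show nullRight k ∘ hyperbolaParam σ r = fun s => signedRadius σ r k * Real.exp (-1 * s k) from
    funext fun s => nullRight_hyperbolaParam s k] at h2
  have e1 := congrArg (fun L => L v) (h1.unique ((hasFDerivAt_exp_coord 1 k s).const_mul (r k)))
  have e2 := congrArg (fun L => L v)
    (h2.unique ((hasFDerivAt_exp_coord (-1) k s).const_mul (signedRadius σ r k)))
  refine ⟨e1.trans ?_, e2.trans ?_⟩ <;> simp <;> ring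

theorem isLagrangianParam_hyperbolaParam : IsLagrangianParam (hyperbolaParam σ r) := by
  intro s v w
  have h := two_mul_paraOmega (fderiv ℝ (hyperbolaParam σ r) s v)
    (fderiv ℝ (hyperbolaParam σ r) s w)
  simp only [(fderiv_hyperbolaParam_null s _ _).1, (fderiv_hyperbolaParam_null s _ _).2] at h
  rw [Finset.sum_eq_zero fun k _ => by ring] at h
  simpa using h

theorem det_inducedMetric_hyperbolaParam (hr : ∀ j, 0 < r j) (s : Fin n → ℝ) :
    (inducedMetric (hyperbolaParam σ r) s).det ≠ 0 := by
  rw [det_inducedMetric fun i j => isLagrangianParam_hyperbolaParam s _ _]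
  simp only [(fderiv_hyperbolaParam_null s _ _).1, (fderiv_hyperbolaParam_null s _ _).2]
  have hdiag : ∀ d : Fin n → ℝ, (Matrix.of fun i k => d k * (Pi.single i (1 : ℝ) : Fin n → ℝ) k)
      = Matrix.diagonal d := fun d => by
    ext i k
    by_cases hik : i = k
    · subst hik; simp
    · simp [hik, Ne.symm hik]
  simp only [← neg_mul]
  rw [hdiag (fun k => r k * Real.exp (1 * s k)),
    hdiag (fun k => -signedRadius σ r k * Real.exp (-1 * s k)), Matrix.det_diagonal,
    Matrix.det_diagonal]
  exact mul_ne_zero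
    (Finset.prod_ne_zero_iff.2 fun k _ => mul_ne_zero (hr k).ne' (Real.exp_pos _).ne')
    (Finset.prod_ne_zero_iff.2 fun k _ =>
      mul_ne_zero (neg_ne_zero.2 (signedRadius_ne hr k)) (Real.exp_pos _).ne')

theorem isHMinimal_hyperbolaParam (hr : ∀ j, 0 < r j) : IsHMinimal (hyperbolaParam σ r) :=
  ⟨isLagrangianParam_hyperbolaParam, det_inducedMetric_hyperbolaParam hr,
    fun _ _ _ h => (h.hasVariations hr).1⟩

end Hyperbola

/-! ### Definiteness in dimensions one and two -/

section Stable

variable {n : ℕ}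

theorem dirDeriv_eq_sum (u : (Fin n → ℝ) → ℝ) (v s : Fin n → ℝ) :
    dirDeriv v u s = ∑ i, v i * partialD i u s := by
  have hv : v = ∑ i, v i • (Pi.single i 1 : Fin n → ℝ) := by
    simp_rw [← Pi.single_smul, smul_eq_mul, mul_one]
    exact (Finset.univ_sum_single v).symm
  simp only [dirDeriv]
  conv_lhs => rw [hv, map_sum]
  simp only [map_smul, smul_eq_mul]

/-- A test function which is constant in some direction vanishes. -/
theorem IsTestFunction.eq_zero_of_dirDeriv_eq_zero {E : Type*} [NormedAddCommGroup E]
    [NormedSpace ℝ E] {u : E → ℝ} (hu : IsTestFunction u) {v : E} (hv : v ≠ 0)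
    (h : ∀ s, _root_.dirDeriv v u s = 0) (s : E) : u s = 0 := by
  have hd : ∀ t : ℝ, HasDerivAt (fun t : ℝ => u (s + t • v)) 0 t := fun t => by
    have h1 : HasDerivAt (fun t : ℝ => s + t • v) v t := by
      simpa using ((hasDerivAt_id t).smul_const v).const_add s
    have := (hu.differentiableAt (s + t • v)).hasFDerivAt.comp_hasDerivAt t h1
    rwa [show fderiv ℝ u (s + t • v) v = 0 from h _] at this
  have hconst : ∀ t : ℝ, u (s + t • v) = u s := fun t => by
    have := is_const_of_deriv_eq_zero (fun t => (hd t).differentiableAt)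
      (fun t => (hd t).deriv) t 0
    simpa using this
  obtain ⟨R, hR⟩ := hu.compact.isCompact.isBounded.exists_norm_le
  have hvn : 0 < ‖v‖ := norm_pos_iff.2 hv
  by_contra hne
  -- Far enough along the line to leave every ball that contains the support.
  set t : ℝ := (|R| + ‖s‖ + 1) / ‖v‖ with ht
  have hmem := hR (s + t • v) (subset_tsupport u (by rw [Function.mem_support, hconst]; exact hne))
  have h1 : ‖t • v‖ = |R| + ‖s‖ + 1 := by
    rw [norm_smul, ht, Real.norm_of_nonneg (by positivity), div_mul_cancel₀ _ hvn.ne']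
  have h2 : ‖t • v‖ ≤ ‖s + t • v‖ + ‖s‖ := by
    simpa using norm_sub_le (s + t • v) s
  linarith [le_abs_self R]

/-- The integrand of `hessianForm` is a test function. -/
theorem isTestFunction_hessianForm_integrand (ε : Fin n → ℝ) {u : (Fin n → ℝ) → ℝ}
    (hu : IsTestFunction u) :
    IsTestFunction (fun s => (∑ i, partialD i (partialD i u) s / ε i) ^ 2) ∧
    IsTestFunction (fun s => 2 * ∑ i, (partialD i u s / ε i) ^ 2
      - (∑ i, partialD i u s / ε i) ^ 2) := by
  have h1 : ∀ i, IsTestFunction fun s => partialD i u s / ε i := fun i => by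
    simpa only [div_eq_inv_mul] using (hu.dirDeriv _).const_mul _
  have h2 : ∀ i, IsTestFunction fun s => partialD i (partialD i u) s / ε i := fun i => by
    simpa only [div_eq_inv_mul] using ((hu.dirDeriv _).dirDeriv _).const_mul _
  exact ⟨(IsTestFunction.sum _ h2).pow_two,
    ((IsTestFunction.sum _ fun i => (h1 i).pow_two).const_mul 2).sub
      (IsTestFunction.sum _ h1).pow_two⟩

theorem hessianForm_pos_of_exists {ε : Fin n → ℝ} {u : (Fin n → ℝ) → ℝ} (hu : IsTestFunction u)
    (hnonneg : ∀ w : Fin n → ℝ, 0 ≤ 2 * ∑ i, w i ^ 2 - (∑ i, w i) ^ 2)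
    (hpos : ∃ s, 0 < 2 * ∑ i, (partialD i u s / ε i) ^ 2 - (∑ i, partialD i u s / ε i) ^ 2) :
    0 < hessianForm ε u := by
  obtain ⟨s, hs⟩ := hpos
  obtain ⟨t1, t2⟩ := isTestFunction_hessianForm_integrand ε hu
  have ht := t1.add t2
  simp only [← add_sub_assoc] at ht
  refine ht.smooth.continuous.integral_pos_of_hasCompactSupport_nonneg_nonzero ht.compact
    (fun s => ?_) (x := s) ?_
  · have := hnonneg fun i => partialD i u s / ε i
    have := sq_nonneg (∑ i, partialD i (partialD i u) s / ε i)
    simp only [Pi.zero_apply]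
    linarith
  · have := sq_nonneg (∑ i, partialD i (partialD i u) s / ε i)
    exact ne_of_gt (by linarith)

/-- The gradient part is `w₀²` for `n = 1` and `(w₀ - w₁)²` for `n = 2`, hence nonnegative; it
remains to find a point where it is positive. -/
theorem hessianForm_pos {ε : Fin n → ℝ} (hn : n = 1 ∨ n = 2) (hε : ∀ i, ε i ≠ 0)
    {u : (Fin n → ℝ) → ℝ} (hu : IsTestFunction u) (hne : ∃ i s, partialD i u s ≠ 0) :
    0 < hessianForm ε u := by
  obtain ⟨i₀, s₀, h₀⟩ := hne
  rcases hn with rfl | rfl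
  · refine hessianForm_pos_of_exists hu (fun w => ?_) ⟨s₀, ?_⟩
    · simp only [Fin.sum_univ_one]; nlinarith [sq_nonneg (w 0)]
    · obtain rfl : i₀ = 0 := Subsingleton.elim _ _
      have : 0 < (partialD 0 u s₀ / ε 0) ^ 2 := by
        have := div_ne_zero h₀ (hε 0)
        positivity
      simp only [Fin.sum_univ_one]; linarith
  · refine hessianForm_pos_of_exists hu (fun w => ?_) ?_
    · simp only [Fin.sum_univ_two]; nlinarith [sq_nonneg (w 0 - w 1)]
    -- If `(w₀ - w₁)²` vanished everywhere, `u` would be constant in the direction `(1/ε₀, -1/ε₁)`,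
    -- hence zero by compact support.
    · by_contra! hcon
      have hzero : ∀ s, dirDeriv ![1 / ε 0, -(1 / ε 1)] u s = 0 := fun s => by
        have := hcon s
        simp only [Fin.sum_univ_two] at this
        rw [dirDeriv_eq_sum]
        simp only [Fin.sum_univ_two, Matrix.cons_val_zero, Matrix.cons_val_one]
        nlinarith [sq_nonneg (1 / ε 0 * partialD 0 u s + -(1 / ε 1) * partialD 1 u s),
          sq_eq_zero_iff.1 (le_antisymm (by linear_combination this) (sq_nonneg
            (1 / ε 0 * partialD 0 u s + -(1 / ε 1) * partialD 1 u s)))]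
      have hv : ![1 / ε 0, -(1 / ε 1)] ≠ 0 := fun h => by
        have := congrFun h 0
        simp [hε 0] at this
      have hu0 : u = fun _ => 0 := funext fun s => hu.eq_zero_of_dirDeriv_eq_zero hv hzero s
      rw [hu0] at h₀
      simp [dirDeriv] at h₀

variable {σ : Fin n → Bool} {r : Fin n → ℝ}

theorem IsHamiltonianField.dirDeriv_comp_param {F : ParaSpace n → ℝ}
    {X : ParaSpace n → ParaSpace n} (h : IsHamiltonianField F X) (s v : Fin n → ℝ) :
    dirDeriv v (F ∘ hyperbolaParam σ r) s
      = paraOmega (X (hyperbolaParam σ r s)) (fderiv ℝ (hyperbolaParam σ r) s v) := by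
  have := (h.smooth.differentiable (by simp) (hyperbolaParam σ r s)).hasFDerivAt.comp s
    (contDiff_hyperbolaParam.differentiable (by simp) s).hasFDerivAt
  rw [dirDeriv, this.fderiv, h.contract]
  rfl

/-- A Lagrangian tangent space is its own `ω`-complement: if the differential of `F` vanishes on it,
then `X` is `ω`-orthogonal to it and hence tangent. -/
theorem exists_partialD_ne_zero (hr : ∀ j, 0 < r j) {F : ParaSpace n → ℝ}
    {X : ParaSpace n → ParaSpace n} (h : IsHamiltonianField F X)
    (hX : IsNontangent (hyperbolaParam σ r) X) :
    ∃ i s, partialD i (F ∘ hyperbolaParam σ r) s ≠ 0 := by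
  obtain ⟨s, hs⟩ := hX
  by_contra! hcon
  -- The tangent vector is chosen to match the left null coordinates of `X`; the vanishing of `ω`
  -- then forces the right ones to match.
  refine hs ⟨fun i => nullLeft i (X (hyperbolaParam σ r s)) / (r i * Real.exp (1 * s i)), ?_⟩
  have hcoord : ∀ v w : ParaSpace n, (∀ k, nullLeft k v = nullLeft k w) →
      (∀ k, nullRight k v = nullRight k w) → v = w := fun v w h1 h2 => by
    funext k
    have e1 := h1 k
    have e2 := h2 k
    simp only [nullLeft_apply, nullRight_apply] at e1 e2
    exact Prod.ext (by linarith) (by linarith)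
  have hp : ∀ k, r k * Real.exp (1 * s k) ≠ 0 := fun k =>
    mul_ne_zero (hr k).ne' (Real.exp_pos _).ne'
  refine hcoord _ _ (fun k => ?_) fun k => ?_
  · rw [(fderiv_hyperbolaParam_null s _ k).1, mul_div_cancel₀ _ (hp k)]
  · rw [(fderiv_hyperbolaParam_null s _ k).2]
    have h1 := hcon k s
    rw [partialD, h.dirDeriv_comp_param] at h1
    have h2 := two_mul_paraOmega (X (hyperbolaParam σ r s))
      (fderiv ℝ (hyperbolaParam σ r) s (Pi.single k 1))
    rw [h1] at h2
    simp only [(fderiv_hyperbolaParam_null s _ _).1, (fderiv_hyperbolaParam_null s _ _).2] at h2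
    rw [Finset.sum_eq_single k (fun j _ hj => by simp [hj]) (by simp), Pi.single_eq_same] at h2
    rw [← mul_div_assoc, neg_eq_iff_eq_neg, div_eq_iff (hp k)]
    linear_combination h2

theorem isHStable_hyperbolaParam (hr : ∀ j, 0 < r j) (hn : n = 1 ∨ n = 2) :
    IsHStable (hyperbolaParam σ r) := by
  -- The second variation is minus a positive constant times a positive form, so the negative
  -- alternative holds.
  refine ⟨isHMinimal_hyperbolaParam hr, Or.inr fun F X Φ h hX =>
    ⟨_, neg_neg_of_pos (mul_pos (hyperbolaDensity_pos hr) ?_), (h.hasVariations hr).2⟩⟩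
  refine hessianForm_pos hn (fun k => mul_ne_zero (hr k).ne' (signedRadius_ne hr k)) ?_
    (exists_partialD_ne_zero hr h.hamiltonian hX)
  exact ⟨h.hamiltonian.smooth.comp contDiff_hyperbolaParam,
    h.hamiltonian.compactSupport.comp_isClosedEmbedding (isClosedEmbedding_hyperbolaParam hr)⟩

end Stable

/-! ### Test functions of both signs in higher dimension -/

section Indefinite

variable {n : ℕ}

/-- The quadratic form `2 ∑ wᵢ² - (∑ wᵢ)²`. -/
noncomputable def gradientForm (w : Fin n → ℝ) : ℝ := 2 * ∑ i, w i ^ 2 - (∑ i, w i) ^ 2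

/-- Any quadratic form, summed over a pair of vectors, is invariant under rotation of the pair. This
cancels the cross terms when a cutoff is modulated by a cosine and by a sine. -/
theorem gradientForm_rotate (a b : Fin n → ℝ) (c d : ℝ) (hcd : c ^ 2 + d ^ 2 = 1) :
    gradientForm (fun i => a i * c - b i * d) + gradientForm (fun i => a i * d + b i * c)
      = gradientForm a + gradientForm b := by
  have h1 : ∑ i, (a i * c - b i * d) ^ 2 + ∑ i, (a i * d + b i * c) ^ 2
      = ∑ i, a i ^ 2 + ∑ i, b i ^ 2 := by
    simp only [← Finset.sum_add_distrib]
    refine Finset.sum_congr rfl fun i _ => ?_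
    linear_combination (a i ^ 2 + b i ^ 2) * hcd
  simp only [gradientForm, Finset.sum_sub_distrib, Finset.sum_add_distrib, ← Finset.sum_mul] at h1 ⊢
  linear_combination 2 * h1 - ((∑ i, a i) ^ 2 + (∑ i, b i) ^ 2) * hcd

theorem gradientForm_smul (c : ℝ) (a : Fin n → ℝ) :
    gradientForm (fun i => c * a i) = c ^ 2 * gradientForm a := by
  simp only [gradientForm, mul_pow, ← Finset.mul_sum]
  ring

theorem gradientForm_indicator {m : ℕ} (hm : m ≤ n) :
    gradientForm (fun i : Fin n => if i.val < m then 1 else 0) = 2 * m - m ^ 2 := by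
  have h : ∑ i : Fin n, (if i.val < m then (1 : ℝ) else 0) = m := by
    rw [Fin.sum_univ_eq_sum_range (fun i => if i < m then (1 : ℝ) else 0) n,
      ← Finset.sum_filter, Finset.sum_const]
    have : (Finset.range n).filter (· < m) = Finset.range m := by
      ext i; simp; omega
    rw [this]; simp
  simp only [gradientForm, ite_pow, one_pow, ne_eq, OfNat.ofNat_ne_zero, not_false_eq_true,
    zero_pow, h]

theorem isTestFunction_gradientForm (ε : Fin n → ℝ) {u : (Fin n → ℝ) → ℝ}
    (hu : IsTestFunction u) :
    IsTestFunction (fun s => gradientForm fun i => partialD i u s / ε i) :=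
  (isTestFunction_hessianForm_integrand ε hu).2

/-- If a multiple of `gradientForm` takes a negative value, then so does its integral on gradients
of test functions. -/
theorem exists_integral_gradientForm_neg {ε : Fin n → ℝ} (hε : ∀ i, ε i ≠ 0) {α : ℝ}
    {ξ : Fin n → ℝ} (hξ : α * gradientForm ξ < 0) :
    ∃ u : (Fin n → ℝ) → ℝ, IsTestFunction u ∧
      α * ∫ s, gradientForm (fun i => partialD i u s / ε i) < 0 := by
  obtain ⟨χ⟩ : Nonempty (ContDiffBump (0 : Fin n → ℝ)) := inferInstance
  have hχ : IsTestFunction (χ : (Fin n → ℝ) → ℝ) := ⟨χ.contDiff, χ.hasCompactSupport⟩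
  have hχ2 : 0 < ∫ s, χ s ^ 2 := by
    refine hχ.pow_two.smooth.continuous.integral_pos_of_hasCompactSupport_nonneg_nonzero
      hχ.pow_two.compact (fun s => sq_nonneg _) (x := 0) ?_
    have : χ 0 = 1 := χ.one_of_mem_closedBall (by simp [χ.rIn_pos.le])
    simp [this]
  set g : ℝ := ∫ s, gradientForm (fun i => partialD i χ s / ε i) with hg
  -- A frequency `l` so large that the oscillation outweighs the gradient of the cutoff. With `l² =
  -- |α g| / (-N) + 1` the expression is `α g - |α g| + N < 0`.
  obtain ⟨l, hl⟩ : ∃ l : ℝ, α * g + l ^ 2 * (α * gradientForm ξ * ∫ s, χ s ^ 2) < 0 := by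
    set N := α * gradientForm ξ * ∫ s, χ s ^ 2
    have hNneg : N < 0 := mul_neg_of_neg_of_pos hξ hχ2
    refine ⟨√(|α * g| / -N + 1), ?_⟩
    have hnn : 0 ≤ |α * g| / -N := div_nonneg (abs_nonneg _) (neg_nonneg.2 hNneg.le)
    rw [Real.sq_sqrt (by linarith), add_mul, one_mul]
    have : |α * g| / -N * N = -|α * g| := by
      rw [div_neg, neg_mul, div_mul_cancel₀ _ hNneg.ne]
    rw [this]
    linarith [le_abs_self (α * g)]
  -- The factor `ε i` cancels the division by `ε i` in the form, so the phase contributes the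
  -- direction `l ξ`.
  set κ : Fin n → ℝ := fun i => l * (ε i * ξ i) with hκ
  set lin : (Fin n → ℝ) →L[ℝ] ℝ :=
    ∑ i, κ i • ContinuousLinearMap.proj (R := ℝ) (φ := fun _ : Fin n => ℝ) i with hlin
  have hlin1 : ∀ i, lin (Pi.single i 1) = κ i := fun i => by
    simp [hlin, Pi.single_apply]
  have hcos : ContDiff ℝ ∞ fun s => Real.cos (lin s) := Real.contDiff_cos.comp lin.contDiff
  have hsin : ContDiff ℝ ∞ fun s => Real.sin (lin s) := Real.contDiff_sin.comp lin.contDiff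
  have tc := hχ.mul_smooth hcos
  have ts := hχ.mul_smooth hsin
  have dc : ∀ i s, partialD i (fun s => χ s * Real.cos (lin s)) s / ε i
      = partialD i χ s / ε i * Real.cos (lin s) - (l * χ s) * ξ i * Real.sin (lin s) := by
    intro i s
    rw [partialD, dirDeriv_mul (hχ.differentiableAt s) (hcos.differentiable (by simp) s)]
    have : dirDeriv (Pi.single i 1) (fun s => Real.cos (lin s)) s = -Real.sin (lin s) * κ i := by
      rw [dirDeriv, (lin.hasFDerivAt.cos).fderiv]
      simp [hlin1]
    rw [this, hκ]
    have := hε i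
    field_simp
    ring
  have ds : ∀ i s, partialD i (fun s => χ s * Real.sin (lin s)) s / ε i
      = partialD i χ s / ε i * Real.sin (lin s) + (l * χ s) * ξ i * Real.cos (lin s) := by
    intro i s
    rw [partialD, dirDeriv_mul (hχ.differentiableAt s) (hsin.differentiable (by simp) s)]
    have : dirDeriv (Pi.single i 1) (fun s => Real.sin (lin s)) s = Real.cos (lin s) * κ i := by
      rw [dirDeriv, (lin.hasFDerivAt.sin).fderiv]
      simp [hlin1]
    rw [this, hκ]
    have := hε i
    field_simp
  have hsum : (∫ s, gradientForm fun i => partialD i (fun s => χ s * Real.cos (lin s)) s / ε i)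
      + (∫ s, gradientForm fun i => partialD i (fun s => χ s * Real.sin (lin s)) s / ε i)
      = g + l ^ 2 * (gradientForm ξ * ∫ s, χ s ^ 2) := by
    rw [← integral_add (isTestFunction_gradientForm ε tc).integrable
      (isTestFunction_gradientForm ε ts).integrable, hg, ← integral_const_mul,
      ← integral_const_mul, ← integral_add (isTestFunction_gradientForm ε hχ).integrable
      ((hχ.pow_two.const_mul _).const_mul _).integrable]
    refine integral_congr_ae (.of_forall fun s => ?_)
    simp only [dc, ds]
    rw [gradientForm_rotate _ (fun i => l * χ s * ξ i) _ _ (Real.cos_sq_add_sin_sq _),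
      gradientForm_smul]
    ring
  -- The contributions of `χ cos` and `χ sin` add up to a number whose product with `α` is negative,
  -- so one of the two functions will do.
  by_contra! hcon
  have h1 := hcon _ tc
  have h2 := hcon _ ts
  have h3 := congrArg (α * ·) hsum
  simp only [mul_add] at h3
  linarith

theorem partialD_comp_smul {u : (Fin n → ℝ) → ℝ} (hu : IsTestFunction u) (c : ℝ) (i : Fin n)
    (s : Fin n → ℝ) : partialD i (fun s => u (c • s)) s = c * partialD i u (c • s) := by
  have h : HasFDerivAt (fun s => u (c • s)) _ s :=
    (hu.differentiableAt (c • s)).hasFDerivAt.comp s ((hasFDerivAt_id s).const_smul c)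
  rw [partialD, dirDeriv, h.fderiv]
  simp [dirDeriv]

theorem IsTestFunction.comp_smul {u : (Fin n → ℝ) → ℝ} (hu : IsTestFunction u) {c : ℝ}
    (hc : c ≠ 0) : IsTestFunction fun s => u (c • s) :=
  ⟨hu.smooth.comp (contDiff_const_smul c), hu.compact.comp_smul hc⟩

theorem hessianForm_eq (ε : Fin n → ℝ) {u : (Fin n → ℝ) → ℝ} (hu : IsTestFunction u) :
    hessianForm ε u = (∫ s, (∑ i, partialD i (partialD i u) s / ε i) ^ 2)
      + ∫ s, gradientForm (fun i => partialD i u s / ε i) := by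
  obtain ⟨t1, t2⟩ := isTestFunction_hessianForm_integrand ε hu
  rw [← integral_add t1.integrable (isTestFunction_gradientForm ε hu).integrable, hessianForm]
  simp only [gradientForm, add_sub_assoc]

theorem exists_hessianForm_pos {ε : Fin n → ℝ} (hε : ∀ i, ε i ≠ 0) (hn : 1 ≤ n) :
    ∃ u : (Fin n → ℝ) → ℝ, IsTestFunction u ∧ 0 < hessianForm ε u := by
  obtain ⟨u, hu, h⟩ := exists_integral_gradientForm_neg hε (α := -1)
    (ξ := fun i : Fin n => if i.val < 1 then 1 else 0) (by
      rw [gradientForm_indicator hn]; norm_num)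
  refine ⟨u, hu, ?_⟩
  rw [hessianForm_eq ε hu]
  have : 0 ≤ ∫ s, (∑ i, partialD i (partialD i u) s / ε i) ^ 2 :=
    integral_nonneg fun s => sq_nonneg _
  linarith

/-- Three equal components give `2 · 3 - 3² = -3`. Replacing `u` by `u(c ·)` multiplies the
second-derivative part by `c⁴` and the gradient part by `c²`, up to a common Jacobian, so the
gradient part wins for small `c`. -/
theorem exists_hessianForm_neg {ε : Fin n → ℝ} (hε : ∀ i, ε i ≠ 0) (hn : 3 ≤ n) :
    ∃ u : (Fin n → ℝ) → ℝ, IsTestFunction u ∧ hessianForm ε u < 0 := by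
  obtain ⟨u, hu, h⟩ := exists_integral_gradientForm_neg hε (α := 1)
    (ξ := fun i : Fin n => if i.val < 3 then 1 else 0) (by
      rw [gradientForm_indicator hn]; norm_num)
  rw [one_mul] at h
  set G := ∫ s, gradientForm (fun i => partialD i u s / ε i) with hG
  set A := ∫ s, (∑ i, partialD i (partialD i u) s / ε i) ^ 2 with hA
  have hA0 : 0 ≤ A := integral_nonneg fun s => sq_nonneg _
  -- With `c² = -G / (A + 1)` the expression equals `-c²`; the `+ 1` allows `A = 0`.
  obtain ⟨c, hc, hcG⟩ : ∃ c : ℝ, 0 < c ∧ c ^ 2 * A + G < 0 := by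
    have hq : 0 < -G / (A + 1) := div_pos (neg_pos.2 h) (by linarith)
    refine ⟨√(-G / (A + 1)), Real.sqrt_pos.2 hq, ?_⟩
    rw [Real.sq_sqrt hq.le]
    have : -G / (A + 1) * (A + 1) = -G := div_mul_cancel₀ _ (by linarith)
    linarith
  have tc := hu.comp_smul hc.ne'
  refine ⟨_, tc, ?_⟩
  have h1 : ∀ i s, partialD i (fun s => u (c • s)) s = c * partialD i u (c • s) :=
    partialD_comp_smul hu c
  have h2 : ∀ i s, partialD i (partialD i fun s => u (c • s)) s
      = c ^ 2 * partialD i (partialD i u) (c • s) := fun i s => by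
    have e : (partialD i fun s => u (c • s)) = fun s => c * partialD i u (c • s) :=
      funext (h1 i)
    have e3 := partialD_comp_smul (hu.dirDeriv (Pi.single i 1)) c i s
    rw [e, partialD, dirDeriv_const_mul (((hu.dirDeriv _).comp_smul hc.ne').differentiableAt s)]
    linear_combination c * e3
  have e1 : ∫ s, (∑ i, partialD i (partialD i fun s => u (c • s)) s / ε i) ^ 2
      = |(c ^ Module.finrank ℝ (Fin n → ℝ))⁻¹| * (c ^ 4 * A) := by
    rw [mul_left_comm, hA, ← smul_eq_mul (a := |_|), ← Measure.integral_comp_smul volume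
      (fun s => (∑ i, partialD i (partialD i u) s / ε i) ^ 2) c, ← integral_const_mul]
    refine integral_congr_ae (.of_forall fun s => ?_)
    simp only [h2, mul_div_assoc, ← Finset.mul_sum]
    ring
  have e2 : ∫ s, gradientForm (fun i => partialD i (fun s => u (c • s)) s / ε i)
      = |(c ^ Module.finrank ℝ (Fin n → ℝ))⁻¹| * (c ^ 2 * G) := by
    rw [mul_left_comm, hG, ← smul_eq_mul (a := |_|), ← Measure.integral_comp_smul volume
      (fun s => gradientForm fun i => partialD i u s / ε i) c, ← integral_const_mul]
    refine integral_congr_ae (.of_forall fun s => ?_)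
    simp only [h1, mul_div_assoc, gradientForm_smul]
  rw [hessianForm_eq ε tc, e1, e2]
  have hpos : 0 < |(c ^ Module.finrank ℝ (Fin n → ℝ))⁻¹| := abs_pos.2 (by positivity)
  have : |(c ^ Module.finrank ℝ (Fin n → ℝ))⁻¹| * (c ^ 4 * A)
      + |(c ^ Module.finrank ℝ (Fin n → ℝ))⁻¹| * (c ^ 2 * G)
      = |(c ^ Module.finrank ℝ (Fin n → ℝ))⁻¹| * c ^ 2 * (c ^ 2 * A + G) := by ring
  rw [this]
  exact mul_neg_of_pos_of_neg (by positivity) hcG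

end Indefinite

/-! ### Realizing a test function by a normal Hamiltonian variation -/

section Extension

variable {n : ℕ}

/-- The hyperbolic angles of the components of a point of para-complex space. -/
noncomputable def hyperbolaAngle (z : ParaSpace n) : Fin n → ℝ := fun j =>
  1 / 2 * (Real.log (nullLeft j z) - Real.log (nullRight j z))

/-- The squared lengths of the components, relative to those of a product of hyperbolas. -/
noncomputable def relativeSquare (σ : Fin n → Bool) (r : Fin n → ℝ) (j : Fin n)
    (z : ParaSpace n) : ℝ := nullLeft j z * nullRight j z / (r j * signedRadius σ r j)

/-- A cutoff function on the line, equal to `1` near `1`. -/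
noncomputable def unitBump : ContDiffBump (1 : ℝ) where
  rIn := 1 / 4
  rOut := 1 / 2
  rIn_pos := by norm_num
  rIn_lt_rOut := by norm_num

/-- The extension of a function on a product of hyperbolas to para-complex space which is constant
along rays near the product of hyperbolas. -/
noncomputable def radialExtension (σ : Fin n → Bool) (r : Fin n → ℝ) (u : (Fin n → ℝ) → ℝ)
    (z : ParaSpace n) : ℝ :=
  (∏ j, unitBump (relativeSquare σ r j z)) * u (hyperbolaAngle z)

/-- The Hamiltonian vector field of a function on para-complex space. -/
noncomputable def hamiltonianField (F : ParaSpace n → ℝ) (z : ParaSpace n) : ParaSpace n :=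
  fun j => (-fderiv ℝ F z (Pi.single j (0, 1)), fderiv ℝ F z (Pi.single j (1, 0)))

theorem isHamiltonianField_hamiltonianField {F : ParaSpace n → ℝ} (hF : ContDiff ℝ ∞ F)
    (hc : HasCompactSupport F) : IsHamiltonianField F (hamiltonianField F) where
  smooth := hF
  compactSupport := hc
  contract z v := by
    rw [paraOmega_eq]
    have hv : v = ∑ j, ((v j).1 • (Pi.single j (1, 0) : ParaSpace n)
        + (v j).2 • (Pi.single j (0, 1) : ParaSpace n)) := by
      conv_lhs => rw [← Finset.univ_sum_single v]
      refine Finset.sum_congr rfl fun j _ => ?_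
      rw [← Pi.single_smul, ← Pi.single_smul, ← Pi.single_add]
      simp
    conv_rhs => rw [hv, map_sum]
    refine Finset.sum_congr rfl fun j _ => ?_
    simp only [hamiltonianField, map_add, map_smul, smul_eq_mul]
    ring

variable {σ : Fin n → Bool} {r : Fin n → ℝ} {u : (Fin n → ℝ) → ℝ}

theorem contDiff_relativeSquare (j : Fin n) : ContDiff ℝ ∞ (relativeSquare σ r j) :=
  ((nullLeft j).contDiff.mul (nullRight j).contDiff).div_const _

theorem hasFDerivAt_hyperbolaAngle {z : ParaSpace n} (j : Fin n) (hl : nullLeft j z ≠ 0)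
    (hr : nullRight j z ≠ 0) : HasFDerivAt (fun z => hyperbolaAngle z j)
      ((1 / 2 : ℝ) • ((nullLeft j z)⁻¹ • nullLeft j - (nullRight j z)⁻¹ • nullRight j)) z :=
  (((nullLeft j).hasFDerivAt.log hl).sub ((nullRight j).hasFDerivAt.log hr)).const_mul _

/-- The angles are singular only where a null coordinate vanishes; there the corresponding relative
square is `0` and the cutoff is zero nearby, so the default value of the logarithm at `0` is
harmless. -/
theorem contDiff_radialExtension (hu : ContDiff ℝ ∞ u) :
    ContDiff ℝ ∞ (radialExtension σ r u) := by
  rw [contDiff_iff_contDiffAt]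
  intro z
  by_cases h : ∀ j, nullLeft j z ≠ 0 ∧ nullRight j z ≠ 0
  · have h1 : ContDiffAt ℝ ∞ hyperbolaAngle z := by
      rw [contDiffAt_pi]
      exact fun j => contDiffAt_const.mul (((nullLeft j).contDiff.contDiffAt.log (h j).1).sub
        ((nullRight j).contDiff.contDiffAt.log (h j).2))
    exact (contDiffAt_prod fun j _ => (unitBump.contDiff.comp
      (contDiff_relativeSquare j)).contDiffAt).mul (hu.contDiffAt.comp z h1)
  · push Not at h
    obtain ⟨j, hj⟩ := h
    have h0 : relativeSquare σ r j z = 0 := by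
      rw [relativeSquare]
      by_cases hl : nullLeft j z = 0
      · rw [hl]; simp
      · rw [hj hl]; simp
    have hev : radialExtension σ r u =ᶠ[𝓝 z] fun _ => 0 := by
      have hcont := (contDiff_relativeSquare (σ := σ) (r := r) j).continuous.continuousAt (x := z)
      have : ∀ᶠ y in 𝓝 z, relativeSquare σ r j y < 1 / 2 :=
        hcont.eventually (gt_mem_nhds (by rw [h0]; norm_num))
      filter_upwards [this] with y hy
      have hb : unitBump (relativeSquare σ r j y) = 0 := unitBump.zero_of_le_dist (by
        rw [Real.dist_eq, abs_sub_comm]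
        exact le_trans (by rw [unitBump]; linarith) (le_abs_self _))
      rw [radialExtension, Finset.prod_eq_zero (Finset.mem_univ j) hb, zero_mul]
    exact contDiffAt_const.congr_of_eventuallyEq hev

/-- Rests on `a² = |a b| e^{log a - log b}`. It bounds the null coordinates on the support of the
extension, where the product `a b` and the angle are both bounded. -/
theorem sq_le_of_log_sub_log_le {a b R c : ℝ} (hab : a * b ≠ 0) (hc : |a * b| ≤ c)
    (h : |1 / 2 * (Real.log a - Real.log b)| ≤ R) : a ^ 2 ≤ c * Real.exp (2 * R) := by
  have ha := left_ne_zero_of_mul hab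
  have hb := right_ne_zero_of_mul hab
  have h1 : a ^ 2 = |a * b| * Real.exp (Real.log a - Real.log b) := by
    rw [Real.exp_sub, Real.exp_log_eq_abs ha, Real.exp_log_eq_abs hb, abs_mul]
    have := abs_ne_zero.2 hb
    field_simp
    rw [sq_abs]
  rw [h1]
  have h2 := (abs_le.1 h).2
  have hc0 := (abs_nonneg _).trans hc
  gcongr
  linarith

theorem hasCompactSupport_radialExtension (hr : ∀ j, 0 < r j) (hu : HasCompactSupport u) :
    HasCompactSupport (radialExtension σ r u) := by
  obtain ⟨R, hR⟩ := hu.isCompact.isBounded.exists_norm_le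
  set c : Fin n → ℝ := fun j => 3 / 2 * |r j * signedRadius σ r j| * Real.exp (2 * R)
  have hc0 : ∀ j, 0 ≤ c j := fun j => by positivity
  have hcs : 0 ≤ ∑ j, c j := Finset.sum_nonneg fun j _ => hc0 j
  refine HasCompactSupport.intro (isCompact_closedBall (0 : ParaSpace n) (1 + ∑ j, c j))
    fun z hz => ?_
  contrapose! hz
  rw [mem_closedBall_zero_iff, pi_norm_le_iff_of_nonneg (by linarith)]
  intro j
  have hbump : unitBump (relativeSquare σ r j z) ≠ 0 := fun h => hz (by
    rw [radialExtension, Finset.prod_eq_zero (Finset.mem_univ j) h, zero_mul])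
  have hε : r j * signedRadius σ r j ≠ 0 := mul_ne_zero (hr j).ne' (signedRadius_ne hr j)
  have hdist : |relativeSquare σ r j z - 1| < 1 / 2 := by
    by_contra! h
    exact hbump (unitBump.zero_of_le_dist (by rw [Real.dist_eq]; exact h))
  have hmem : hyperbolaAngle z ∈ tsupport u := subset_tsupport u fun h => hz (by
    rw [radialExtension, h, mul_zero])
  have hangle : |hyperbolaAngle z j| ≤ R := (norm_le_pi_norm (hyperbolaAngle z) j).trans (hR _ hmem)
  obtain ⟨h1, h2⟩ := abs_lt.1 hdist
  have hprod : nullLeft j z * nullRight j z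
      = relativeSquare σ r j z * (r j * signedRadius σ r j) := by
    rw [relativeSquare, div_mul_cancel₀ _ hε]
  have hne : nullLeft j z * nullRight j z ≠ 0 := by
    rw [hprod]; exact mul_ne_zero (by linarith) hε
  have hle : |nullLeft j z * nullRight j z| ≤ 3 / 2 * |r j * signedRadius σ r j| := by
    rw [hprod, abs_mul, abs_of_pos (by linarith : 0 < relativeSquare σ r j z)]
    gcongr
    linarith
  have e1 := sq_le_of_log_sub_log_le hne hle hangle
  have e2 := sq_le_of_log_sub_log_le (a := nullRight j z) (b := nullLeft j z) (R := R)
    (mul_comm (nullLeft j z) _ ▸ hne) (mul_comm (nullLeft j z) _ ▸ hle) (by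
      rw [← abs_neg]; convert hangle using 2; rw [hyperbolaAngle]; ring)
  have hcj : c j ≤ ∑ j, c j := Finset.single_le_sum (fun j _ => hc0 j) (Finset.mem_univ j)
  rw [nullLeft_apply] at e1
  rw [nullRight_apply] at e2
  change _ ≤ c j at e1
  change _ ≤ c j at e2
  rw [Prod.norm_def, max_le_iff, Real.norm_eq_abs, Real.norm_eq_abs, abs_le, abs_le]
  refine ⟨⟨?_, ?_⟩, ?_, ?_⟩ <;>
    nlinarith [sq_nonneg ((z j).1 + (z j).2 - 1), sq_nonneg ((z j).1 + (z j).2 + 1),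
      sq_nonneg ((z j).1 - (z j).2 - 1), sq_nonneg ((z j).1 - (z j).2 + 1)]

theorem hasFDerivAt_radialExtension (hu : ContDiff ℝ ∞ u) {z : ParaSpace n}
    (hz : ∀ j, relativeSquare σ r j z ∈ Set.Ioo (3 / 4) (5 / 4)) :
    ∀ v, fderiv ℝ (radialExtension σ r u) z v = ∑ j, partialD j u (hyperbolaAngle z)
      * (1 / 2 * ((nullLeft j z)⁻¹ * nullLeft j v - (nullRight j z)⁻¹ * nullRight j v)) := by
  have hev : radialExtension σ r u =ᶠ[𝓝 z] fun z => u (hyperbolaAngle z) := by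
    have : ∀ᶠ y in 𝓝 z, ∀ j, relativeSquare σ r j y ∈ Set.Ioo (3 / 4) (5 / 4) := by
      rw [Filter.eventually_all]
      exact fun j => (contDiff_relativeSquare j).continuous.continuousAt.eventually
        (isOpen_Ioo.mem_nhds (hz j))
    filter_upwards [this] with y hy
    rw [radialExtension, Finset.prod_eq_one, one_mul]
    intro j _
    refine unitBump.one_of_mem_closedBall ?_
    rw [Metric.mem_closedBall, Real.dist_eq, abs_le]
    exact ⟨by rw [unitBump]; linarith [(hy j).1], by rw [unitBump]; linarith [(hy j).2]⟩
  have hne : ∀ j, nullLeft j z ≠ 0 ∧ nullRight j z ≠ 0 := fun j => by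
    have h : relativeSquare σ r j z ≠ 0 := by linarith [(hz j).1]
    rw [relativeSquare] at h
    exact ⟨fun h0 => h (by simp [h0]), fun h0 => h (by simp [h0])⟩
  have hangle := hasFDerivAt_pi.2 fun j => hasFDerivAt_hyperbolaAngle j (hne j).1 (hne j).2
  have hcomp := (hu.differentiable (by simp) (hyperbolaAngle z)).hasFDerivAt.comp z hangle
  intro v
  rw [hev.fderiv_eq, show (fun z => u (hyperbolaAngle z)) = u ∘ fun z j => hyperbolaAngle z j
    from rfl, hcomp.fderiv, ContinuousLinearMap.comp_apply]
  refine (dirDeriv_eq_sum u _ _).trans (Finset.sum_congr rfl fun j _ => ?_)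
  simp
  ring

/-- The explicit Hamiltonian flow of a radial extension, starting from a product of hyperbolas. -/
noncomputable def radialFlow (σ : Fin n → Bool) (r : Fin n → ℝ) (u : (Fin n → ℝ) → ℝ) (t : ℝ)
    (s : Fin n → ℝ) : ParaSpace n := fun j =>
  √(1 + t * (-2 * partialD j u s / (r j * signedRadius σ r j))) • hyperbolaParam σ r s j

theorem exp_mul_exp_neg (x : ℝ) : Real.exp (1 * x) * Real.exp (-1 * x) = 1 := by
  rw [← Real.exp_add]; simp

theorem log_sub_log_hyperbola (hr : ∀ j, 0 < r j) {l : ℝ} (hl : l ≠ 0) (s : Fin n → ℝ)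
    (j : Fin n) : 1 / 2 * (Real.log (l * (r j * Real.exp (1 * s j)))
      - Real.log (l * (signedRadius σ r j * Real.exp (-1 * s j)))) = s j := by
  have h1 := (hr j).ne'
  have h2 := signedRadius_ne (σ := σ) hr j
  -- `Real.log` ignores the sign of its argument, so a single angle formula serves both kinds of
  -- hyperbola.
  have h3 : Real.log (signedRadius σ r j) = Real.log (r j) := by
    rw [signedRadius]; split_ifs
    · rfl
    · exact Real.log_neg_eq_log _
  rw [Real.log_mul hl (mul_ne_zero h1 (Real.exp_pos _).ne'), Real.log_mul hl
    (mul_ne_zero h2 (Real.exp_pos _).ne'), Real.log_mul h1 (Real.exp_pos _).ne',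
    Real.log_mul h2 (Real.exp_pos _).ne', Real.log_exp, Real.log_exp, h3]
  ring

theorem radialExtension_comp_param (hr : ∀ j, 0 < r j) (u : (Fin n → ℝ) → ℝ) :
    radialExtension σ r u ∘ hyperbolaParam σ r = u := by
  funext s
  have h1 : hyperbolaAngle (hyperbolaParam σ r s) = s := funext fun j => by
    have := log_sub_log_hyperbola (σ := σ) hr one_ne_zero s j
    simpa only [hyperbolaAngle, nullLeft_hyperbolaParam, nullRight_hyperbolaParam,
      one_mul] using this
  have h2 : ∀ j, relativeSquare σ r j (hyperbolaParam σ r s) = 1 := fun j => by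
    rw [relativeSquare, nullLeft_hyperbolaParam, nullRight_hyperbolaParam,
      div_eq_one_iff_eq (mul_ne_zero (hr j).ne' (signedRadius_ne hr j))]
    linear_combination (r j * signedRadius σ r j) * exp_mul_exp_neg (s j)
  have h3 : unitBump (1 : ℝ) = 1 := unitBump.one_of_mem_closedBall (by simp [unitBump])
  simp [radialExtension, h1, h2, h3]

/-- Angles and relative squares behave like angle-action coordinates: where the cutoffs are `1` the
Hamiltonian depends on the angles alone, so the angles are conserved and each relative square grows
at the constant rate `a j s`. -/
theorem isHamiltonianVariation_radialFlow (hr : ∀ j, 0 < r j) (hu : IsTestFunction u) :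
    IsHamiltonianVariation (hyperbolaParam σ r) (radialExtension σ r u)
      (hamiltonianField (radialExtension σ r u)) (radialFlow σ r u) ∧
    IsNormalAlong (hyperbolaParam σ r) (hamiltonianField (radialExtension σ r u)) := by
  have hX := isHamiltonianField_hamiltonianField (contDiff_radialExtension (σ := σ) (r := r)
    hu.smooth) (hasCompactSupport_radialExtension hr hu.compact)
  set a : Fin n → (Fin n → ℝ) → ℝ := fun j s =>
    -2 * partialD j u s / (r j * signedRadius σ r j) with ha
  have hε : ∀ j, r j * signedRadius σ r j ≠ 0 := fun j =>
    mul_ne_zero (hr j).ne' (signedRadius_ne hr j)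
  have ta : ∀ j, IsTestFunction (a j) := fun j => by
    have := (hu.dirDeriv (Pi.single j 1)).const_mul (-2 / (r j * signedRadius σ r j))
    convert this using 2 with s
    rw [ha]; ring
  obtain ⟨C, hC0, hC⟩ : ∃ C : ℝ, 0 < C ∧ ∀ j s, |a j s| ≤ C := by
    have h : ∀ j, ∃ C, ∀ s, ‖a j s‖ ≤ C := fun j =>
      (ta j).compact.exists_bound_of_continuous (ta j).smooth.continuous
    choose C hC using h
    refine ⟨1 + ∑ j, |C j|, by positivity, fun j s => (hC j s).trans ?_⟩
    have := Finset.single_le_sum (fun j _ => abs_nonneg (C j)) (Finset.mem_univ j)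
    linarith [le_abs_self (C j)]
  -- For `|t| < δ` the relative squares `1 + t a` stay within `1/4` of `1`, where every cutoff
  -- equals `1`.
  set δ : ℝ := 1 / (4 * C) with hδ
  have hδ0 : 0 < δ := by positivity
  have hlam : ∀ t ∈ Set.Ioo (-δ) δ, ∀ j s, 1 + t * a j s ∈ Set.Ioo (3 / 4 : ℝ) (5 / 4) := by
    intro t ht j s
    have h1 : |t * a j s| < 1 / 4 := by
      rw [abs_mul]
      have h2 : |t| < δ := abs_lt.2 ht
      calc |t| * |a j s| ≤ |t| * C := by gcongr; exact hC j s
        _ < δ * C := by gcongr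
        _ = 1 / 4 := by rw [hδ]; field_simp
    obtain ⟨h2, h3⟩ := abs_lt.1 h1
    exact ⟨by linarith, by linarith⟩
  have hleft : ∀ t s j, nullLeft j (radialFlow σ r u t s)
      = √(1 + t * a j s) * (r j * Real.exp (1 * s j)) := fun t s j => by
    rw [← nullLeft_hyperbolaParam (σ := σ)]
    simp only [nullLeft_apply, radialFlow, Prod.smul_fst, Prod.smul_snd, smul_eq_mul]
    ring
  have hright : ∀ t s j, nullRight j (radialFlow σ r u t s)
      = √(1 + t * a j s) * (signedRadius σ r j * Real.exp (-1 * s j)) := fun t s j => by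
    rw [← nullRight_hyperbolaParam (σ := σ)]
    simp only [nullRight_apply, radialFlow, Prod.smul_fst, Prod.smul_snd, smul_eq_mul]
    ring
  have hsqrt : ∀ t ∈ Set.Ioo (-δ) δ, ∀ j s, 0 < √(1 + t * a j s) ∧
      √(1 + t * a j s) * √(1 + t * a j s) = 1 + t * a j s := fun t ht j s => by
    have := (hlam t ht j s).1
    exact ⟨Real.sqrt_pos.2 (by linarith), Real.mul_self_sqrt (by linarith)⟩
  have hangle : ∀ t ∈ Set.Ioo (-δ) δ, ∀ s, hyperbolaAngle (radialFlow σ r u t s) = s :=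
    fun t ht s => funext fun j => by
      rw [hyperbolaAngle, hleft, hright]
      exact log_sub_log_hyperbola hr (hsqrt t ht j s).1.ne' s j
  have hrel : ∀ t ∈ Set.Ioo (-δ) δ, ∀ s j, relativeSquare σ r j (radialFlow σ r u t s)
      = 1 + t * a j s := fun t ht s j => by
    rw [relativeSquare, hleft, hright, div_eq_iff (hε j)]
    linear_combination (r j * signedRadius σ r j * √(1 + t * a j s) * √(1 + t * a j s))
      * exp_mul_exp_neg (s j) + (r j * signedRadius σ r j) * (hsqrt t ht j s).2
  -- The right side is the time derivative of `√(1 + t a)` times the base point. By nondegeneracy of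
  -- `ω` it suffices to compare pairings with all `v`.
  have hfield : ∀ t ∈ Set.Ioo (-δ) δ, ∀ s,
      hamiltonianField (radialExtension σ r u) (radialFlow σ r u t s)
        = fun j => (a j s / (2 * √(1 + t * a j s))) • hyperbolaParam σ r s j := by
    intro t ht s
    refine paraOmega_injective fun v => ?_
    rw [hX.contract, hasFDerivAt_radialExtension hu.smooth fun j => by
      rw [hrel t ht]; exact hlam t ht j s]
    refine mul_left_cancel₀ (two_ne_zero (α := ℝ)) ?_
    rw [two_mul_paraOmega, Finset.mul_sum, hangle t ht]
    refine Finset.sum_congr rfl fun j _ => ?_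
    have e1 : nullLeft j (fun j => (a j s / (2 * √(1 + t * a j s))) • hyperbolaParam σ r s j)
        = a j s / (2 * √(1 + t * a j s)) * (r j * Real.exp (1 * s j)) := by
      rw [← nullLeft_hyperbolaParam (σ := σ)]
      simp only [nullLeft_apply, Prod.smul_fst, Prod.smul_snd, smul_eq_mul]
      ring
    have e2 : nullRight j (fun j => (a j s / (2 * √(1 + t * a j s))) • hyperbolaParam σ r s j)
        = a j s / (2 * √(1 + t * a j s)) * (signedRadius σ r j * Real.exp (-1 * s j)) := by
      rw [← nullRight_hyperbolaParam (σ := σ)]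
      simp only [nullRight_apply, Prod.smul_fst, Prod.smul_snd, smul_eq_mul]
      ring
    rw [hleft, hright, e1, e2]
    have h1 := (hsqrt t ht j s).1.ne'
    have h2 := (hr j).ne'
    have h3 := signedRadius_ne (σ := σ) hr j
    have h4 : partialD j u s = -(a j s * (r j * signedRadius σ r j)) / 2 := by
      rw [ha]; field_simp
    have h5 := exp_mul_exp_neg (s j)
    have h6 := (Real.exp_pos (1 * s j)).ne'
    have h7 : Real.exp (-1 * s j) = (Real.exp (1 * s j))⁻¹ := eq_inv_of_mul_eq_one_right h5
    rw [h4, h7]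
    generalize √(1 + t * a j s) = l at h1 ⊢
    generalize Real.exp (1 * s j) = e at h6 ⊢
    field_simp
    ring
  refine ⟨⟨hX, δ, hδ0, ?_, fun s => ?_, fun t ht s => ?_⟩, fun s v => ?_⟩
  · rw [contDiffOn_pi]
    intro j
    have h1 : ContDiff ℝ ∞ fun p : ℝ × (Fin n → ℝ) => 1 + p.1 * a j p.2 :=
      contDiff_const.add (contDiff_fst.mul ((ta j).smooth.comp contDiff_snd))
    have h2 : ContDiff ℝ ∞ fun p : ℝ × (Fin n → ℝ) => hyperbolaParam σ r p.2 j :=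
      (contDiff_pi.1 contDiff_hyperbolaParam j).comp contDiff_snd
    exact (h1.contDiffOn.sqrt fun p hp => by
      have := (hlam p.1 hp.1 j p.2).1; linarith).smul h2.contDiffOn
  · funext j
    simp [radialFlow]
  · rw [hfield t ht, hasDerivAt_pi]
    intro j
    have h1 : HasDerivAt (fun t => 1 + t * a j s) (a j s) t := by
      simpa using ((hasDerivAt_id t).mul_const (a j s)).const_add 1
    exact (h1.sqrt (by have := (hlam t ht j s).1; linarith)).smul_const _
  · have h0 : (0 : ℝ) ∈ Set.Ioo (-δ) δ := ⟨neg_neg_of_pos hδ0, hδ0⟩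
    have hflow0 : radialFlow σ r u 0 s = hyperbolaParam σ r s := funext fun j => by
      simp [radialFlow]
    have hf := hfield 0 h0 s
    rw [hflow0] at hf
    have h2 := two_mul_paraMetric (hamiltonianField (radialExtension σ r u) (hyperbolaParam σ r s))
      (fderiv ℝ (hyperbolaParam σ r) s v)
    rw [Finset.sum_eq_zero] at h2
    · simpa using h2
    -- At time `0` the field is a multiple of the position vector in each factor, and the position
    -- vector is normal to a hyperbola centred at the origin.
    · intro k _
      rw [(fderiv_hyperbolaParam_null s _ _).1, (fderiv_hyperbolaParam_null s _ _).2, hf]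
      have e1 := nullLeft_hyperbolaParam (σ := σ) (r := r) s k
      have e2 := nullRight_hyperbolaParam (σ := σ) (r := r) s k
      simp only [nullLeft_apply, nullRight_apply, Prod.smul_fst, Prod.smul_snd, smul_eq_mul,
        ← mul_add, ← mul_sub] at e1 e2 ⊢
      rw [e1, e2]
      ring

theorem isHUnstable_hyperbolaParam (hr : ∀ j, 0 < r j) (hn : 3 ≤ n) :
    IsHUnstable (hyperbolaParam σ r) := by
  have hε : ∀ j, r j * signedRadius σ r j ≠ 0 := fun j =>
    mul_ne_zero (hr j).ne' (signedRadius_ne hr j)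
  have key : ∀ u : (Fin n → ℝ) → ℝ, IsTestFunction u → ∃ F X Φ,
      IsHamiltonianVariation (hyperbolaParam σ r) F X Φ ∧ IsNormalAlong (hyperbolaParam σ r) X ∧
      HasSecondVariation (hyperbolaParam σ r) F Φ
        (-(hyperbolaDensity σ r * hyperbolaForm σ r u)) := fun u hu => by
    obtain ⟨h1, h2⟩ := isHamiltonianVariation_radialFlow (σ := σ) hr hu
    have h3 := (h1.hasVariations hr).2
    rw [radialExtension_comp_param hr] at h3
    exact ⟨_, _, _, h1, h2, h3⟩
  have hd := hyperbolaDensity_pos (σ := σ) hr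
  obtain ⟨u, hu, hneg⟩ := exists_hessianForm_neg hε hn
  obtain ⟨w, hw, hpos⟩ := exists_hessianForm_pos hε (by omega)
  obtain ⟨F, X, Φ, h1, h2, h3⟩ := key u hu
  obtain ⟨F', X', Φ', h1', h2', h3'⟩ := key w hw
  exact ⟨isHMinimal_hyperbolaParam hr,
    ⟨F, X, Φ, h1, h2, _, neg_pos.2 (mul_neg_of_pos_of_neg hd hneg), h3⟩,
    F', X', Φ', h1', h2', _, neg_neg_of_pos (mul_pos hd hpos), h3'⟩

end Extension

/-! ### Independence of the parametrization -/

section Reparametrization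

variable {n : ℕ}

/-- `f` and `h` differ by the diffeomorphism `ψ` with inverse `g`. -/
structure IsReparametrization (f h : (Fin n → ℝ) → ParaSpace n)
    (ψ g : (Fin n → ℝ) → Fin n → ℝ) : Prop where
  smooth : ContDiff ℝ ∞ ψ
  smooth_inv : ContDiff ℝ ∞ g
  left_inv : ∀ s, g (ψ s) = s
  right_inv : ∀ s, ψ (g s) = s
  eq_comp : f = fun s => h (ψ s)

/-- This form needs no Lagrangian condition and reduces the change of the Gram matrix under
reparametrization to the chain rule for the two null Jacobians. -/
theorem gram_eq (f : (Fin n → ℝ) → ParaSpace n) (s : Fin n → ℝ) :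
    (2 : ℝ) • inducedMetric f s
      = (Matrix.of fun i k => nullLeft k (fderiv ℝ f s (Pi.single i 1)))
          * (Matrix.of fun i k => nullRight k (fderiv ℝ f s (Pi.single i 1))).transpose
        + (Matrix.of fun i k => nullRight k (fderiv ℝ f s (Pi.single i 1)))
          * (Matrix.of fun i k => nullLeft k (fderiv ℝ f s (Pi.single i 1))).transpose := by
  ext i j
  rw [Matrix.smul_apply, smul_eq_mul, inducedMetric, Matrix.of_apply, two_mul_paraMetric,
    Finset.sum_add_distrib]
  rfl

theorem det_inducedMetric_comp {h : (Fin n → ℝ) → ParaSpace n} {ψ : (Fin n → ℝ) → Fin n → ℝ}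
    {s : Fin n → ℝ} (hh : DifferentiableAt ℝ h (ψ s)) (hψ : DifferentiableAt ℝ ψ s) :
    (inducedMetric (fun s => h (ψ s)) s).det
      = (fderiv ℝ ψ s).det ^ 2 * (inducedMetric h (ψ s)).det := by
  have hd : fderiv ℝ (fun s => h (ψ s)) s = (fderiv ℝ h (ψ s)).comp (fderiv ℝ ψ s) :=
    fderiv_comp s hh hψ
  set N : Matrix (Fin n) (Fin n) ℝ := Matrix.of fun i l => fderiv ℝ ψ s (Pi.single i 1) l with hN
  have hmul : ∀ L : Fin n → ParaSpace n →L[ℝ] ℝ,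
      (Matrix.of fun i k => L k (fderiv ℝ (fun s => h (ψ s)) s (Pi.single i 1)))
        = N * Matrix.of fun i k => L k (fderiv ℝ h (ψ s) (Pi.single i 1)) := fun L => by
    ext i k
    rw [Matrix.mul_apply, hd]
    simp only [Matrix.of_apply, ContinuousLinearMap.comp_apply, hN]
    have hv : fderiv ℝ ψ s (Pi.single i 1)
        = ∑ l, fderiv ℝ ψ s (Pi.single i 1) l • (Pi.single l 1 : Fin n → ℝ) := by
      simp_rw [← Pi.single_smul, smul_eq_mul, mul_one]
      exact (Finset.univ_sum_single _).symm
    conv_lhs => rw [hv, map_sum, map_sum]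
    simp only [map_smul, smul_eq_mul]
  have hG : inducedMetric (fun s => h (ψ s)) s = N * inducedMetric h (ψ s) * N.transpose := by
    have h2 : (2 : ℝ) • inducedMetric (fun s => h (ψ s)) s
        = (2 : ℝ) • (N * inducedMetric h (ψ s) * N.transpose) := by
      rw [gram_eq, hmul, hmul, ← Matrix.smul_mul, ← Matrix.mul_smul, gram_eq,
        Matrix.transpose_mul, Matrix.transpose_mul, Matrix.mul_add, Matrix.add_mul]
      simp only [Matrix.mul_assoc]
    exact smul_right_injective _ (two_ne_zero (α := ℝ)) h2
  have hdet : N.det = (fderiv ℝ ψ s).det := by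
    have : N.transpose = LinearMap.toMatrix' (fderiv ℝ ψ s : (Fin n → ℝ) →ₗ[ℝ] Fin n → ℝ) := by
      ext i j
      simp [hN, LinearMap.toMatrix'_apply, Matrix.transpose_apply]
    rw [← Matrix.det_transpose, this, LinearMap.det_toMatrix']
  rw [hG, Matrix.det_mul, Matrix.det_mul, Matrix.det_transpose, hdet]
  ring

theorem IsHamiltonianVariation.comp {f : (Fin n → ℝ) → ParaSpace n} {F : ParaSpace n → ℝ}
    {X : ParaSpace n → ParaSpace n} {Φ : ℝ → (Fin n → ℝ) → ParaSpace n}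
    (h : IsHamiltonianVariation f F X Φ) {g : (Fin n → ℝ) → Fin n → ℝ} (hg : ContDiff ℝ ∞ g) :
    IsHamiltonianVariation (fun s => f (g s)) F X (fun t s => Φ t (g s)) := by
  obtain ⟨hX, δ, hδ, hsm, h0, hder⟩ := h
  refine ⟨hX, δ, hδ, ?_, fun s => h0 (g s), fun t ht s => hder t ht (g s)⟩
  exact hsm.comp (contDiff_fst.prodMk (hg.comp contDiff_snd)).contDiffOn
    fun p hp => ⟨hp.1, trivial⟩

theorem IsFlowVariation.eventually_differentiable {f : (Fin n → ℝ) → ParaSpace n}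
    {X : ParaSpace n → ParaSpace n} {Φ : ℝ → (Fin n → ℝ) → ParaSpace n}
    (h : IsFlowVariation f X Φ) : ∀ᶠ t in 𝓝 (0 : ℝ), Differentiable ℝ (Φ t) := by
  obtain ⟨δ, hδ, hsm, -, -⟩ := h
  filter_upwards [Ioo_mem_nhds (neg_neg_of_pos hδ) hδ] with t ht s
  exact ((hsm.contDiffAt ((isOpen_slab n δ).mem_nhds (⟨ht, trivial⟩ : (t, s) ∈ slab n δ)))
    |>.differentiableAt (by simp)).comp s (hasFDerivAt_prodMk_right t s).differentiableAt

theorem HasSecondDerivAt.congr {V W : ℝ → ℝ} {c t : ℝ} (h : HasSecondDerivAt V c t)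
    (hVW : W =ᶠ[𝓝 t] V) : HasSecondDerivAt W c t := by
  obtain ⟨V', h1, h2⟩ := h
  refine ⟨V', ?_, h2⟩
  filter_upwards [h1, hVW.eventually_nhds] with x hx hx' using hx.congr_of_eventuallyEq hx'

namespace IsReparametrization

variable {f h : (Fin n → ℝ) → ParaSpace n} {ψ g : (Fin n → ℝ) → Fin n → ℝ}

theorem symm (H : IsReparametrization f h ψ g) : IsReparametrization h f g ψ :=
  ⟨H.smooth_inv, H.smooth, H.right_inv, H.left_inv, by
    funext s; rw [H.eq_comp]; simp only [H.right_inv]⟩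

theorem fderiv_eq (H : IsReparametrization f h ψ g) (hh : ContDiff ℝ ∞ h) (s : Fin n → ℝ) :
    fderiv ℝ f s = (fderiv ℝ h (ψ s)).comp (fderiv ℝ ψ s) := by
  rw [H.eq_comp]
  exact fderiv_comp s (hh.differentiable (by simp) _) (H.smooth.differentiable (by simp) s)

/-- Change of variables: the Gram determinant picks up `(det ψ')²`, whose square root is exactly the
Jacobian factor. -/
theorem inducedVolume_eq (H : IsReparametrization f h ψ g) {Ψ : (Fin n → ℝ) → ParaSpace n}
    (hΨ : Differentiable ℝ Ψ) {K : Set (Fin n → ℝ)} (hK : IsCompact K) :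
    inducedVolume K Ψ = inducedVolume (ψ '' K) fun s => Ψ (g s) := by
  have hψ := H.smooth.differentiable (by simp)
  rw [inducedVolume, inducedVolume, integral_image_eq_integral_abs_det_fderiv_smul volume
    hK.isClosed.measurableSet (fun s _ => (hψ s).hasFDerivAt.hasFDerivWithinAt)
    (Function.LeftInverse.injective H.left_inv).injOn]
  refine setIntegral_congr_fun hK.isClosed.measurableSet fun s _ => ?_
  have e := det_inducedMetric_comp (h := fun s => Ψ (g s)) (ψ := ψ) (s := s)
    ((hΨ _).comp _ (H.smooth_inv.differentiable (by simp) _)) (hψ s)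
  simp only [H.left_inv] at e
  change √|(inducedMetric Ψ s).det| = _
  rw [e, abs_mul, Real.sqrt_mul (abs_nonneg _), abs_pow, Real.sqrt_sq (abs_nonneg _), smul_eq_mul]

theorem hasVariations (H : IsReparametrization f h ψ g) {F : ParaSpace n → ℝ}
    {X : ParaSpace n → ParaSpace n} {Φ : ℝ → (Fin n → ℝ) → ParaSpace n}
    (hΦ : IsHamiltonianVariation f F X Φ) (c : ℝ) :
    (HasFirstVariation h F (fun t s => Φ t (g s)) c → HasFirstVariation f F Φ c) ∧
      (HasSecondVariation h F (fun t s => Φ t (g s)) c → HasSecondVariation f F Φ c) := by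
  have hK' : ∀ K : Set (Fin n → ℝ), IsCompact K → f ⁻¹' tsupport F ⊆ K →
      IsCompact (ψ '' K) ∧ h ⁻¹' tsupport F ⊆ ψ '' K ∧
      (fun t => inducedVolume K (Φ t))
        =ᶠ[𝓝 0] fun t => inducedVolume (ψ '' K) fun s => Φ t (g s) := fun K hK hS => by
    refine ⟨hK.image H.smooth.continuous, fun s hs => ⟨g s, hS ?_, H.right_inv s⟩, ?_⟩
    · rw [Set.mem_preimage, H.eq_comp]
      change h (ψ (g s)) ∈ tsupport F
      rw [H.right_inv]
      exact hs
    · filter_upwards [hΦ.flow.eventually_differentiable] with t ht using H.inducedVolume_eq ht hK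
  refine ⟨fun h1 K hK hS => ?_, fun h1 K hK hS => ?_⟩
  · obtain ⟨a, b, e⟩ := hK' K hK hS
    exact (h1 _ a b).congr_of_eventuallyEq e
  · obtain ⟨a, b, e⟩ := hK' K hK hS
    exact (h1 _ a b).congr e

theorem transport (H : IsReparametrization f h ψ g) {F : ParaSpace n → ℝ}
    {X : ParaSpace n → ParaSpace n} {Φ : ℝ → (Fin n → ℝ) → ParaSpace n}
    (hΦ : IsHamiltonianVariation f F X Φ) :
    IsHamiltonianVariation h F X fun t s => Φ t (g s) := by
  rw [H.symm.eq_comp]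
  exact hΦ.comp H.smooth_inv

theorem isLagrangianParam (H : IsReparametrization f h ψ g) (hh : ContDiff ℝ ∞ h)
    (hL : IsLagrangianParam h) : IsLagrangianParam f := fun s v w => by
  rw [H.fderiv_eq hh]
  exact hL _ _ _

theorem isHMinimal (H : IsReparametrization f h ψ g) (hf : ContDiff ℝ ∞ f) (hh : ContDiff ℝ ∞ h)
    (hm : IsHMinimal h) : IsHMinimal f := by
  refine ⟨H.isLagrangianParam hh hm.1, fun s h0 => hm.2.1 (ψ s) ?_, fun F X Φ hΦ =>
    (H.hasVariations hΦ 0).1 (hm.2.2 F X _ (H.transport hΦ))⟩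
  rw [H.symm.eq_comp, det_inducedMetric_comp (hf.differentiable (by simp) _)
    (H.smooth_inv.differentiable (by simp) _), H.left_inv, h0, mul_zero]

theorem isHStable (H : IsReparametrization f h ψ g) (hf : ContDiff ℝ ∞ f) (hh : ContDiff ℝ ∞ h)
    (hs : IsHStable h) : IsHStable f := by
  have hnt : ∀ X, IsNontangent f X → IsNontangent h X := by
    rintro X ⟨s, hX⟩
    refine ⟨ψ s, fun ⟨v, hv⟩ => hX ⟨fderiv ℝ g (ψ s) v, ?_⟩⟩
    rw [H.symm.fderiv_eq hf, H.left_inv, ContinuousLinearMap.comp_apply] at hv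
    rw [hv, H.eq_comp]
  refine ⟨H.isHMinimal hf hh hs.1, hs.2.imp (fun hp F X Φ hΦ hX => ?_) fun hp F X Φ hΦ hX => ?_⟩
  all_goals
    obtain ⟨c, hc, h2⟩ := hp F X _ (H.transport hΦ) (hnt X hX)
    exact ⟨c, hc, (H.hasVariations hΦ c).2 h2⟩

theorem isHUnstable (H : IsReparametrization f h ψ g) (hf : ContDiff ℝ ∞ f)
    (hh : ContDiff ℝ ∞ h) (hu : IsHUnstable h) : IsHUnstable f := by
  have key : ∀ {F X Φ c}, IsHamiltonianVariation h F X Φ → IsNormalAlong h X →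
      HasSecondVariation h F Φ c → IsHamiltonianVariation f F X (fun t s => Φ t (ψ s)) ∧
        IsNormalAlong f X ∧ HasSecondVariation f F (fun t s => Φ t (ψ s)) c := by
    intro F X Φ c hΦ hX hc
    have hΦ' := H.symm.transport hΦ
    refine ⟨hΦ', fun s v => ?_, (H.hasVariations hΦ' c).2 ?_⟩
    · rw [H.fderiv_eq hh, ContinuousLinearMap.comp_apply, H.eq_comp]
      exact hX _ _
    · simpa only [H.right_inv] using hc
  obtain ⟨hm, ⟨F, X, Φ, h1, h2, c, hc, h3⟩, F', X', Φ', h1', h2', c', hc', h3'⟩ := hu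
  obtain ⟨a1, a2, a3⟩ := key h1 h2 h3
  obtain ⟨b1, b2, b3⟩ := key h1' h2' h3'
  exact ⟨H.isHMinimal hf hh hm, ⟨F, X, _, a1, a2, c, hc, a3⟩, F', X', _, b1, b2, c', hc', b3⟩

end IsReparametrization

/-- Every global parametrization of a product of hyperbolas is a reparametrization of the model
one. -/
theorem IsGlobalParam.exists_isReparametrization {σ : Fin n → Bool} {r : Fin n → ℝ}
    (hr : ∀ j, 0 < r j) {f : (Fin n → ℝ) → ParaSpace n}
    (hf : IsGlobalParam f (hyperbolaProduct σ r)) :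
    ∃ ψ g, IsReparametrization f (hyperbolaParam σ r) ψ g := by
  set ψ : (Fin n → ℝ) → Fin n → ℝ := fun s => hyperbolaCoord σ r (f s) with hψ
  have hmem : ∀ s, f s ∈ hyperbolaProduct σ r := fun s => hf.range_eq ▸ Set.mem_range_self s
  have hfψ : ∀ s, hyperbolaParam σ r (ψ s) = f s := fun s => hyperbolaParam_coord hr (hmem s)
  have hψs : ContDiff ℝ ∞ ψ := contDiff_hyperbolaCoord.comp hf.smooth
  have hex : ∀ s, ∃ x, f x = hyperbolaParam σ r s := fun s => by
    have := hyperbolaParam_mem (σ := σ) hr s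
    rwa [← hf.range_eq] at this
  choose g hg using hex
  have hright : ∀ s, ψ (g s) = s := fun s => by
    simp only [hψ, hg, hyperbolaCoord_param hr]
  have hleft : ∀ s, g (ψ s) = s := fun s => hf.embedding.injective (by rw [hg, hfψ])
  -- This uses that `f` is a topological embedding: continuity of `g` can be tested after composing
  -- with `f`.
  have hgc : Continuous g := by
    rw [hf.embedding.continuous_iff]
    rw [show f ∘ g = hyperbolaParam σ r from funext hg]
    exact contDiff_hyperbolaParam.continuous
  let e : (Fin n → ℝ) ≃ₜ (Fin n → ℝ) :=
    ⟨⟨ψ, g, hleft, hright⟩, hψs.continuous, hgc⟩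
  have hd : ∀ s, fderiv ℝ f s = (fderiv ℝ (hyperbolaParam σ r) (ψ s)).comp (fderiv ℝ ψ s) :=
    fun s => by
      rw [show f = fun s => hyperbolaParam σ r (ψ s) from funext fun s => (hfψ s).symm]
      exact fderiv_comp s (contDiff_hyperbolaParam.differentiable (by simp) _)
        (hψs.differentiable (by simp) s)
  have hinj : ∀ s, Function.Injective (fderiv ℝ ψ s) := fun s v w hvw =>
    hf.immersion s (by
      rw [hd, ContinuousLinearMap.comp_apply, ContinuousLinearMap.comp_apply, hvw])
  -- Inverse function theorem: since `f` is an immersion, `ψ'` is injective, hence invertible by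
  -- equality of dimensions.
  have hgs : ContDiff ℝ ∞ g := e.contDiff_symm
    (f₀' := fun s => (LinearEquiv.ofInjectiveEndo
      (fderiv ℝ ψ s : (Fin n → ℝ) →ₗ[ℝ] Fin n → ℝ) (hinj s)).toContinuousLinearEquiv)
    (fun s => (hψs.differentiable (by simp) s).hasFDerivAt) hψs
  exact ⟨ψ, g, hψs, hgs, hleft, hright, funext fun s => (hfψ s).symm⟩

end Reparametrization

theorem mainTheorem5 {n : ℕ} (σ : Fin n → Bool) (r : Fin n → ℝ) (hr : ∀ j, 0 < r j) :
    (∃ f : (Fin n → ℝ) → ParaSpace n, IsGlobalParam f (hyperbolaProduct σ r)) ∧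
    ∀ f : (Fin n → ℝ) → ParaSpace n, IsGlobalParam f (hyperbolaProduct σ r) →
      IsLagrangianParam f ∧ IsHMinimal f ∧
      (n = 1 ∨ n = 2 → IsHStable f) ∧
      (3 ≤ n → IsHUnstable f) := by
  refine ⟨⟨_, isGlobalParam_hyperbolaParam hr⟩, fun f hf => ?_⟩
  obtain ⟨ψ, g, H⟩ := hf.exists_isReparametrization hr
  have hh : ContDiff ℝ ∞ (hyperbolaParam σ r) := contDiff_hyperbolaParam
  exact ⟨H.isLagrangianParam hh isLagrangianParam_hyperbolaParam,
    H.isHMinimal hf.smooth hh (isHMinimal_hyperbolaParam hr),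
    fun hn => H.isHStable hf.smooth hh (isHStable_hyperbolaParam hr hn),
    fun hn => H.isHUnstable hf.smooth hh (isHUnstable_hyperbolaParam hr hn)⟩
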